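/- **Setting.** Let $\Sigma$ be a smooth 4-dimensional manifold (Hausdorff, second countable) with possibly empty boundary $\partial\Sigma$, let $\vec\Phi:\Sigma\to\mathbb{R}^m$ be a smooth immersion, and let $\vec B:\Sigma\to\mathbb{R}^m$ be smooth, compactly supported (its support may meet $\partial\Sigma$; no condition if $\Sigma$ is compact) and normal, i.e. $\vec B(p)\perp d\vec\Phi_p(T_p\Sigma)$ for all $p\in\Sigma$. Write $g_{ij}=\partial_i\vec\Phi\cdot\partial_j\vec\Phi$ for the induced metric, $\nabla$ for its Levi-Civita covariant derivative (acting componentwise on $\mathbb{R}^m$-valued tensors; indices are raised with $g^{ij}$ and repeated indices are summed), $d\mu$ for its volume measure, $d\sigma$ for the induced volume measure of $\partial\Sigma$, $\eta$ for the outward unit conormal along $\partial\Sigma$, $\vec h_{ij}=\nabla_i\nabla_j\vec\Phi$, $\vec H=\frac14 g^{ij}\vec h_{ij}$, $\pi_{\vec n}$ for the orthogonal projection of $\mathbb{R}^m$ onto the normal space, and $\Delta_\perp\vec X=g^{ij}\pi_{\vec n}\nabla_i\pi_{\vec n}\nabla_j\vec X$. Also $|\pi_{\vec n}\nabla\vec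 H|^2=g^{ij}\,\pi_{\vec n}\nabla_i\vec H\cdot\pi_{\vec n}\nabla_j\vec H$ and $|\vec H\cdot\vec h|^2=(\vec H\cdot\vec h^{ij})(\vec H\cdot\vec h_{ij})$. For measurable $K\subseteq\Sigma$ put $$\mathcal E_K(\vec\Phi)=\int_K\big(|\pi_{\vec n}\nabla\vec H|^2-|\vec H\cdot\vec h|^2+7|\vec H|^4\big)\,d\mu .$$ **Theorem.** Define $$\begin{aligned} \vec{\mathcal W}={}&-\tfrac12\Delta_\perp^2\vec H-\tfrac12(\vec h_{ik}\cdot\Delta_\perp\vec H)\vec h^{ik}-4|\pi_{\vec n}\nabla\vec H|^2\vec H+2\pi_{\vec n}\nabla_j\big((\vec h^j_i\cdot\nabla^i\vec H)\vec H\big)\\ &-2\pi_{\vec n}\nabla_j\big((\vec H\cdot\vec h^j_i)\pi_{\vec n}\nabla^i\vec H\big)+2(\pi_{\vec n}\nabla_i\vec H\cdot\pi_{\vec n}\nabla_j\vec H)\vec h^{ij}-\tfrac12\Delta_\perp\big((\vec H\cdot\vec h^{ij})\vec h_{ij}\big)\\ &-2\pi_{\vec n}\nabla_i\nabla_k\big((\vec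 H\cdot\vec h^{ik})\vec H\big)-28|\vec H|^4\vec H-\tfrac12(\vec H\cdot\vec h^{ij})(\vec h_{ij}\cdot\vec h_{pq})\vec h^{pq}\\ &-4(\vec H\cdot\vec h_{ij})(\vec H\cdot\vec h^i_k)\vec h^{jk}+4|\vec H\cdot\vec h|^2\vec H+7\Delta_\perp(|\vec H|^2\vec H)+7|\vec H|^2(\vec H\cdot\vec h_{ij})\vec h^{ij} \end{aligned}$$ and the vector field $$\begin{aligned} V^j={}&\tfrac12(\nabla^j\vec H\cdot\vec h^{ik})(\vec B\cdot\vec h_{ik})+\tfrac12\nabla^j\vec H\cdot\Delta_\perp\vec B-2(\nabla^i\vec H\cdot\vec h_i^j)(\vec H\cdot\vec B)+2(\nabla^i\vec H\cdot\vec B)(\vec H\cdot\vec h_i^j)\\ &-\tfrac12\Delta_\perp\vec H\cdot\nabla^j\vec B+\tfrac12\nabla^j\Delta_\perp\vec H\cdot\vec B-\tfrac12(\vec H\cdot\vec h^{ik})(\vec h_{ik}\cdot\nabla^j\vec B)+\tfrac12\pi_{\vec n}\nabla^j\big((\vec H\cdot\vec h^{ik})\vec h_{ik}\big)\cdot\vec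 B\\ &-2(\vec H\cdot\vec h^{ij})(\vec H\cdot\nabla_i\vec B)+2\pi_{\vec n}\nabla_i\big((\vec H\cdot\vec h^{ij})\vec H\big)\cdot\vec B+7|\vec H|^2\vec H\cdot\nabla^j\vec B-7\pi_{\vec n}\nabla^j(|\vec H|^2\vec H)\cdot\vec B . \end{aligned}$$ Then $\vec B\cdot\vec{\mathcal W}$ is $\mu$-integrable on $\Sigma$, $V^j\eta_j$ is $\sigma$-integrable on $\partial\Sigma$, and the energy density of $\vec\Phi$ is integrable on every compact subset of $\Sigma$. For every measurable $K\subseteq\Sigma$ that contains the support of $\vec B$ and on which the energy density of $\vec\Phi$ is integrable (for instance $K=\Sigma$ if $\Sigma$ is compact), the energy density of $\vec\Phi+t\vec B$ is integrable on $K$ with respect to its own volume measure for all $t$ near $0$, the function $t\mapsto\mathcal E_K(\vec\Phi+t\vec B)$ is differentiable at $t=0$, and $$\frac{d}{dt}\Big|_{t=0}\mathcal E_K(\vec\Phi+t\vec B)=\int_\Sigma\vec B\cdot\vec{\mathcal W}\,d\mu+\int_{\partial\Sigma}V^j\eta_j\,d\sigma .$$ -/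

import Mathlib

open MeasureTheory Filter Topology
open scoped Manifold ContDiff InnerProductSpace

noncomputable section

namespace FourWillmore

/-- Coordinate space of a chart of a 4-manifold. Coordinates are indexed by `0, 1, 2, 3`; charts of
a manifold with boundary take values in `{y | 0 ≤ y 0}`, the boundary being `{y | y 0 = 0}`. -/
abbrev Coord : Type := EuclideanSpace ℝ (Fin 4)

/-- The ambient Euclidean space `ℝ^m`. -/
abbrev Amb (m : ℕ) : Type := EuclideanSpace ℝ (Fin m)

/-- The closed half space in which all coordinate computations take place. -/
def halfSpace : Set Coord := {y | 0 ≤ y 0}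

/-- The partial derivative `∂_i f`, one-sided at the boundary of the half space. -/
def pd {W : Type*} [NormedAddCommGroup W] [NormedSpace ℝ W] (i : Fin 4) (f : Coord → W)
    (y : Coord) : W :=
  fderivWithin ℝ f halfSpace y (EuclideanSpace.single i 1)

section Local

/-! ### Geometry of a parametrised immersion `F : {y | 0 ≤ y 0} → ℝ^m` -/

variable {m : ℕ}

/-- First fundamental form `g_{ij} = ∂_i F · ∂_j F`. -/
def metric (F : Coord → Amb m) (y : Coord) : Matrix (Fin 4) (Fin 4) ℝ :=
  Matrix.of fun i j => ⟪pd i F y, pd j F y⟫_ℝ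

/-- Inverse metric `g^{ij}`. -/
def metricInv (F : Coord → Amb m) (y : Coord) : Matrix (Fin 4) (Fin 4) ℝ :=
  (metric F y)⁻¹

/-- Christoffel symbols `Γ^k_{ij}` of the Levi-Civita connection of `g`. -/
def christoffel (F : Coord → Amb m) (k i j : Fin 4) (y : Coord) : ℝ :=
  (1 / 2) * ∑ l, metricInv F y k l *
    (pd i (fun z => metric F z j l) y + pd j (fun z => metric F z i l) y
      - pd l (fun z => metric F z i j) y)

/-- `∇_i T_j` for a (vector valued) tensor with one lower index. -/
def nablaLow {W : Type*} [NormedAddCommGroup W] [NormedSpace ℝ W] (F : Coord → Amb m)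
    (T : Fin 4 → Coord → W) (i j : Fin 4) (y : Coord) : W :=
  pd i (T j) y - ∑ k, christoffel F k i j y • T k y

/-- `∇_i T^j` for a (vector valued) tensor with one upper index. -/
def nablaUp {W : Type*} [NormedAddCommGroup W] [NormedSpace ℝ W] (F : Coord → Amb m)
    (T : Fin 4 → Coord → W) (i j : Fin 4) (y : Coord) : W :=
  pd i (T j) y + ∑ k, christoffel F j i k y • T k y

/-- `∇_i T^{jk}` for a (vector valued) tensor with two upper indices. -/
def nablaUpUp {W : Type*} [NormedAddCommGroup W] [NormedSpace ℝ W] (F : Coord → Amb m)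
    (T : Fin 4 → Fin 4 → Coord → W) (i j k : Fin 4) (y : Coord) : W :=
  pd i (T j k) y + ∑ l, christoffel F j i l y • T l k y + ∑ l, christoffel F k i l y • T j l y

/-- `∇^i X = g^{ij} ∂_j X` for an `ℝ^m`-valued field `X` (componentwise gradient). -/
def grad (F : Coord → Amb m) (X : Coord → Amb m) (i : Fin 4) (y : Coord) : Amb m :=
  ∑ j, metricInv F y i j • pd j X y

/-- Normal projection `π_n X = X - g^{ij} (X · ∂_i F) ∂_j F`. -/
def normalPart (F : Coord → Amb m) (X : Coord → Amb m) (y : Coord) : Amb m :=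
  X y - ∑ i, ∑ j, (metricInv F y i j * ⟪X y, pd i F y⟫_ℝ) • pd j F y

/-- Second fundamental form `h_{ij} = ∇_i ∇_j F`. -/
def sff (F : Coord → Amb m) (i j : Fin 4) (y : Coord) : Amb m :=
  nablaLow F (fun k => pd k F) i j y

/-- `h^i_j = g^{ik} h_{kj}`. -/
def sffMixed (F : Coord → Amb m) (i j : Fin 4) (y : Coord) : Amb m :=
  ∑ k, metricInv F y i k • sff F k j y

/-- `h^{ij} = g^{ik} g^{jl} h_{kl}`. -/
def sffUp (F : Coord → Amb m) (i j : Fin 4) (y : Coord) : Amb m :=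
  ∑ k, ∑ l, (metricInv F y i k * metricInv F y j l) • sff F k l y

/-- Mean curvature vector, `4 H = g^{ij} h_{ij}`. -/
def meanCurv (F : Coord → Amb m) (y : Coord) : Amb m :=
  (1 / 4 : ℝ) • ∑ i, ∑ j, metricInv F y i j • sff F i j y

/-- `π_n ∇_i X`. -/
def normalPd (F : Coord → Amb m) (i : Fin 4) (X : Coord → Amb m) (y : Coord) : Amb m :=
  normalPart F (pd i X) y

/-- `π_n ∇^i X`. -/
def normalGrad (F : Coord → Amb m) (X : Coord → Amb m) (i : Fin 4) (y : Coord) : Amb m :=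
  normalPart F (grad F X i) y

/-- `Δ_⊥ X = g^{ij} π_n ∇_i π_n ∇_j X`. -/
def lapPerp (F : Coord → Amb m) (X : Coord → Amb m) (y : Coord) : Amb m :=
  ∑ i, ∑ j, metricInv F y i j •
    normalPart F (nablaLow F (fun k => normalPd F k X) i j) y

/-- `|π_n ∇H|² = g^{ij} (π_n ∇_i H) · (π_n ∇_j H)`. -/
def normSqNormalGradH (F : Coord → Amb m) (y : Coord) : ℝ :=
  ∑ i, ∑ j, metricInv F y i j *
    ⟪normalPd F i (meanCurv F) y, normalPd F j (meanCurv F) y⟫_ℝ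

/-- `|H · h|² = (H · h^{ij}) (H · h_{ij})`. -/
def normSqHh (F : Coord → Amb m) (y : Coord) : ℝ :=
  ∑ i, ∑ j, ⟪meanCurv F y, sffUp F i j y⟫_ℝ * ⟪meanCurv F y, sff F i j y⟫_ℝ

/-- The integrand `|π_n ∇H|² - |H · h|² + 7 |H|⁴`. -/
def localDensity (F : Coord → Amb m) (y : Coord) : ℝ :=
  normSqNormalGradH F y - normSqHh F y + 7 * ‖meanCurv F y‖ ^ 4

/-- `|H|² H`. -/
def cubicH (F : Coord → Amb m) (y : Coord) : Amb m :=
  ‖meanCurv F y‖ ^ 2 • meanCurv F y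

/-- `(H · h^{ij}) h_{ij}`. -/
def hhH (F : Coord → Amb m) (y : Coord) : Amb m :=
  ∑ i, ∑ j, ⟪meanCurv F y, sffUp F i j y⟫_ℝ • sff F i j y

/-- `(H · h^{ij}) H`. -/
def HhH (F : Coord → Amb m) (i j : Fin 4) (y : Coord) : Amb m :=
  ⟪meanCurv F y, sffUp F i j y⟫_ℝ • meanCurv F y

/-- `∇_k ((H · h^{ik}) H)`. -/
def divHhH (F : Coord → Amb m) (i : Fin 4) (y : Coord) : Amb m :=
  ∑ k, nablaUpUp F (HhH F) k i k y

/-- The 4-Willmore operator `𝒲`. -/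
def localWillmore (F : Coord → Amb m) (y : Coord) : Amb m :=
  -(1 / 2 : ℝ) • lapPerp F (lapPerp F (meanCurv F)) y
  - (1 / 2 : ℝ) • ∑ i, ∑ k, ⟪sff F i k y, lapPerp F (meanCurv F) y⟫_ℝ • sffUp F i k y
  - (4 * normSqNormalGradH F y) • meanCurv F y
  + (2 : ℝ) • normalPart F (fun z => ∑ j, nablaUp F
      (fun j w => ∑ i, ⟪sffMixed F j i w, grad F (meanCurv F) i w⟫_ℝ • meanCurv F w) j j z) y
  - (2 : ℝ) • normalPart F (fun z => ∑ j, nablaUp F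
      (fun j w => ∑ i, ⟪meanCurv F w, sffMixed F j i w⟫_ℝ •
        normalGrad F (meanCurv F) i w) j j z) y
  + (2 : ℝ) • ∑ i, ∑ j,
      ⟪normalPd F i (meanCurv F) y, normalPd F j (meanCurv F) y⟫_ℝ • sffUp F i j y
  - (1 / 2 : ℝ) • lapPerp F (hhH F) y
  - (2 : ℝ) • normalPart F (fun z => ∑ i, nablaUp F (divHhH F) i i z) y
  - (28 * ‖meanCurv F y‖ ^ 4) • meanCurv F y
  - (1 / 2 : ℝ) • ∑ i, ∑ j, ∑ p, ∑ q,
      (⟪meanCurv F y, sffUp F i j y⟫_ℝ * ⟪sff F i j y, sff F p q y⟫_ℝ) • sffUp F p q y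
  - (4 : ℝ) • ∑ i, ∑ j, ∑ k,
      (⟪meanCurv F y, sff F i j y⟫_ℝ * ⟪meanCurv F y, sffMixed F i k y⟫_ℝ) • sffUp F j k y
  + (4 * normSqHh F y) • meanCurv F y
  + (7 : ℝ) • lapPerp F (cubicH F) y
  + (7 * ‖meanCurv F y‖ ^ 2) • ∑ i, ∑ j, ⟪meanCurv F y, sff F i j y⟫_ℝ • sffUp F i j y

/-- The components `V^j` of the flux field of the variation `b`. -/
def localFlux (F b : Coord → Amb m) (j : Fin 4) (y : Coord) : ℝ :=
  (1 / 2) * ∑ i, ∑ k,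
      ⟪grad F (meanCurv F) j y, sffUp F i k y⟫_ℝ * ⟪b y, sff F i k y⟫_ℝ
  + (1 / 2) * ⟪grad F (meanCurv F) j y, lapPerp F b y⟫_ℝ
  - 2 * (∑ i, ⟪grad F (meanCurv F) i y, sffMixed F j i y⟫_ℝ) * ⟪meanCurv F y, b y⟫_ℝ
  + 2 * ∑ i, ⟪grad F (meanCurv F) i y, b y⟫_ℝ * ⟪meanCurv F y, sffMixed F j i y⟫_ℝ
  - (1 / 2) * ⟪lapPerp F (meanCurv F) y, grad F b j y⟫_ℝ
  + (1 / 2) * ⟪grad F (lapPerp F (meanCurv F)) j y, b y⟫_ℝ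
  - (1 / 2) * ∑ i, ∑ k,
      ⟪meanCurv F y, sffUp F i k y⟫_ℝ * ⟪sff F i k y, grad F b j y⟫_ℝ
  + (1 / 2) * ⟪normalGrad F (hhH F) j y, b y⟫_ℝ
  - 2 * ∑ i, ⟪meanCurv F y, sffUp F i j y⟫_ℝ * ⟪meanCurv F y, pd i b y⟫_ℝ
  + 2 * ⟪normalPart F (fun z => ∑ i, nablaUpUp F (HhH F) i i j z) y, b y⟫_ℝ
  + 7 * ‖meanCurv F y‖ ^ 2 * ⟪meanCurv F y, grad F b j y⟫_ℝ
  - 7 * ⟪normalGrad F (cubicH F) j y, b y⟫_ℝ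

/-- Covector components `η_j` of the outward unit conormal along `{y | y 0 = 0}`: since the
manifold is `{y | 0 ≤ y 0}`, it is `-dy⁰ / |dy⁰|_g`. -/
def conormal (F : Coord → Amb m) (j : Fin 4) (y : Coord) : ℝ :=
  if j = 0 then -(1 / Real.sqrt (metricInv F y 0 0)) else 0

/-- Volume density `|g|^{1/2}`. -/
def volDensity (F : Coord → Amb m) (y : Coord) : ℝ :=
  Real.sqrt (metric F y).det

/-- Volume density of the metric induced on the boundary `{y | y 0 = 0}`, with coordinates
`y 1, y 2, y 3`. -/
def bdryDensity (F : Coord → Amb m) (y : Coord) : ℝ :=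
  Real.sqrt ((metric F y).submatrix Fin.succ Fin.succ).det

end Local

section Global

/-! ### Global objects on a 4-manifold `M` with (possibly empty) boundary -/

variable {m : ℕ} {M : Type*} [TopologicalSpace M] [ChartedSpace (EuclideanHalfSpace 4) M]

/-- The field `X` on `M` read in the preferred chart at `p`. -/
def read (X : M → Amb m) (p : M) : Coord → Amb m :=
  X ∘ (extChartAt (𝓡∂ 4) p).symm

/-- The coordinates of `p` in the preferred chart at `p`. -/
def pt (p : M) : Coord := extChartAt (𝓡∂ 4) p p

/-- `|π_n ∇H|² - |H · h|² + 7 |H|⁴` as a function on `M`. -/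
def energyDensity (Φ : M → Amb m) (p : M) : ℝ :=
  localDensity (read Φ p) (pt p)

/-- The 4-Willmore operator `𝒲` as an `ℝ^m`-valued function on `M`. -/
def willmore (Φ : M → Amb m) (p : M) : Amb m :=
  localWillmore (read Φ p) (pt p)

/-- The flux `V^j η_j` at boundary points of `M`, `η` being the outward unit conormal. -/
def flux (Φ B : M → Amb m) (p : M) : ℝ :=
  ∑ j, localFlux (read Φ p) (read B p) j (pt p) * conormal (read Φ p) j (pt p)

variable [MeasurableSpace M]

/-- The measure `|g|^{1/2} dy` of the preferred chart at `x`, as a measure on `M`. -/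
def chartVolume (Φ : M → Amb m) (x : M) : Measure M :=
  ((volume.restrict (extChartAt (𝓡∂ 4) x).target).withDensity
      fun y => ENNReal.ofReal (volDensity (read Φ x) y)).map (extChartAt (𝓡∂ 4) x).symm

/-- The Riemannian volume measure `dμ` of the metric induced by `Φ`: the least measure dominating
all the measures `|g|^{1/2} dy` of the charts. As these agree on overlaps of charts, it is the
measure that restricts to `|g|^{1/2} dy` in every chart. -/
def vol (Φ : M → Amb m) : Measure M := ⨆ x : M, chartVolume Φ x

/-- The point `(0, z₀, z₁, z₂)` of the boundary of the half space. -/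
def bdryPoint (z : EuclideanSpace ℝ (Fin 3)) : Coord :=
  WithLp.toLp 2 (Fin.cons 0 fun i => z i)

/-- The boundary volume measure of the preferred chart at `x`, as a measure on `M`. -/
def chartBdryVolume (Φ : M → Amb m) (x : M) : Measure M :=
  ((volume.restrict (bdryPoint ⁻¹' (extChartAt (𝓡∂ 4) x).target)).withDensity
      fun z => ENNReal.ofReal (bdryDensity (read Φ x) (bdryPoint z))).map
    fun z => (extChartAt (𝓡∂ 4) x).symm (bdryPoint z)

/-- The Riemannian volume measure `dσ` of the boundary of `M`, as a measure on `M` carried by the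
boundary; glued from charts in the same way as `vol`. -/
def bdryVol (Φ : M → Amb m) : Measure M := ⨆ x : M, chartBdryVolume Φ x

/-- The energy `∫_K (|π_n ∇H|² - |H · h|² + 7 |H|⁴) dμ` of the part `K` of `M`. -/
def energy (Φ : M → Amb m) (K : Set M) : ℝ :=
  ∫ p in K, energyDensity Φ p ∂(vol Φ)

end Global

end FourWillmore

end

/-!
The variation is computed pointwise in charts and integrated afterwards.

**In a chart.** Let `F` be an immersion of a relatively open subset of the half space and `b` a
normal field. The energy density times `√g` is a smooth function `jetEnergy` of the derivatives of
`F` of orders one to three, and these move along a line when `F` moves along `F + t b`. The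
pointwise first variation formula `Imm.hasDerivAt_jetEnergy` states that the derivative at `t = 0`
is `√g (b · 𝒲 + ∇_j V^j)`. It rests on the variations of the inverse metric
(`Imm.hasDerivAt_gramInv`), of the volume density (`Imm.hasDerivAt_vol`) and of the mean
curvature, whose normal part is `¼ (Δ_⊥ b + (b · h^{ij}) h_{ij})` (`Imm.nproj_varH`) and whose
tangential part is found by differentiating `H · ∂_k F = 0` (`Imm.inner_varH_frame`). Derivatives
are then moved from `b` onto the curvature terms. The divergences that arise add up to that of `V`
(`Imm.localFlux_eq`), and what remains is `b · 𝒲` (`inner_localWillmore`).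

**Change of coordinates.** The energy density, the flux field `V` and its flux through the
boundary are invariant (`Transition.localDensity_eq`, `Transition.localFlux_eq`,
`Transition.flux_eq`). The invariance of `b · 𝒲` (`Transition.inner_localWillmore_eq`) needs no
computation with the long expression for `𝒲`: by the pointwise formula, `√g b · 𝒲` is the
variation of the invariant energy less the invariant divergence of `V`. The same identity gives
the continuity of `B · 𝒲` on the manifold. The chart measures agree on overlaps
(`chartVolume_compat`, `chartBdryVolume_compat`), so that their suprema, the measures `vol` and
`bdryVol`, restrict to them (`iSup_measure_apply`).

**On the manifold.** For small `t` the map `Φ + t B` is an immersion, by compactness of the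
support of `B` (`eventually_isImm`). Off this support neither the energy density nor the volume
measure depends on `t` (`energy_diff_tsupport`). On the support, a partition of unity reduces the
derivative to integrals over compact subsets of charts, which may be differentiated under the
integral sign (`hasDerivAt_integral_tsupport`). This yields the integral of `B · 𝒲 + ∇_j V^j`, and
the divergence theorem (`integral_divFlux`), which the same partition reduces to the divergence
theorem in the half space (`integral_divergence_halfSpace`), turns the second summand into the
boundary term.
-/

noncomputable section

namespace FourWillmore

/-! ### Partial derivatives on relatively open subsets of the half space -/

/-- `U` is an open subset of the closed half space. -/
structure RelOpen (U : Set Coord) : Prop where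
  subset : U ⊆ halfSpace
  mem_nhdsWithin : ∀ y ∈ U, U ∈ 𝓝[halfSpace] y

lemma halfSpace_eq_range : halfSpace = Set.range (𝓡∂ 4) := by
  rw [range_modelWithCornersEuclideanHalfSpace]; rfl

lemma uniqueDiffOn_halfSpace : UniqueDiffOn ℝ halfSpace := by
  rw [halfSpace_eq_range]; exact (𝓡∂ 4).uniqueDiffOn

lemma isClosed_halfSpace : IsClosed halfSpace :=
  isClosed_le continuous_const (by fun_prop)

section Calculus

variable {U : Set Coord} {W W₁ W₂ : Type*} [NormedAddCommGroup W] [NormedSpace ℝ W]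
  [NormedAddCommGroup W₁] [NormedSpace ℝ W₁] [NormedAddCommGroup W₂] [NormedSpace ℝ W₂]
  {y : Coord} {f g : Coord → W} {m : ℕ}

lemma RelOpen.nhdsWithin_eq (hU : RelOpen U) (hy : y ∈ U) : 𝓝[U] y = 𝓝[halfSpace] y :=
  le_antisymm (nhdsWithin_mono _ hU.subset) (nhdsWithin_le_iff.2 (hU.mem_nhdsWithin y hy))

lemma RelOpen.uniqueDiffOn (hU : RelOpen U) : UniqueDiffOn ℝ U := fun y hy =>
  (uniqueDiffOn_halfSpace y (hU.subset hy)).mono_nhds (hU.nhdsWithin_eq hy).ge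

lemma RelOpen.inter_isOpen (hU : RelOpen U) {O : Set Coord} (hO : IsOpen O) : RelOpen (U ∩ O) :=
  ⟨fun _ h => hU.subset h.1, fun y h =>
    inter_mem (hU.mem_nhdsWithin y h.1) (mem_nhdsWithin_of_mem_nhds (hO.mem_nhds h.2))⟩

lemma RelOpen.inter_preimage (hU : RelOpen U) {Z : Type*} [TopologicalSpace Z] {ψ : Coord → Z}
    (hψ : ContinuousOn ψ U) {O : Set Z} (hO : IsOpen O) : RelOpen (U ∩ ψ ⁻¹' O) := by
  refine ⟨fun _ h => hU.subset h.1, fun y h => ?_⟩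
  refine inter_mem (hU.mem_nhdsWithin y h.1) ?_
  have := (hψ y h.1).preimage_mem_nhdsWithin (hO.mem_nhds h.2)
  rwa [hU.nhdsWithin_eq h.1] at this

lemma RelOpen.fderivWithin_eq (hU : RelOpen U) (hy : y ∈ U) :
    fderivWithin ℝ f halfSpace y = fderivWithin ℝ f U y :=
  fderivWithin_congr_set' y <| by
    have := hU.mem_nhdsWithin y hy
    filter_upwards [nhdsWithin_le_nhds (s := {y}ᶜ) (mem_nhdsWithin_iff_eventually.1 this)]
      with z hz
    exact propext ⟨fun h => hz h, fun h => hU.subset h⟩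

lemma RelOpen.pd_eq (hU : RelOpen U) (hy : y ∈ U) (i : Fin 4) :
    pd i f y = fderivWithin ℝ f U y (EuclideanSpace.single i 1) := by
  rw [pd, hU.fderivWithin_eq hy]

lemma RelOpen.diff (hU : RelOpen U) (hf : ContDiffOn ℝ ∞ f U) (hy : y ∈ U) :
    DifferentiableWithinAt ℝ f halfSpace y :=
  ((hf.differentiableOn (by simp)) y hy).mono_of_mem_nhdsWithin (hU.mem_nhdsWithin y hy)

lemma RelOpen.hasFDerivWithinAt (hU : RelOpen U) (hf : ContDiffOn ℝ ∞ f U) (hy : y ∈ U) :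
    HasFDerivWithinAt f (fderivWithin ℝ f halfSpace y) halfSpace y :=
  (hU.diff hf hy).hasFDerivWithinAt

lemma RelOpen.contDiffOn_fderivWithin (hU : RelOpen U) (hf : ContDiffOn ℝ ∞ f U) :
    ContDiffOn ℝ ∞ (fderivWithin ℝ f halfSpace) U :=
  (hf.fderivWithin hU.uniqueDiffOn (m := ∞) (by simp)).congr fun _ hy => hU.fderivWithin_eq hy

lemma RelOpen.pd_smooth (hU : RelOpen U) (hf : ContDiffOn ℝ ∞ f U) (i : Fin 4) :
    ContDiffOn ℝ ∞ (pd i f) U :=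
  (hU.contDiffOn_fderivWithin hf).clm_apply contDiffOn_const

lemma RelOpen.ud (hU : RelOpen U) (hy : y ∈ U) : UniqueDiffWithinAt ℝ halfSpace y :=
  uniqueDiffOn_halfSpace y (hU.subset hy)

lemma pd_of_hasFDerivWithinAt (hU : RelOpen U) (hy : y ∈ U) {f' : Coord →L[ℝ] W}
    (h : HasFDerivWithinAt f f' halfSpace y) (i : Fin 4) :
    pd i f y = f' (EuclideanSpace.single i 1) := by
  rw [pd, h.fderivWithin (hU.ud hy)]

lemma RelOpen.pd_congr (hU : RelOpen U) (h : ∀ z ∈ U, f z = g z) (hy : y ∈ U) (i : Fin 4) :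
    pd i f y = pd i g y := by
  rw [hU.pd_eq hy, hU.pd_eq hy, fderivWithin_congr h (h y hy)]

lemma RelOpen.pd_add (hU : RelOpen U) (hf : ContDiffOn ℝ ∞ f U) (hg : ContDiffOn ℝ ∞ g U)
    (hy : y ∈ U) (i : Fin 4) : pd i (fun z => f z + g z) y = pd i f y + pd i g y :=
  (pd_of_hasFDerivWithinAt hU hy
    ((hU.hasFDerivWithinAt hf hy).add (hU.hasFDerivWithinAt hg hy)) i).trans rfl

lemma RelOpen.pd_sub (hU : RelOpen U) (hf : ContDiffOn ℝ ∞ f U) (hg : ContDiffOn ℝ ∞ g U)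
    (hy : y ∈ U) (i : Fin 4) : pd i (fun z => f z - g z) y = pd i f y - pd i g y :=
  (pd_of_hasFDerivWithinAt hU hy
    ((hU.hasFDerivWithinAt hf hy).sub (hU.hasFDerivWithinAt hg hy)) i).trans rfl

lemma RelOpen.pd_const_smul (hU : RelOpen U) (hf : ContDiffOn ℝ ∞ f U) (c : ℝ)
    (hy : y ∈ U) (i : Fin 4) : pd i (fun z => c • f z) y = c • pd i f y :=
  (pd_of_hasFDerivWithinAt hU hy ((hU.hasFDerivWithinAt hf hy).const_smul c) i).trans rfl

lemma RelOpen.pd_sum (hU : RelOpen U) {ι : Type*} (s : Finset ι) {f : ι → Coord → W}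
    (hf : ∀ k ∈ s, ContDiffOn ℝ ∞ (f k) U) (hy : y ∈ U) (i : Fin 4) :
    pd i (fun z => ∑ k ∈ s, f k z) y = ∑ k ∈ s, pd i (f k) y := by
  rw [pd_of_hasFDerivWithinAt hU hy (HasFDerivWithinAt.fun_sum
    fun k hk => hU.hasFDerivWithinAt (hf k hk) hy)]
  simp [pd]

lemma RelOpen.pd_smul (hU : RelOpen U) {c : Coord → ℝ} (hc : ContDiffOn ℝ ∞ c U)
    (hf : ContDiffOn ℝ ∞ f U) (hy : y ∈ U) (i : Fin 4) :
    pd i (fun z => c z • f z) y = pd i c y • f y + c y • pd i f y := by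
  rw [pd_of_hasFDerivWithinAt hU hy
    ((hU.hasFDerivWithinAt hc hy).fun_smul (hU.hasFDerivWithinAt hf hy))]
  simp [pd, add_comm]

lemma RelOpen.pd_mul (hU : RelOpen U) {c d : Coord → ℝ} (hc : ContDiffOn ℝ ∞ c U)
    (hd : ContDiffOn ℝ ∞ d U) (hy : y ∈ U) (i : Fin 4) :
    pd i (fun z => c z * d z) y = pd i c y * d y + c y * pd i d y :=
  hU.pd_smul hc hd hy i

lemma RelOpen.pd_inner (hU : RelOpen U) {X Y : Coord → Amb m} (hX : ContDiffOn ℝ ∞ X U)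
    (hY : ContDiffOn ℝ ∞ Y U) (hy : y ∈ U) (i : Fin 4) :
    pd i (fun z => ⟪X z, Y z⟫_ℝ) y = ⟪pd i X y, Y y⟫_ℝ + ⟪X y, pd i Y y⟫_ℝ := by
  rw [pd_of_hasFDerivWithinAt hU hy
    ((hU.hasFDerivWithinAt hX hy).inner ℝ (hU.hasFDerivWithinAt hY hy))]
  simp [pd, add_comm]

lemma pd_const (hU : RelOpen U) (hy : y ∈ U) (c : W) (i : Fin 4) :
    pd i (fun _ => c) y = 0 := by
  rw [pd_of_hasFDerivWithinAt hU hy (hasFDerivWithinAt_const c y _)]; rfl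

lemma halfSpace_subset_closure_interior : halfSpace ⊆ closure (interior halfSpace) := by
  rw [halfSpace_eq_range]
  exact (𝓡∂ 4).range_subset_closure_interior

lemma RelOpen.pd_comm (hU : RelOpen U) (hf : ContDiffOn ℝ ∞ f U) (hy : y ∈ U) (i j : Fin 4) :
    pd i (pd j f) y = pd j (pd i f) y := by
  have hd : DifferentiableWithinAt ℝ (fderivWithin ℝ f halfSpace) halfSpace y :=
    hU.diff (hU.contDiffOn_fderivWithin hf) hy
  have key : ∀ a b : Fin 4, pd a (pd b f) y
      = fderivWithin ℝ (fderivWithin ℝ f halfSpace) halfSpace y (EuclideanSpace.single a 1)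
        (EuclideanSpace.single b 1) := fun a b => by
    have h := hd.hasFDerivWithinAt.clm_apply
      (hasFDerivWithinAt_const (EuclideanSpace.single b (1 : ℝ)) y halfSpace)
    have h2 := pd_of_hasFDerivWithinAt hU hy h a
    simp only [ContinuousLinearMap.comp_zero, zero_add] at h2
    refine h2.trans ?_
    simp
  rw [key, key]
  have hc : ContDiffWithinAt ℝ ∞ f halfSpace y :=
    (hf y hy).mono_of_mem_nhdsWithin (hU.mem_nhdsWithin y hy)
  exact (hc.isSymmSndFDerivWithinAt
    (by simp only [minSmoothness_of_isRCLikeNormedField]; exact ENat.LEInfty.out)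
    uniqueDiffOn_halfSpace
    (halfSpace_subset_closure_interior (hU.subset hy)) (hU.subset hy)) _ _

/-- Chain rule for the outer map differentiable at the image point. -/
lemma RelOpen.pd_comp (hU : RelOpen U) {j : Coord → W₁} (hj : ContDiffOn ℝ ∞ j U) (hy : y ∈ U)
    {G : W₁ → W} (hG : DifferentiableAt ℝ G (j y)) (i : Fin 4) :
    pd i (fun z => G (j z)) y = fderiv ℝ G (j y) (pd i j y) := by
  exact (pd_of_hasFDerivWithinAt hU hy
    (hG.hasFDerivAt.comp_hasFDerivWithinAt y (hU.hasFDerivWithinAt hj hy)) i).trans rfl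

end Calculus

/-! ### Determinants and inverses of matrix valued functions -/

section Matrix

variable {n : Type*} [Fintype n] [DecidableEq n] {E : Type*} [NormedAddCommGroup E]
  [NormedSpace ℝ E]

lemma contDiffOn_det {g : E → Matrix n n ℝ} {s : Set E}
    (hg : ∀ i j, ContDiffOn ℝ ∞ (fun z => g z i j) s) :
    ContDiffOn ℝ ∞ (fun z => (g z).det) s := by
  simp only [Matrix.det_apply']
  exact ContDiffOn.sum fun σ _ => contDiffOn_const.mul (contDiffOn_prod fun i _ => hg _ _)

lemma contDiffOn_inv {g : E → Matrix n n ℝ} {s : Set E}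
    (hg : ∀ i j, ContDiffOn ℝ ∞ (fun z => g z i j) s) (h0 : ∀ z ∈ s, (g z).det ≠ 0) (i j : n) :
    ContDiffOn ℝ ∞ (fun z => (g z)⁻¹ i j) s := by
  simp only [Matrix.inv_def, Ring.inverse_eq_inv', Matrix.smul_apply, smul_eq_mul,
    Matrix.adjugate_apply]
  refine ((contDiffOn_det hg).inv h0).mul (contDiffOn_det fun a b => ?_)
  simp only [Matrix.updateRow_apply]
  split_ifs
  · exact contDiffOn_const
  · exact hg a b

/-- Jacobi's formula for the derivative of a determinant. -/
lemma hasFDerivWithinAt_det {g : E → Matrix n n ℝ} {g' : n → n → E →L[ℝ] ℝ} {s : Set E} {y : E}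
    (hg : ∀ i j, HasFDerivWithinAt (fun z => g z i j) (g' i j) s y) :
    HasFDerivWithinAt (fun z => (g z).det) (∑ i, ∑ j, (g y).adjugate j i • g' i j) s y := by
  let D : ContinuousMultilinearMap ℝ (fun _ : n => n → ℝ) ℝ :=
    ⟨(Matrix.detRowAlternating (R := ℝ) (n := n)).toMultilinearMap,
      Continuous.matrix_det (A := fun x : n → n → ℝ => (x : Matrix n n ℝ)) continuous_id⟩
  have hD : ∀ A : n → n → ℝ, D A = (Matrix.of A).det := fun A => rfl
  have h1 : HasFDerivWithinAt (fun z => (fun i j => g z i j : n → n → ℝ))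
      (ContinuousLinearMap.pi fun i => ContinuousLinearMap.pi fun j => g' i j) s y :=
    hasFDerivWithinAt_pi.2 fun i => hasFDerivWithinAt_pi.2 fun j => hg i j
  have h2 := (D.hasFDerivAt (fun i j => g y i j)).comp_hasFDerivWithinAt y h1
  refine (h2.congr_fderiv ?_)
  ext v
  simp only [ContinuousLinearMap.comp_apply, ContinuousMultilinearMap.linearDeriv_apply,
    _root_.sum_apply, _root_.smul_apply, smul_eq_mul]
  refine Finset.sum_congr rfl fun i _ => ?_
  have h3 : D (Function.update (fun i j => g y i j) i fun j => g' i j v)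
      = (Matrix.cramer (g y).transpose fun j => g' i j v) i := by
    rw [Matrix.cramer_transpose_apply]; rfl
  refine h3.trans ?_
  rw [Matrix.cramer_eq_adjugate_mulVec, Matrix.mulVec, dotProduct]
  simp [← Matrix.adjugate_transpose]

end Matrix

/-! ### The moving frame of an immersion -/

variable {m : ℕ}

/-- `F` is a smooth immersion on the relatively open set `U`. -/
structure Imm (F : Coord → Amb m) (U : Set Coord) : Prop extends RelOpen U where
  smooth : ContDiffOn ℝ ∞ F U
  det_pos : ∀ y ∈ U, 0 < (metric F y).det

/-- The orthogonal projection of `ℝ^m` to the normal space at `y`, as a linear map. -/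
def nproj (F : Coord → Amb m) (y : Coord) : Amb m →ₗ[ℝ] Amb m where
  toFun v := v - ∑ i, ∑ j, (metricInv F y i j * ⟪v, pd i F y⟫_ℝ) • pd j F y
  map_add' v w := by
    simp only [inner_add_left, mul_add, add_smul, Finset.sum_add_distrib]; abel
  map_smul' c v := by
    simp only [inner_smul_left, RingHom.id_apply, smul_sub, Finset.smul_sum, smul_smul]
    congr 1
    refine Finset.sum_congr rfl fun i _ => Finset.sum_congr rfl fun j _ => ?_
    congr 1; simp; ring

lemma normalPart_eq (F X : Coord → Amb m) (y : Coord) :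
    normalPart F X y = nproj F y (X y) := rfl

lemma nproj_apply (F : Coord → Amb m) (y : Coord) (v : Amb m) :
    nproj F y v = v - ∑ i, ∑ j, (metricInv F y i j * ⟪v, pd i F y⟫_ℝ) • pd j F y := rfl

section
variable {F : Coord → Amb m} {U : Set Coord} {y : Coord} {W : Type*} [NormedAddCommGroup W]
  [NormedSpace ℝ W]

lemma metric_apply (i j : Fin 4) : metric F y i j = ⟪pd i F y, pd j F y⟫_ℝ := rfl

lemma metric_symm (i j : Fin 4) : metric F y i j = metric F y j i :=
  real_inner_comm (pd j F y) (pd i F y)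

lemma metricInv_symm (i j : Fin 4) : metricInv F y i j = metricInv F y j i := by
  have h : (metric F y).transpose = metric F y := Matrix.ext fun i j => metric_symm j i
  calc metricInv F y i j = ((metric F y).transpose)⁻¹ i j := by rw [h]; rfl
    _ = metricInv F y j i := by rw [← Matrix.transpose_nonsing_inv]; rfl

namespace Imm
variable (hF : Imm F U)
include hF

lemma isUnit_det (hy : y ∈ U) : IsUnit (metric F y).det := (hF.det_pos y hy).ne'.isUnit

lemma metric_mul_inv (hy : y ∈ U) (i j : Fin 4) :
    ∑ k, metric F y i k * metricInv F y k j = if i = j then 1 else 0 := by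
  have := congrFun (congrFun (Matrix.mul_nonsing_inv _ (hF.isUnit_det hy)) i) j
  rwa [Matrix.mul_apply, Matrix.one_apply] at this

lemma inv_mul_metric (hy : y ∈ U) (i j : Fin 4) :
    ∑ k, metricInv F y i k * metric F y k j = if i = j then 1 else 0 := by
  have := congrFun (congrFun (Matrix.nonsing_inv_mul _ (hF.isUnit_det hy)) i) j
  rwa [Matrix.mul_apply, Matrix.one_apply] at this

lemma nproj_frame (hy : y ∈ U) (k : Fin 4) : nproj F y (pd k F y) = 0 := by
  rw [nproj_apply, Finset.sum_comm, sub_eq_zero]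
  simp only [← Finset.sum_smul]
  have : ∀ j, ∑ i, metricInv F y i j * ⟪pd k F y, pd i F y⟫_ℝ = if k = j then 1 else 0 := by
    intro j
    rw [← hF.metric_mul_inv hy k j]
    exact Finset.sum_congr rfl fun i _ => mul_comm _ _
  simp [this]

lemma inner_nproj_frame (hy : y ∈ U) (v : Amb m) (k : Fin 4) :
    ⟪nproj F y v, pd k F y⟫_ℝ = 0 := by
  rw [nproj_apply, inner_sub_left, sum_inner]
  simp only [sum_inner, real_inner_smul_left]
  have : ∀ i, ∑ j, metricInv F y i j * ⟪v, pd i F y⟫_ℝ * ⟪pd j F y, pd k F y⟫_ℝ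
      = if i = k then ⟪v, pd i F y⟫_ℝ else 0 := by
    intro i
    have h := congrArg (· * ⟪v, pd i F y⟫_ℝ) (hF.inv_mul_metric hy i k)
    simp only [Finset.sum_mul, metric_apply, ite_mul, one_mul, zero_mul] at h
    rw [← h]
    exact Finset.sum_congr rfl fun j _ => by ring
  simp [this]

omit hF in
lemma inner_nproj_of_normal {w : Amb m} (hw : ∀ k, ⟪w, pd k F y⟫_ℝ = 0) (v : Amb m) :
    ⟪nproj F y v, w⟫_ℝ = ⟪v, w⟫_ℝ := by
  simp [nproj_apply, inner_sub_left, sum_inner, real_inner_smul_left,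
    fun k => (real_inner_comm (pd k F y) w).symm.trans (hw k)]

omit hF in
lemma inner_of_normal_nproj {w : Amb m} (hw : ∀ k, ⟪w, pd k F y⟫_ℝ = 0) (v : Amb m) :
    ⟪w, nproj F y v⟫_ℝ = ⟪w, v⟫_ℝ := by
  rw [real_inner_comm, inner_nproj_of_normal hw, real_inner_comm]

lemma inner_nproj_nproj (hy : y ∈ U) (v w : Amb m) :
    ⟪nproj F y v, nproj F y w⟫_ℝ = ⟪nproj F y v, w⟫_ℝ :=
  inner_of_normal_nproj (hF.inner_nproj_frame hy v) w

lemma pd_frame_smooth (i : Fin 4) : ContDiffOn ℝ ∞ (pd i F) U := hF.pd_smooth hF.smooth i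

lemma metric_smooth (i j : Fin 4) : ContDiffOn ℝ ∞ (fun z => metric F z i j) U :=
  (hF.pd_frame_smooth i).inner ℝ (hF.pd_frame_smooth j)

lemma metricInv_smooth (i j : Fin 4) : ContDiffOn ℝ ∞ (fun z => metricInv F z i j) U :=
  contDiffOn_inv hF.metric_smooth (fun z hz => (hF.det_pos z hz).ne') i j

lemma volDensity_smooth : ContDiffOn ℝ ∞ (volDensity F) U :=
  (contDiffOn_det hF.metric_smooth).sqrt fun z hz => (hF.det_pos z hz).ne'

lemma volDensity_pos (hy : y ∈ U) : 0 < volDensity F y := Real.sqrt_pos.2 (hF.det_pos y hy)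

lemma pd_metric (hy : y ∈ U) (k i j : Fin 4) : pd k (fun z => metric F z i j) y
    = ⟪pd k (pd i F) y, pd j F y⟫_ℝ + ⟪pd k (pd j F) y, pd i F y⟫_ℝ := by
  simp only [metric_apply]
  rw [hF.pd_inner (hF.pd_frame_smooth i) (hF.pd_frame_smooth j) hy,
    real_inner_comm (pd k (pd j F) y)]

/-- The Christoffel symbols are the tangential coefficients of the second derivatives of the
immersion. -/
lemma christoffel_eq (hy : y ∈ U) (k i j : Fin 4) :
    christoffel F k i j y = ∑ l, metricInv F y k l * ⟪pd i (pd j F) y, pd l F y⟫_ℝ := by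
  rw [christoffel, Finset.mul_sum]
  refine Finset.sum_congr rfl fun l _ => ?_
  rw [hF.pd_metric hy, hF.pd_metric hy, hF.pd_metric hy, hF.pd_comm hF.smooth hy j i,
    hF.pd_comm hF.smooth hy l i, hF.pd_comm hF.smooth hy l j]
  ring

lemma sum_christoffel_frame (hy : y ∈ U) (i j : Fin 4) :
    ∑ k, christoffel F k i j y • pd k F y = pd i (pd j F) y - nproj F y (pd i (pd j F) y) := by
  rw [nproj_apply, sub_sub_cancel, Finset.sum_comm]
  refine Finset.sum_congr rfl fun k _ => ?_
  rw [hF.christoffel_eq hy, Finset.sum_smul]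
  exact Finset.sum_congr rfl fun l _ => by rw [metricInv_symm]

/-- The second fundamental form is the normal part of the Hessian of the immersion. -/
lemma sff_eq (hy : y ∈ U) (i j : Fin 4) : sff F i j y = nproj F y (pd i (pd j F) y) := by
  rw [sff, nablaLow, hF.sum_christoffel_frame hy, sub_sub_cancel]

lemma sff_symm (hy : y ∈ U) (i j : Fin 4) : sff F i j y = sff F j i y := by
  rw [hF.sff_eq hy, hF.sff_eq hy, hF.pd_comm hF.smooth hy]

lemma sff_normal (hy : y ∈ U) (i j k : Fin 4) : ⟪sff F i j y, pd k F y⟫_ℝ = 0 := by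
  rw [hF.sff_eq hy, hF.inner_nproj_frame hy]

lemma meanCurv_normal (hy : y ∈ U) (k : Fin 4) : ⟪meanCurv F y, pd k F y⟫_ℝ = 0 := by
  simp [meanCurv, real_inner_smul_left, sum_inner, hF.sff_normal hy]

lemma lapPerp_normal (X : Coord → Amb m) (hy : y ∈ U) (k : Fin 4) :
    ⟪lapPerp F X y, pd k F y⟫_ℝ = 0 := by
  simp [lapPerp, real_inner_smul_left, sum_inner, normalPart_eq, hF.inner_nproj_frame hy]

/-- The derivative of the inverse metric, which expresses `∇ g⁻¹ = 0`. -/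
lemma pd_metricInv (hy : y ∈ U) (k a b : Fin 4) : pd k (fun z => metricInv F z a b) y
    = - ∑ c, christoffel F b k c y * metricInv F y a c
      - ∑ c, christoffel F a k c y * metricInv F y c b := by
  set G : Matrix (Fin 4) (Fin 4) ℝ := metricInv F y with hG
  set dG : Matrix (Fin 4) (Fin 4) ℝ := Matrix.of fun a b => pd k (fun z => metricInv F z a b) y
  set Λ : Matrix (Fin 4) (Fin 4) ℝ := Matrix.of fun i j => ⟪pd k (pd i F) y, pd j F y⟫_ℝ
    with hΛ
  have h1 : (Λ + Λ.transpose) * G + metric F y * dG = 0 := by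
    ext i j
    have h := hF.pd_congr (f := fun z => ∑ l, metric F z i l * metricInv F z l j)
      (g := fun _ => if i = j then 1 else 0) (fun z hz => hF.metric_mul_inv hz i j) hy k
    rw [pd_const hF.toRelOpen hy, hF.pd_sum _ (fun l _ => (hF.metric_smooth i l).mul
      (hF.metricInv_smooth l j)) hy] at h
    simp only [Matrix.add_apply, Matrix.mul_apply, Matrix.zero_apply]
    rw [← h, ← Finset.sum_add_distrib]
    refine Finset.sum_congr rfl fun l _ => ?_
    rw [hF.pd_mul (hF.metric_smooth i l) (hF.metricInv_smooth l j) hy, hF.pd_metric hy]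
    simp [Λ, G, dG, Matrix.transpose_apply]
  have hGg : G * metric F y = 1 := Matrix.nonsing_inv_mul _ (hF.isUnit_det hy)
  have h2 : dG = - (G * Λ.transpose) * G - G * (Λ * G) := by
    have h := congrArg (G * ·) h1
    simp only [Matrix.mul_add, ← Matrix.mul_assoc, hGg, Matrix.one_mul, Matrix.add_mul,
      Matrix.mul_zero] at h
    rw [eq_comm, ← sub_eq_zero, ← neg_eq_zero, ← h]
    simp only [Matrix.neg_mul, ← Matrix.mul_assoc]
    abel
  have hΓ1 : ∀ c d, (G * Λ.transpose) c d = christoffel F c k d y := fun c d => by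
    rw [hF.christoffel_eq hy, Matrix.mul_apply]
    rfl
  have hΓ2 : ∀ c d, (Λ * G) c d = christoffel F d k c y := fun c d => by
    rw [hF.christoffel_eq hy, Matrix.mul_apply]
    exact Finset.sum_congr rfl fun l _ => by rw [mul_comm, hG, metricInv_symm]; rfl
  have h3 := congrFun (congrFun h2 a) b
  simp only [Matrix.sub_apply, Matrix.neg_mul, Matrix.neg_apply] at h3
  rw [Matrix.mul_apply, Matrix.mul_apply] at h3
  simp only [hΓ1, hΓ2] at h3
  refine (show pd k (fun z => metricInv F z a b) y = dG a b from rfl).trans (h3.trans ?_)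
  rw [sub_eq_add_neg, sub_eq_add_neg, add_comm]
  congr 2
  exact Finset.sum_congr rfl fun c _ => mul_comm _ _

/-- The logarithmic derivative of the volume density is the contracted Christoffel symbol. -/
lemma pd_volDensity (hy : y ∈ U) (k : Fin 4) :
    pd k (volDensity F) y = volDensity F y * ∑ j, christoffel F j j k y := by
  have hd := hasFDerivWithinAt_det (g := metric F) (s := halfSpace) (y := y)
    fun i j => hF.hasFDerivWithinAt (hF.metric_smooth i j) hy
  have h := pd_of_hasFDerivWithinAt hF.toRelOpen hy (hd.sqrt (hF.det_pos y hy).ne') k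
  refine (show pd k (volDensity F) y = _ from h).trans ?_
  simp only [_root_.sum_apply, _root_.smul_apply, smul_eq_mul]
  have hadj : ∀ i j, (metric F y).adjugate i j = (metric F y).det * metricInv F y i j := by
    intro i j
    rw [metricInv, Matrix.inv_def, Matrix.smul_apply, Ring.inverse_eq_inv', smul_eq_mul,
      mul_inv_cancel_left₀ (hF.det_pos y hy).ne']
  have hpd : ∀ i j, fderivWithin ℝ (fun z => metric F z i j) halfSpace y
      (EuclideanSpace.single k 1) = _ := fun i j => hF.pd_metric hy k i j
  simp only [hadj, hpd]
  have hs : Real.sqrt (metric F y).det = volDensity F y := rfl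
  have hsq : (metric F y).det = volDensity F y * volDensity F y :=
    (Real.mul_self_sqrt (hF.det_pos y hy).le).symm
  have hv := (hF.volDensity_pos hy).ne'
  have h1 : ∑ i, ∑ j, metricInv F y j i * ⟪pd k (pd i F) y, pd j F y⟫_ℝ
      = ∑ j, christoffel F j j k y := by
    refine Finset.sum_congr rfl fun i _ => ?_
    rw [hF.christoffel_eq hy, hF.pd_comm hF.smooth hy i k]
    exact Finset.sum_congr rfl fun l _ => by rw [metricInv_symm]
  have h2 : ∑ i, ∑ j, metricInv F y j i * ⟪pd k (pd j F) y, pd i F y⟫_ℝ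
      = ∑ j, christoffel F j j k y := by
    rw [Finset.sum_comm, ← h1]
    exact Finset.sum_congr rfl fun i _ => Finset.sum_congr rfl fun j _ => by rw [metricInv_symm]
  have h3 : ∑ i, ∑ j, (metric F y).det * metricInv F y j i *
      (⟪pd k (pd i F) y, pd j F y⟫_ℝ + ⟪pd k (pd j F) y, pd i F y⟫_ℝ)
      = (metric F y).det * (2 * ∑ j, christoffel F j j k y) := by
    rw [two_mul]
    nth_rw 1 [← h1]
    rw [← h2]
    simp only [mul_add, Finset.mul_sum, Finset.sum_add_distrib, mul_assoc]
  rw [h3, hs, hsq]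
  field_simp

end Imm
end

/-! ### Smoothness of the geometric quantities -/

section
variable {m : ℕ} {F : Coord → Amb m} {U : Set Coord} {y : Coord} {W : Type*}
  [NormedAddCommGroup W] [NormedSpace ℝ W]

/-- The divergence `∇_j T^j` of a (vector valued) vector field. -/
def divUp (F : Coord → Amb m) (T : Fin 4 → Coord → W) (y : Coord) : W :=
  ∑ j, nablaUp F T j j y

namespace Imm
variable (hF : Imm F U)
include hF

lemma christoffel_smooth (k i j : Fin 4) : ContDiffOn ℝ ∞ (christoffel F k i j) U :=
  contDiffOn_const.mul <| ContDiffOn.sum fun l _ => (hF.metricInv_smooth k l).mul <|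
    ((hF.pd_smooth (hF.metric_smooth j l) i).add (hF.pd_smooth (hF.metric_smooth i l) j)).sub
      (hF.pd_smooth (hF.metric_smooth i j) l)

lemma nablaLow_smooth {T : Fin 4 → Coord → W} (hT : ∀ k, ContDiffOn ℝ ∞ (T k) U) (i j : Fin 4) :
    ContDiffOn ℝ ∞ (nablaLow F T i j) U :=
  (hF.pd_smooth (hT j) i).sub <| ContDiffOn.sum fun k _ => (hF.christoffel_smooth k i j).smul (hT k)

lemma nablaUp_smooth {T : Fin 4 → Coord → W} (hT : ∀ k, ContDiffOn ℝ ∞ (T k) U) (i j : Fin 4) :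
    ContDiffOn ℝ ∞ (nablaUp F T i j) U :=
  (hF.pd_smooth (hT j) i).add <| ContDiffOn.sum fun k _ => (hF.christoffel_smooth j i k).smul (hT k)

lemma divUp_smooth {T : Fin 4 → Coord → W} (hT : ∀ k, ContDiffOn ℝ ∞ (T k) U) :
    ContDiffOn ℝ ∞ (divUp F T) U :=
  ContDiffOn.sum fun j _ => hF.nablaUp_smooth hT j j

lemma nablaUpUp_smooth {T : Fin 4 → Fin 4 → Coord → W} (hT : ∀ k l, ContDiffOn ℝ ∞ (T k l) U)
    (i j k : Fin 4) : ContDiffOn ℝ ∞ (nablaUpUp F T i j k) U :=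
  ((hF.pd_smooth (hT j k) i).add <|
    ContDiffOn.sum fun l _ => (hF.christoffel_smooth j i l).smul (hT l k)).add <|
    ContDiffOn.sum fun l _ => (hF.christoffel_smooth k i l).smul (hT j l)

lemma grad_smooth {X : Coord → Amb m} (hX : ContDiffOn ℝ ∞ X U) (i : Fin 4) :
    ContDiffOn ℝ ∞ (grad F X i) U :=
  ContDiffOn.sum fun j _ => (hF.metricInv_smooth i j).smul (hF.pd_smooth hX j)

lemma normalPart_smooth {X : Coord → Amb m} (hX : ContDiffOn ℝ ∞ X U) :
    ContDiffOn ℝ ∞ (normalPart F X) U :=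
  hX.sub <| ContDiffOn.sum fun i _ => ContDiffOn.sum fun j _ =>
    ((hF.metricInv_smooth i j).mul (hX.inner ℝ (hF.pd_frame_smooth i))).smul (hF.pd_frame_smooth j)

lemma sff_smooth (i j : Fin 4) : ContDiffOn ℝ ∞ (sff F i j) U :=
  hF.nablaLow_smooth hF.pd_frame_smooth i j

lemma sffMixed_smooth (i j : Fin 4) : ContDiffOn ℝ ∞ (sffMixed F i j) U :=
  ContDiffOn.sum fun k _ => (hF.metricInv_smooth i k).smul (hF.sff_smooth k j)

lemma sffUp_smooth (i j : Fin 4) : ContDiffOn ℝ ∞ (sffUp F i j) U :=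
  ContDiffOn.sum fun k _ => ContDiffOn.sum fun l _ =>
    ((hF.metricInv_smooth i k).mul (hF.metricInv_smooth j l)).smul (hF.sff_smooth k l)

lemma meanCurv_smooth : ContDiffOn ℝ ∞ (meanCurv F) U :=
  (ContDiffOn.sum fun i _ => ContDiffOn.sum fun j _ =>
    (hF.metricInv_smooth i j).smul (hF.sff_smooth i j)).const_smul (1 / 4 : ℝ)

lemma normalPd_smooth {X : Coord → Amb m} (hX : ContDiffOn ℝ ∞ X U) (i : Fin 4) :
    ContDiffOn ℝ ∞ (normalPd F i X) U :=
  hF.normalPart_smooth (hF.pd_smooth hX i)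

lemma normalGrad_smooth {X : Coord → Amb m} (hX : ContDiffOn ℝ ∞ X U) (i : Fin 4) :
    ContDiffOn ℝ ∞ (normalGrad F X i) U :=
  hF.normalPart_smooth (hF.grad_smooth hX i)

lemma lapPerp_smooth {X : Coord → Amb m} (hX : ContDiffOn ℝ ∞ X U) :
    ContDiffOn ℝ ∞ (lapPerp F X) U :=
  ContDiffOn.sum fun i _ => ContDiffOn.sum fun j _ => (hF.metricInv_smooth i j).smul <|
    hF.normalPart_smooth (hF.nablaLow_smooth (fun k => hF.normalPd_smooth hX k) i j)

lemma normSqNormalGradH_smooth : ContDiffOn ℝ ∞ (normSqNormalGradH F) U :=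
  ContDiffOn.sum fun i _ => ContDiffOn.sum fun j _ => (hF.metricInv_smooth i j).mul <|
    (hF.normalPd_smooth hF.meanCurv_smooth i).inner ℝ (hF.normalPd_smooth hF.meanCurv_smooth j)

lemma inner_H_sffUp_smooth (i j : Fin 4) :
    ContDiffOn ℝ ∞ (fun z => ⟪meanCurv F z, sffUp F i j z⟫_ℝ) U :=
  hF.meanCurv_smooth.inner ℝ (hF.sffUp_smooth i j)

lemma normSqHh_smooth : ContDiffOn ℝ ∞ (normSqHh F) U :=
  ContDiffOn.sum fun i _ => ContDiffOn.sum fun j _ => (hF.inner_H_sffUp_smooth i j).mul <|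
    hF.meanCurv_smooth.inner ℝ (hF.sff_smooth i j)

lemma normSqH_smooth : ContDiffOn ℝ ∞ (fun z => ‖meanCurv F z‖ ^ 2) U :=
  hF.meanCurv_smooth.norm_sq ℝ

lemma localDensity_smooth : ContDiffOn ℝ ∞ (localDensity F) U := by
  refine (hF.normSqNormalGradH_smooth.sub hF.normSqHh_smooth).add
    (((hF.normSqH_smooth.pow 2).const_smul (7 : ℝ)).congr fun z _ => ?_)
  simp only [smul_eq_mul]
  ring

lemma cubicH_smooth : ContDiffOn ℝ ∞ (cubicH F) U :=
  hF.normSqH_smooth.smul hF.meanCurv_smooth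

lemma hhH_smooth : ContDiffOn ℝ ∞ (hhH F) U :=
  ContDiffOn.sum fun i _ => ContDiffOn.sum fun j _ =>
    (hF.inner_H_sffUp_smooth i j).smul (hF.sff_smooth i j)

lemma HhH_smooth (i j : Fin 4) : ContDiffOn ℝ ∞ (HhH F i j) U :=
  (hF.inner_H_sffUp_smooth i j).smul hF.meanCurv_smooth

lemma divHhH_smooth (i : Fin 4) : ContDiffOn ℝ ∞ (divHhH F i) U :=
  ContDiffOn.sum fun k _ => hF.nablaUpUp_smooth hF.HhH_smooth k i k

lemma localFlux_smooth {b : Coord → Amb m} (hb : ContDiffOn ℝ ∞ b U) (j : Fin 4) :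
    ContDiffOn ℝ ∞ (localFlux F b j) U := by
  have hH := hF.meanCurv_smooth
  have hg := fun i => hF.grad_smooth hH i
  have hgb := fun i => hF.grad_smooth hb i
  have hL := hF.lapPerp_smooth hH
  refine ((((((((((ContDiffOn.add ?_ ?_).sub ?_).add ?_).sub ?_).add ?_).sub ?_).add ?_).sub
    ?_).add ?_).add ?_).sub ?_
  · exact contDiffOn_const.mul <| ContDiffOn.sum fun i _ => ContDiffOn.sum fun k _ =>
      ((hg j).inner ℝ (hF.sffUp_smooth i k)).mul (hb.inner ℝ (hF.sff_smooth i k))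
  · exact contDiffOn_const.mul <| (hg j).inner ℝ (hF.lapPerp_smooth hb)
  · exact (contDiffOn_const.mul <| ContDiffOn.sum fun i _ =>
      (hg i).inner ℝ (hF.sffMixed_smooth j i)).mul (hH.inner ℝ hb)
  · exact contDiffOn_const.mul <| ContDiffOn.sum fun i _ =>
      ((hg i).inner ℝ hb).mul (hH.inner ℝ (hF.sffMixed_smooth j i))
  · exact contDiffOn_const.mul <| hL.inner ℝ (hgb j)
  · exact contDiffOn_const.mul <| (hF.grad_smooth hL j).inner ℝ hb
  · exact contDiffOn_const.mul <| ContDiffOn.sum fun i _ => ContDiffOn.sum fun k _ =>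
      (hF.inner_H_sffUp_smooth i k).mul ((hF.sff_smooth i k).inner ℝ (hgb j))
  · exact contDiffOn_const.mul <| (hF.normalGrad_smooth hF.hhH_smooth j).inner ℝ hb
  · exact contDiffOn_const.mul <| ContDiffOn.sum fun i _ =>
      (hF.inner_H_sffUp_smooth i j).mul (hH.inner ℝ (hF.pd_smooth hb i))
  · exact contDiffOn_const.mul <| (hF.normalPart_smooth <| ContDiffOn.sum fun i _ =>
      hF.nablaUpUp_smooth hF.HhH_smooth i i j).inner ℝ hb
  · exact (contDiffOn_const.mul hF.normSqH_smooth).mul (hH.inner ℝ (hgb j))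
  · exact contDiffOn_const.mul <| (hF.normalGrad_smooth hF.cubicH_smooth j).inner ℝ hb

end Imm

/-! ### Integration by parts at the level of divergences -/

namespace Imm
variable (hF : Imm F U)
include hF

lemma divUp_congr {T S : Fin 4 → Coord → W} (h : ∀ j, ∀ z ∈ U, T j z = S j z) (hy : y ∈ U) :
    divUp F T y = divUp F S y := by
  refine Finset.sum_congr rfl fun j _ => ?_
  simp only [nablaUp, hF.pd_congr (h j) hy, h _ y hy]

lemma divUp_add {T S : Fin 4 → Coord → W} (hT : ∀ k, ContDiffOn ℝ ∞ (T k) U)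
    (hS : ∀ k, ContDiffOn ℝ ∞ (S k) U) (hy : y ∈ U) :
    divUp F (fun j z => T j z + S j z) y = divUp F T y + divUp F S y := by
  simp only [divUp, nablaUp, hF.pd_add (hT _) (hS _) hy, smul_add, Finset.sum_add_distrib]
  abel

lemma divUp_const_smul {T : Fin 4 → Coord → W} (hT : ∀ k, ContDiffOn ℝ ∞ (T k) U) (c : ℝ)
    (hy : y ∈ U) : divUp F (fun j z => c • T j z) y = c • divUp F T y := by
  simp only [divUp, nablaUp, hF.pd_const_smul (hT _) c hy, smul_add, Finset.sum_add_distrib,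
    Finset.smul_sum, smul_comm c]

lemma divUp_const_mul {T : Fin 4 → Coord → ℝ} (hT : ∀ k, ContDiffOn ℝ ∞ (T k) U) (c : ℝ)
    (hy : y ∈ U) : divUp F (fun j z => c * T j z) y = c * divUp F T y :=
  hF.divUp_const_smul hT c hy

/-- `√g ∇_j X^j = ∂_j (√g X^j)`. -/
lemma volDensity_mul_divUp {X : Fin 4 → Coord → ℝ} (hX : ∀ k, ContDiffOn ℝ ∞ (X k) U)
    (hy : y ∈ U) :
    volDensity F y * divUp F X y = ∑ j, pd j (fun z => volDensity F z * X j z) y := by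
  have h : ∀ j, pd j (fun z => volDensity F z * X j z) y
      = volDensity F y * (∑ k, christoffel F k k j y * X j y) + volDensity F y * pd j (X j) y := by
    intro j
    rw [hF.pd_mul hF.volDensity_smooth (hX j) hy, hF.pd_volDensity hy, mul_assoc, Finset.sum_mul]
  simp only [h, Finset.sum_add_distrib, ← Finset.mul_sum, ← mul_add]
  rw [Finset.sum_comm, divUp]
  simp only [nablaUp, Finset.sum_add_distrib, smul_eq_mul]
  rw [add_comm]

lemma divUp_inner {X : Fin 4 → Coord → Amb m} {Y : Coord → Amb m}
    (hX : ∀ k, ContDiffOn ℝ ∞ (X k) U) (hY : ContDiffOn ℝ ∞ Y U) (hy : y ∈ U) :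
    divUp F (fun j z => ⟪X j z, Y z⟫_ℝ) y
      = ⟪divUp F X y, Y y⟫_ℝ + ∑ j, ⟪X j y, pd j Y y⟫_ℝ := by
  simp only [divUp, nablaUp, hF.pd_inner (hX _) hY hy, smul_eq_mul, sum_inner, inner_add_left,
    real_inner_smul_left, Finset.sum_add_distrib]
  ring

/-- Raising an index commutes with covariant differentiation. -/
lemma sum_metricInv_nablaLow {T : Fin 4 → Coord → W} (hT : ∀ k, ContDiffOn ℝ ∞ (T k) U)
    (hy : y ∈ U) : ∑ i, ∑ j, metricInv F y i j • nablaLow F T i j y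
      = divUp F (fun i z => ∑ j, metricInv F z i j • T j z) y := by
  have h : ∀ i, pd i (fun z => ∑ j, metricInv F z i j • T j z) y
      = ∑ j, metricInv F y i j • pd i (T j) y
        + ∑ j, pd i (fun z => metricInv F z i j) y • T j y := by
    intro i
    rw [hF.pd_sum (f := fun j z => metricInv F z i j • T j z) _
      (fun j _ => (hF.metricInv_smooth i j).smul (hT j)) hy,
      ← Finset.sum_add_distrib]
    exact Finset.sum_congr rfl fun j _ => by
      rw [hF.pd_smul (hF.metricInv_smooth i j) (hT j) hy, add_comm]
  have h2 : ∑ i, ∑ j, pd i (fun z => metricInv F z i j) y • T j y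
      = - (∑ i, ∑ j, metricInv F y i j • ∑ k, christoffel F k i j y • T k y)
        - ∑ i, ∑ k, christoffel F i i k y • ∑ j, metricInv F y k j • T j y := by
    have e1 : ∑ i, ∑ j, metricInv F y i j • ∑ k, christoffel F k i j y • T k y
        = ∑ i, ∑ j, (∑ c, christoffel F j i c y * metricInv F y i c) • T j y := by
      refine Finset.sum_congr rfl fun i _ => ?_
      simp only [Finset.smul_sum, Finset.sum_smul, smul_smul]
      rw [Finset.sum_comm]
      exact Finset.sum_congr rfl fun j _ => Finset.sum_congr rfl fun c _ => by rw [mul_comm]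
    have e2 : ∑ i, ∑ k, christoffel F i i k y • ∑ j, metricInv F y k j • T j y
        = ∑ i, ∑ j, (∑ c, christoffel F i i c y * metricInv F y c j) • T j y := by
      refine Finset.sum_congr rfl fun i _ => ?_
      simp only [Finset.smul_sum, Finset.sum_smul, smul_smul]
      rw [Finset.sum_comm]
    rw [e1, e2, ← Finset.sum_neg_distrib, ← Finset.sum_sub_distrib]
    refine Finset.sum_congr rfl fun i _ => ?_
    rw [← Finset.sum_neg_distrib, ← Finset.sum_sub_distrib]
    refine Finset.sum_congr rfl fun j _ => ?_
    rw [hF.pd_metricInv hy, sub_smul, neg_smul]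
  simp only [divUp, nablaUp, nablaLow, h, Finset.sum_add_distrib, h2, smul_sub,
    Finset.sum_sub_distrib]
  abel

omit hF in
lemma normalGrad_eq (X : Coord → Amb m) (i : Fin 4) (y : Coord) :
    normalGrad F X i y = ∑ j, metricInv F y i j • normalPd F j X y := by
  simp only [normalGrad, normalPd, normalPart_eq, grad, map_sum, map_smul]

/-- The normal Laplacian is the normal part of a divergence. -/
lemma lapPerp_eq {X : Coord → Amb m} (hX : ContDiffOn ℝ ∞ X U) (hy : y ∈ U) :
    lapPerp F X y = nproj F y (divUp F (normalGrad F X) y) := by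
  have h := hF.sum_metricInv_nablaLow (fun k => hF.normalPd_smooth hX k) hy
  rw [hF.divUp_congr (S := fun i z => ∑ j, metricInv F z i j • normalPd F j X z)
    (fun i z _ => normalGrad_eq X i z) hy, ← h]
  simp only [lapPerp, normalPart_eq, map_sum, map_smul]

/-- Green's formula for the normal Laplacian, before integration. -/
lemma inner_lapPerp {X b : Coord → Amb m} (hX : ContDiffOn ℝ ∞ X U) (hb : ContDiffOn ℝ ∞ b U)
    (hXn : ∀ z ∈ U, ∀ k, ⟪X z, pd k F z⟫_ℝ = 0) (hbn : ∀ z ∈ U, ∀ k, ⟪b z, pd k F z⟫_ℝ = 0)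
    (hy : y ∈ U) : ⟪X y, lapPerp F b y⟫_ℝ
      = divUp F (fun j z => ⟪X z, grad F b j z⟫_ℝ) y
        - divUp F (fun j z => ⟪normalGrad F X j z, b z⟫_ℝ) y + ⟪lapPerp F X y, b y⟫_ℝ := by
  have h1 : divUp F (fun j z => ⟪X z, grad F b j z⟫_ℝ) y
      = ⟪divUp F (normalGrad F b) y, X y⟫_ℝ + ∑ j, ⟪normalGrad F b j y, pd j X y⟫_ℝ := by
    rw [← hF.divUp_inner (fun k => hF.normalGrad_smooth hb k) hX hy]
    refine hF.divUp_congr (fun j z hz => ?_) hy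
    rw [real_inner_comm, normalGrad, normalPart_eq, inner_nproj_of_normal (hXn z hz)]
  rw [h1, hF.divUp_inner (fun k => hF.normalGrad_smooth hX k) hb hy, hF.lapPerp_eq hb hy,
    hF.lapPerp_eq hX hy, inner_of_normal_nproj (hXn y hy), inner_nproj_of_normal (hbn y hy)]
  have h2 : ∑ j, ⟪normalGrad F b j y, pd j X y⟫_ℝ = ∑ j, ⟪normalGrad F X j y, pd j b y⟫_ℝ := by
    simp only [normalGrad_eq, sum_inner, real_inner_smul_left]
    rw [Finset.sum_comm]
    refine Finset.sum_congr rfl fun i _ => Finset.sum_congr rfl fun j _ => ?_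
    rw [metricInv_symm]
    simp only [normalPd, normalPart_eq]
    rw [← hF.inner_nproj_nproj hy, real_inner_comm, hF.inner_nproj_nproj hy]
  rw [h2, real_inner_comm]
  ring

/-- Integration by parts that moves one derivative off the covariant Hessian. -/
lemma sum_inner_hessian {S : Fin 4 → Fin 4 → Coord → Amb m} {b : Coord → Amb m}
    (hS : ∀ i j, ContDiffOn ℝ ∞ (S i j) U) (hb : ContDiffOn ℝ ∞ b U) (hy : y ∈ U) :
    ∑ i, ∑ j, ⟪S i j y, nablaLow F (fun k => pd k b) i j y⟫_ℝ
      = divUp F (fun i z => ∑ j, ⟪S i j z, pd j b z⟫_ℝ) y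
        - ∑ j, ⟪∑ i, nablaUpUp F S i i j y, pd j b y⟫_ℝ := by
  have h : ∀ i, pd i (fun z => ∑ j, ⟪S i j z, pd j b z⟫_ℝ) y
      = ∑ j, ⟪pd i (S i j) y, pd j b y⟫_ℝ + ∑ j, ⟪S i j y, pd i (pd j b) y⟫_ℝ := by
    intro i
    rw [hF.pd_sum _ (fun j _ => (hS i j).inner ℝ (hF.pd_smooth hb j)) hy,
      ← Finset.sum_add_distrib]
    exact Finset.sum_congr rfl fun j _ => hF.pd_inner (hS i j) (hF.pd_smooth hb j) hy i
  have h1 : ∑ j, ⟪∑ i, nablaUpUp F S i i j y, pd j b y⟫_ℝ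
      = ∑ i, ∑ j, ⟪pd i (S i j) y, pd j b y⟫_ℝ
        + ∑ i, ∑ j, ∑ l, christoffel F i i l y * ⟪S l j y, pd j b y⟫_ℝ
        + ∑ i, ∑ j, ∑ l, christoffel F j i l y * ⟪S i l y, pd j b y⟫_ℝ := by
    simp only [sum_inner]
    rw [Finset.sum_comm]
    simp only [nablaUpUp, sum_inner, inner_add_left, real_inner_smul_left, Finset.sum_add_distrib]
  have h2 : ∑ i, ∑ j, ⟪S i j y, ∑ k, christoffel F k i j y • pd k b y⟫_ℝ
      = ∑ i, ∑ j, ∑ l, christoffel F j i l y * ⟪S i l y, pd j b y⟫_ℝ := by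
    simp only [inner_sum, real_inner_smul_right]
    exact Finset.sum_congr rfl fun i _ => Finset.sum_comm
  have h3 : ∑ i, ∑ k, christoffel F i i k y * ∑ j, ⟪S k j y, pd j b y⟫_ℝ
      = ∑ i, ∑ j, ∑ l, christoffel F i i l y * ⟪S l j y, pd j b y⟫_ℝ := by
    simp only [Finset.mul_sum]
    exact Finset.sum_congr rfl fun i _ => Finset.sum_comm
  rw [h1]
  simp only [divUp, nablaUp, nablaLow, h, inner_sub_right, Finset.sum_sub_distrib,
    Finset.sum_add_distrib, h2, smul_eq_mul, h3]
  ring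

end Imm
end

/-! ### The energy density as a smooth function of jets -/

section
variable {m : ℕ}

/-- Values of the first and second derivatives of a map into `ℝ^m`. -/
abbrev Jet (m : ℕ) : Type := (Fin 4 → Amb m) × (Fin 4 → Fin 4 → Amb m)

/-- The first and second derivatives of `F` at `y`. -/
def jet (F : Coord → Amb m) (y : Coord) : Jet m :=
  (fun k => pd k F y, fun i j => pd i (pd j F) y)

/-- The jet of `F`, which holds its derivatives of orders one and two, together with the first
derivatives of that jet. -/
def jet' (F : Coord → Amb m) (y : Coord) : Jet m × (Fin 4 → Jet m) :=
  (jet F y, fun i => pd i (jet F) y)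

/-- The Gram matrix of a frame. -/
def gram (e : Fin 4 → Amb m) : Matrix (Fin 4) (Fin 4) ℝ := Matrix.of fun i j => ⟪e i, e j⟫_ℝ

/-- The mean curvature as a function of jets. -/
def jetH (q : Jet m) : Amb m :=
  (1 / 4 : ℝ) • ∑ i, ∑ j, (gram q.1)⁻¹ i j •
    (q.2 i j - ∑ l, (∑ k, (gram q.1)⁻¹ k l * ⟪q.2 i j, q.1 k⟫_ℝ) • q.1 l)

/-- The part of a vector orthogonal to a frame. -/
def jetProj (e : Fin 4 → Amb m) (v : Amb m) : Amb m :=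
  v - ∑ l, (∑ k, (gram e)⁻¹ k l * ⟪v, e k⟫_ℝ) • e l

/-- The derivative `∂_i H` as a function of jets. -/
def jetDH (Q : Jet m × (Fin 4 → Jet m)) (i : Fin 4) : Amb m := fderiv ℝ jetH Q.1 (Q.2 i)

/-- The energy density as a function of jets. -/
def jetDensity (Q : Jet m × (Fin 4 → Jet m)) : ℝ :=
  ∑ i, ∑ j, (gram Q.1.1)⁻¹ i j *
      ⟪jetProj Q.1.1 (jetDH Q i), jetProj Q.1.1 (jetDH Q j)⟫_ℝ
    - ∑ i, ∑ j, (∑ k, ∑ l, (gram Q.1.1)⁻¹ i k * (gram Q.1.1)⁻¹ j l * ⟪jetH Q.1, Q.1.2 k l⟫_ℝ) *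
      ⟪jetH Q.1, Q.1.2 i j⟫_ℝ
    + 7 * (‖jetH Q.1‖ ^ 2) ^ 2

/-- The energy density, multiplied by the volume density, as a function of jets. -/
def jetEnergy (Q : Jet m × (Fin 4 → Jet m)) : ℝ :=
  jetDensity Q * Real.sqrt (gram Q.1.1).det

/-- Jets of immersions. -/
def immJets (m : ℕ) : Set (Jet m) := {q | 0 < (gram q.1).det}

lemma gram_smooth {E : Type*} [NormedAddCommGroup E] [NormedSpace ℝ E] {e : E → Fin 4 → Amb m}
    {s : Set E} (he : ContDiffOn ℝ ∞ e s) (i j : Fin 4) :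
    ContDiffOn ℝ ∞ (fun z => gram (e z) i j) s :=
  (contDiffOn_pi.1 he i).inner ℝ (contDiffOn_pi.1 he j)

lemma isOpen_immJets : IsOpen (immJets m) := by
  refine isOpen_lt continuous_const (Continuous.matrix_det ?_)
  refine continuous_pi fun i => continuous_pi fun j => ?_
  change Continuous fun q : Jet m => ⟪q.1 i, q.1 j⟫_ℝ
  fun_prop

lemma gramInv_smooth {E : Type*} [NormedAddCommGroup E] [NormedSpace ℝ E] {e : E → Fin 4 → Amb m}
    {s : Set E} (he : ContDiffOn ℝ ∞ e s) (h0 : ∀ z ∈ s, 0 < (gram (e z)).det) (i j : Fin 4) :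
    ContDiffOn ℝ ∞ (fun z => (gram (e z))⁻¹ i j) s :=
  contDiffOn_inv (gram_smooth he) (fun z hz => (h0 z hz).ne') i j

lemma jetProj_smooth {E : Type*} [NormedAddCommGroup E] [NormedSpace ℝ E] {e : E → Fin 4 → Amb m}
    {v : E → Amb m} {s : Set E} (he : ContDiffOn ℝ ∞ e s) (hv : ContDiffOn ℝ ∞ v s)
    (h0 : ∀ z ∈ s, 0 < (gram (e z)).det) : ContDiffOn ℝ ∞ (fun z => jetProj (e z) (v z)) s :=
  hv.sub <| ContDiffOn.sum fun l _ => (ContDiffOn.sum fun k _ =>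
    (gramInv_smooth he h0 k l).mul (hv.inner ℝ (contDiffOn_pi.1 he k))).smul (contDiffOn_pi.1 he l)

lemma jetH_smooth : ContDiffOn ℝ ∞ jetH (immJets m) := by
  have h1 : ContDiffOn ℝ ∞ (fun q : Jet m => q.1) (immJets m) := contDiff_fst.contDiffOn
  have h2 : ∀ i j, ContDiffOn ℝ ∞ (fun q : Jet m => q.2 i j) (immJets m) := fun i j =>
    contDiffOn_pi.1 (contDiffOn_pi.1 contDiff_snd.contDiffOn i) j
  exact (ContDiffOn.sum fun i _ => ContDiffOn.sum fun j _ =>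
    (gramInv_smooth h1 (fun _ h => h) i j).smul
      (jetProj_smooth h1 (h2 i j) fun _ h => h)).const_smul (1 / 4 : ℝ)

lemma jetDH_smooth (i : Fin 4) :
    ContDiffOn ℝ ∞ (fun Q => jetDH Q i) (immJets m ×ˢ (Set.univ : Set (Fin 4 → Jet m))) := by
  have h : ContDiffOn ℝ ∞ (fderiv ℝ (jetH (m := m))) (immJets m) :=
    jetH_smooth.fderiv_of_isOpen isOpen_immJets (by simp)
  refine (h.comp contDiff_fst.contDiffOn fun Q hQ => hQ.1).clm_apply ?_
  exact contDiffOn_pi.1 contDiff_snd.contDiffOn i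

lemma jetEnergy_smooth :
    ContDiffOn ℝ ∞ jetEnergy (immJets m ×ˢ (Set.univ : Set (Fin 4 → Jet m))) := by
  set s := immJets m ×ˢ (Set.univ : Set (Fin 4 → Jet m))
  have h1 : ContDiffOn ℝ ∞ (fun Q : Jet m × (Fin 4 → Jet m) => Q.1.1) s :=
    contDiff_fst.fst.contDiffOn
  have h0 : ∀ Q ∈ s, 0 < (gram Q.1.1).det := fun Q hQ => hQ.1
  have h2 : ∀ i j, ContDiffOn ℝ ∞ (fun Q : Jet m × (Fin 4 → Jet m) => Q.1.2 i j) s := fun i j =>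
    contDiffOn_pi.1 (contDiffOn_pi.1 contDiff_fst.snd.contDiffOn i) j
  have hH : ContDiffOn ℝ ∞ (fun Q : Jet m × (Fin 4 → Jet m) => jetH Q.1) s :=
    jetH_smooth.comp contDiff_fst.contDiffOn fun Q hQ => hQ.1
  have hG := gramInv_smooth h1 h0
  refine ContDiffOn.mul ((ContDiffOn.sub ?_ ?_).add ?_) ?_
  · exact ContDiffOn.sum fun i _ => ContDiffOn.sum fun j _ => (hG i j).mul
      ((jetProj_smooth h1 (jetDH_smooth i) h0).inner ℝ (jetProj_smooth h1 (jetDH_smooth j) h0))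
  · exact ContDiffOn.sum fun i _ => ContDiffOn.sum fun j _ => ContDiffOn.mul
      (ContDiffOn.sum fun k _ => ContDiffOn.sum fun l _ =>
        ((hG i k).mul (hG j l)).mul (hH.inner ℝ (h2 k l))) (hH.inner ℝ (h2 i j))
  · exact contDiffOn_const.mul ((hH.norm_sq ℝ).pow 2)
  · exact (contDiffOn_det (gram_smooth h1)).sqrt fun Q hQ => (h0 Q hQ).ne'

variable {F b : Coord → Amb m} {U : Set Coord} {y : Coord}

lemma jetProj_eq (F : Coord → Amb m) (y : Coord) (v : Amb m) :
    jetProj (jet F y).1 v = nproj F y v := by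
  rw [nproj_apply, jetProj, Finset.sum_comm]
  simp only [Finset.sum_smul]
  rfl

lemma RelOpen.jet_smooth (hU : RelOpen U) (hF : ContDiffOn ℝ ∞ F U) : ContDiffOn ℝ ∞ (jet F) U :=
  (contDiffOn_pi.2 fun k => hU.pd_smooth hF k).prodMk <| contDiffOn_pi.2 fun i =>
    contDiffOn_pi.2 fun j => hU.pd_smooth (hU.pd_smooth hF j) i

lemma RelOpen.jet'_smooth (hU : RelOpen U) (hF : ContDiffOn ℝ ∞ F U) :
    ContDiffOn ℝ ∞ (jet' F) U :=
  (hU.jet_smooth hF).prodMk <| contDiffOn_pi.2 fun i => hU.pd_smooth (hU.jet_smooth hF) i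

lemma RelOpen.jet_add_smul (hU : RelOpen U) (hF : ContDiffOn ℝ ∞ F U) (hb : ContDiffOn ℝ ∞ b U)
    (t : ℝ) (hy : y ∈ U) : jet (F + t • b) y = jet F y + t • jet b y := by
  have h1 : ∀ k, ∀ z ∈ U, pd k (F + t • b) z = pd k F z + t • pd k b z := fun k z hz => by
    rw [← hU.pd_const_smul hb t hz, ← hU.pd_add hF (hb.const_smul t) hz]; rfl
  refine Prod.ext (funext fun k => h1 k y hy) (funext fun i => funext fun j => ?_)
  have h2 := hU.pd_congr (h1 j) hy i
  rw [hU.pd_add (hU.pd_smooth hF j) ((hU.pd_smooth hb j).const_smul t) hy,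
    hU.pd_const_smul (hU.pd_smooth hb j) t hy] at h2
  exact h2

/-- Jets are linear in the map, so that a variation `F + t b` moves the jet along a line. -/
lemma RelOpen.jet'_add_smul (hU : RelOpen U) (hF : ContDiffOn ℝ ∞ F U) (hb : ContDiffOn ℝ ∞ b U)
    (t : ℝ) (hy : y ∈ U) : jet' (F + t • b) y = jet' F y + t • jet' b y := by
  refine Prod.ext (hU.jet_add_smul hF hb t hy) (funext fun i => ?_)
  have h2 := hU.pd_congr (fun z hz => hU.jet_add_smul hF hb t hz) hy i
  rw [hU.pd_add (hU.jet_smooth hF) ((hU.jet_smooth hb).const_smul t) hy,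
    hU.pd_const_smul (hU.jet_smooth hb) t hy] at h2
  exact h2

namespace Imm
variable (hF : Imm F U)
include hF

lemma jet_mem (hy : y ∈ U) : jet F y ∈ immJets m := hF.det_pos y hy

lemma meanCurv_eq_jetH (hy : y ∈ U) : meanCurv F y = jetH (jet F y) := by
  rw [meanCurv]
  refine congrArg _ (Finset.sum_congr rfl fun i _ => Finset.sum_congr rfl fun j _ => ?_)
  refine congrArg _ ((hF.sff_eq hy i j).trans ?_)
  rw [← jetProj_eq]; rfl

lemma differentiableAt_jetH (hy : y ∈ U) : DifferentiableAt ℝ jetH (jet F y) :=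
  (jetH_smooth.contDiffAt (isOpen_immJets.mem_nhds (hF.jet_mem hy))).differentiableAt (by simp)

lemma pd_meanCurv (hy : y ∈ U) (i : Fin 4) :
    pd i (meanCurv F) y = jetDH (jet' F y) i := by
  rw [hF.pd_congr (fun z hz => hF.meanCurv_eq_jetH hz) hy,
    hF.pd_comp (hF.jet_smooth hF.smooth) hy (hF.differentiableAt_jetH hy)]
  rfl

lemma inner_meanCurv_sff (hy : y ∈ U) (i j : Fin 4) :
    ⟪meanCurv F y, sff F i j y⟫_ℝ = ⟪meanCurv F y, pd i (pd j F) y⟫_ℝ := by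
  rw [hF.sff_eq hy, inner_of_normal_nproj (hF.meanCurv_normal hy)]

/-- The energy density depends only on the derivatives of orders one to three. -/
lemma localDensity_eq (hy : y ∈ U) : localDensity F y = jetDensity (jet' F y) := by
  rw [localDensity, jetDensity]
  refine congrArg₂ _ (congrArg₂ _ ?_ ?_) ?_
  · simp only [normSqNormalGradH, normalPd, normalPart_eq, hF.pd_meanCurv hy, ← jetProj_eq]
    rfl
  · simp only [normSqHh, sffUp, inner_sum, real_inner_smul_right, hF.inner_meanCurv_sff hy]
    rw [hF.meanCurv_eq_jetH hy]
    rfl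
  · rw [hF.meanCurv_eq_jetH hy, ← pow_mul]
    rfl

lemma density_mul_vol (hy : y ∈ U) :
    localDensity F y * volDensity F y = jetEnergy (jet' F y) := by
  rw [hF.localDensity_eq hy]; rfl

/-- A variation of an immersion is an immersion where its metric is nondegenerate. -/
lemma add_smul (hb : ContDiffOn ℝ ∞ b U) (t : ℝ) :
    Imm (F + t • b) (U ∩ {z | jet F z + t • jet b z ∈ immJets m}) := by
  have hc : ContinuousOn (fun z => jet F z + t • jet b z) U :=
    (hF.jet_smooth hF.smooth).continuousOn.add
      ((hF.jet_smooth hb).continuousOn.const_smul t)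
  refine ⟨hF.toRelOpen.inter_preimage hc isOpen_immJets,
    (hF.smooth.add (hb.const_smul t)).mono fun _ h => h.1, fun z hz => ?_⟩
  have h : jet (F + t • b) z ∈ immJets m := by
    rw [hF.jet_add_smul hF.smooth hb t hz.1]; exact hz.2
  exact h

lemma density_mul_vol_add_smul (hb : ContDiffOn ℝ ∞ b U) {t : ℝ} (hy : y ∈ U)
    (ht : jet F y + t • jet b y ∈ immJets m) :
    localDensity (F + t • b) y * volDensity (F + t • b) y
      = jetEnergy (jet' F y + t • jet' b y) := by
  rw [(hF.add_smul hb t).density_mul_vol ⟨hy, ht⟩, hF.jet'_add_smul hF.smooth hb t hy]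

end Imm

/-! ### The first variation of the mean curvature -/

/-- The first variation of the mean curvature in direction `b`. -/
def varH (F b : Coord → Amb m) (y : Coord) : Amb m := fderiv ℝ jetH (jet F y) (jet b y)

lemma hasDerivAt_line {E : Type*} [NormedAddCommGroup E] [NormedSpace ℝ E] (p v : E) :
    HasDerivAt (fun t : ℝ => p + t • v) v 0 := by
  simpa using ((hasDerivAt_id (0 : ℝ)).smul_const v).const_add p

namespace Imm
variable (hF : Imm F U)
include hF

lemma varH_smooth (hb : ContDiffOn ℝ ∞ b U) : ContDiffOn ℝ ∞ (varH F b) U :=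
  ((jetH_smooth.fderiv_of_isOpen isOpen_immJets (m := ∞) (by simp)).comp
    (hF.jet_smooth hF.smooth) fun _ h => hF.jet_mem h).clm_apply (hF.jet_smooth hb)

lemma hasDerivAt_jetH (hy : y ∈ U) :
    HasDerivAt (fun t : ℝ => jetH (jet F y + t • jet b y)) (varH F b y) 0 := by
  have h := (hF.differentiableAt_jetH hy).hasFDerivAt
  have h0 : jet F y = jet F y + (0 : ℝ) • jet b y := by simp
  rw [h0] at h
  have := h.comp_hasDerivAt (0 : ℝ) (hasDerivAt_line (jet F y) (jet b y))
  rw [← h0] at this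
  exact this

/-- The variation of a derivative of the mean curvature is the derivative of its variation. -/
lemma hasDerivAt_jetDH (hb : ContDiffOn ℝ ∞ b U) (hy : y ∈ U) (i : Fin 4) :
    HasDerivAt (fun t : ℝ => jetDH (jet' F y + t • jet' b y) i) (pd i (varH F b) y) 0 := by
  have hq := isOpen_immJets.mem_nhds (hF.jet_mem hy)
  have hD : ContDiffAt ℝ ∞ (fderiv ℝ (jetH (m := m))) (jet F y) :=
    (jetH_smooth.fderiv_of_isOpen isOpen_immJets (m := ∞) (by simp)).contDiffAt hq
  have hD' := (hD.differentiableAt (by simp)).hasFDerivAt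
  have hsymm : IsSymmSndFDerivAt ℝ (jetH (m := m)) (jet F y) :=
    (jetH_smooth.contDiffAt hq).isSymmSndFDerivAt
      (by simp only [minSmoothness_of_isRCLikeNormedField]; exact ENat.LEInfty.out)
  have h1 : HasDerivAt (fun t : ℝ => fderiv ℝ jetH (jet F y + t • jet b y))
      (fderiv ℝ (fderiv ℝ jetH) (jet F y) (jet b y)) 0 := by
    have h0 : jet F y = jet F y + (0 : ℝ) • jet b y := by simp
    rw [h0] at hD'
    have := hD'.comp_hasDerivAt (0 : ℝ) (hasDerivAt_line (jet F y) (jet b y))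
    rw [← h0] at this
    exact this
  have h2 := h1.clm_apply (hasDerivAt_line (pd i (jet F) y) (pd i (jet b) y))
  have h3 := pd_of_hasFDerivWithinAt hF.toRelOpen hy
    ((hD'.comp_hasFDerivWithinAt y (hF.hasFDerivWithinAt (hF.jet_smooth hF.smooth) hy)).clm_apply
      (hF.hasFDerivWithinAt (hF.jet_smooth hb) hy)) i
  have h4 : pd i (varH F b) y = fderiv ℝ (fderiv ℝ jetH) (jet F y) (jet b y) (pd i (jet F) y)
      + fderiv ℝ jetH (jet F y) (pd i (jet b) y) := by
    refine (show pd i (varH F b) y = _ from h3).trans ?_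
    simp only [_root_.add_apply, ContinuousLinearMap.comp_apply, ContinuousLinearMap.flip_apply]
    rw [add_comm]
    congr 1
    exact hsymm _ _
  rw [h4]
  simp only [zero_smul, add_zero] at h2
  exact h2

end Imm
end

section
variable {m : ℕ} {F b : Coord → Amb m} {U : Set Coord} {y : Coord}

namespace Imm
variable (hF : Imm F U)
include hF

/-- Weingarten's relation. -/
lemma inner_pd_normal {X : Coord → Amb m} (hX : ContDiffOn ℝ ∞ X U)
    (hXn : ∀ z ∈ U, ∀ k, ⟪X z, pd k F z⟫_ℝ = 0) (hy : y ∈ U) (j k : Fin 4) :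
    ⟪pd j X y, pd k F y⟫_ℝ = -⟪X y, sff F j k y⟫_ℝ := by
  have h := hF.pd_congr (fun z hz => hXn z hz k) hy j
  rw [hF.pd_inner hX (hF.pd_frame_smooth k) hy, pd_const hF.toRelOpen hy] at h
  rw [hF.sff_eq hy, inner_of_normal_nproj (hXn y hy)]
  linarith

lemma eventually_immJets (b : Coord → Amb m) (hy : y ∈ U) :
    ∀ᶠ t : ℝ in 𝓝 0, jet F y + t • jet b y ∈ immJets m := by
  have hc : Continuous fun t : ℝ => jet F y + t • jet b y := by fun_prop
  refine hc.continuousAt.preimage_mem_nhds (isOpen_immJets.mem_nhds ?_)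
  simpa using hF.jet_mem hy

omit hF in
lemma hasDerivAt_frame (F b : Coord → Amb m) (y : Coord) (k : Fin 4) :
    HasDerivAt (fun t : ℝ => (jet F y + t • jet b y).1 k) (pd k b y) 0 :=
  hasDerivAt_line (pd k F y) (pd k b y)

/-- The first variation of the metric under a normal variation is `-2 b · h_{ij}`. -/
lemma hasDerivAt_gram (hb : ContDiffOn ℝ ∞ b U) (hbn : ∀ z ∈ U, ∀ k, ⟪b z, pd k F z⟫_ℝ = 0)
    (hy : y ∈ U) (i j : Fin 4) :
    HasDerivAt (fun t : ℝ => gram (jet F y + t • jet b y).1 i j)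
      (-2 * ⟪b y, sff F i j y⟫_ℝ) 0 := by
  have h := (hasDerivAt_frame F b y i).inner ℝ (hasDerivAt_frame F b y j)
  refine h.congr_deriv ?_
  simp only [zero_smul, add_zero]
  have h1 := hF.inner_pd_normal hb hbn hy i j
  have h2 := hF.inner_pd_normal hb hbn hy j i
  rw [real_inner_comm, hF.sff_symm hy] at h2
  change ⟪pd i F y, pd j b y⟫_ℝ + ⟪pd i b y, pd j F y⟫_ℝ = _
  linarith

omit hF in
lemma inner_sffUp (X : Amb m) (i j : Fin 4) : ⟪X, sffUp F i j y⟫_ℝ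
    = ∑ k, ∑ l, metricInv F y i k * metricInv F y j l * ⟪X, sff F k l y⟫_ℝ := by
  simp only [sffUp, inner_sum, real_inner_smul_right]

/-- The first variation of the inverse metric. -/
lemma hasDerivAt_gramInv (hb : ContDiffOn ℝ ∞ b U) (hbn : ∀ z ∈ U, ∀ k, ⟪b z, pd k F z⟫_ℝ = 0)
    (hy : y ∈ U) (i j : Fin 4) :
    HasDerivAt (fun t : ℝ => (gram (jet F y + t • jet b y).1)⁻¹ i j)
      (2 * ⟪b y, sffUp F i j y⟫_ℝ) 0 := by
  have hc : Continuous fun t : ℝ => jet F y + t • jet b y := by fun_prop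
  have ho : IsOpen ((fun t : ℝ => jet F y + t • jet b y) ⁻¹' immJets m) :=
    isOpen_immJets.preimage hc
  have h0 : (0 : ℝ) ∈ (fun t : ℝ => jet F y + t • jet b y) ⁻¹' immJets m := by
    simpa using hF.jet_mem hy
  have hs : ContDiffOn ℝ ∞ (fun t : ℝ => (jet F y + t • jet b y).1)
      ((fun t : ℝ => jet F y + t • jet b y) ⁻¹' immJets m) := by fun_prop
  have hd : ∀ a c, DifferentiableAt ℝ (fun t : ℝ => (gram (jet F y + t • jet b y).1)⁻¹ a c) 0 :=
    fun a c => ((gramInv_smooth hs (fun t ht => ht) a c).contDiffAt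
      (ho.mem_nhds h0)).differentiableAt (by simp)
  set G : Matrix (Fin 4) (Fin 4) ℝ := metricInv F y with hG
  set G' : Matrix (Fin 4) (Fin 4) ℝ := Matrix.of fun a c =>
    deriv (fun t : ℝ => (gram (jet F y + t • jet b y).1)⁻¹ a c) 0 with hG'
  set β : Matrix (Fin 4) (Fin 4) ℝ := Matrix.of fun a c => ⟪b y, sff F a c y⟫_ℝ with hβ
  -- the derivative of `g g⁻¹ = 1`
  have h1 : ((-2 : ℝ) • β) * G + metric F y * G' = 0 := by
    ext a c
    have e1 : HasDerivAt (fun t : ℝ => ∑ k, gram (jet F y + t • jet b y).1 a k *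
        (gram (jet F y + t • jet b y).1)⁻¹ k c)
        (∑ k, (-2 * ⟪b y, sff F a k y⟫_ℝ * G k c + metric F y a k * G' k c)) 0 := by
      refine HasDerivAt.fun_sum fun k _ => ?_
      have := (hF.hasDerivAt_gram hb hbn hy a k).mul (hd k c).hasDerivAt
      simp only [zero_smul, add_zero] at this
      exact this
    have e2 : (fun t : ℝ => ∑ k, gram (jet F y + t • jet b y).1 a k *
        (gram (jet F y + t • jet b y).1)⁻¹ k c) =ᶠ[𝓝 0] fun _ => (1 : Matrix _ _ ℝ) a c := by
      filter_upwards [hF.eventually_immJets b hy] with t ht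
      have ht' : 0 < (gram (jet F y + t • jet b y).1).det := ht
      rw [← Matrix.mul_apply, Matrix.mul_nonsing_inv _ ht'.ne'.isUnit]
    have e3 := e1.unique ((hasDerivAt_const (0 : ℝ) _).congr_of_eventuallyEq e2)
    rw [Finset.sum_add_distrib] at e3
    simp only [Matrix.add_apply, Matrix.mul_apply, Matrix.zero_apply, Matrix.smul_apply,
      smul_eq_mul, hβ, Matrix.of_apply]
    exact e3
  have hGg : G * metric F y = 1 := Matrix.nonsing_inv_mul _ (hF.isUnit_det hy)
  have h2 : G' = (2 : ℝ) • (G * (β * G)) := by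
    have h : metric F y * G' = (2 : ℝ) • (β * G) := by
      rw [eq_neg_of_add_eq_zero_right h1, Matrix.smul_mul, neg_smul, neg_neg]
    rw [← Matrix.one_mul G', ← hGg, Matrix.mul_assoc, h, Matrix.mul_smul]
  refine (hd i j).hasDerivAt.congr_deriv ?_
  have h3 := congrFun (congrFun h2 i) j
  refine (show deriv (fun t : ℝ => (gram (jet F y + t • jet b y).1)⁻¹ i j) 0 = G' i j
    from rfl).trans (h3.trans ?_)
  rw [inner_sffUp, Matrix.smul_apply, smul_eq_mul, Matrix.mul_apply]
  simp only [Matrix.mul_apply, Finset.mul_sum]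
  refine Finset.sum_congr rfl fun k _ => Finset.sum_congr rfl fun l _ => ?_
  rw [hG, metricInv_symm l j]
  simp only [hβ, Matrix.of_apply]
  ring

omit hF in
lemma inner_meanCurv (X : Amb m) :
    ⟪X, meanCurv F y⟫_ℝ = 1 / 4 * ∑ i, ∑ j, metricInv F y i j * ⟪X, sff F i j y⟫_ℝ := by
  simp only [meanCurv, inner_sum, real_inner_smul_right]

/-- The first variation of the volume density. -/
lemma hasDerivAt_vol (hb : ContDiffOn ℝ ∞ b U) (hbn : ∀ z ∈ U, ∀ k, ⟪b z, pd k F z⟫_ℝ = 0)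
    (hy : y ∈ U) :
    HasDerivAt (fun t : ℝ => Real.sqrt (gram (jet F y + t • jet b y).1).det)
      (-4 * ⟪b y, meanCurv F y⟫_ℝ * volDensity F y) 0 := by
  have hd := hasFDerivWithinAt_det (g := fun t : ℝ => gram (jet F y + t • jet b y).1)
    (s := Set.univ) (y := 0)
    fun i j => (hF.hasDerivAt_gram hb hbn hy i j).hasFDerivAt.hasFDerivWithinAt
  rw [hasFDerivWithinAt_univ] at hd
  have e0 : gram (jet F y + (0 : ℝ) • jet b y).1 = metric F y := by
    rw [zero_smul, add_zero]; rfl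
  have hd2 := hd.hasDerivAt.sqrt (by rw [e0]; exact (hF.det_pos y hy).ne')
  refine hd2.congr_deriv ?_
  rw [e0]
  have hadj : ∀ i j, (metric F y).adjugate i j = (metric F y).det * metricInv F y i j := by
    intro i j
    rw [metricInv, Matrix.inv_def, Matrix.smul_apply, Ring.inverse_eq_inv', smul_eq_mul,
      mul_inv_cancel_left₀ (hF.det_pos y hy).ne']
  have hs : Real.sqrt (metric F y).det = volDensity F y := rfl
  have hsq : (metric F y).det = volDensity F y * volDensity F y :=
    (Real.mul_self_sqrt (hF.det_pos y hy).le).symm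
  have hv := (hF.volDensity_pos hy).ne'
  simp only [_root_.sum_apply, _root_.smul_apply, smul_eq_mul, hadj,
    ContinuousLinearMap.toSpanSingleton_apply, one_mul, inner_meanCurv]
  have h3 : ∑ i, ∑ j, (metric F y).det * metricInv F y j i * (-2 * ⟪b y, sff F i j y⟫_ℝ)
      = -2 * (metric F y).det * ∑ i, ∑ j, metricInv F y i j * ⟪b y, sff F i j y⟫_ℝ := by
    simp only [Finset.mul_sum]
    refine Finset.sum_congr rfl fun i _ => Finset.sum_congr rfl fun j _ => ?_
    rw [metricInv_symm j i]; ring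
  rw [h3, hs, hsq]
  field_simp

/-- The tangential part of the variation of the mean curvature. -/
lemma inner_varH_frame (hb : ContDiffOn ℝ ∞ b U) (hy : y ∈ U) (k : Fin 4) :
    ⟪varH F b y, pd k F y⟫_ℝ = -⟪meanCurv F y, pd k b y⟫_ℝ := by
  have h1 := (hF.hasDerivAt_jetH (b := b) hy).inner ℝ (hasDerivAt_frame F b y k)
  -- the mean curvature of `F + t b` is normal to `F + t b`
  have e2 : (fun t : ℝ => ⟪jetH (jet F y + t • jet b y), (jet F y + t • jet b y).1 k⟫_ℝ)
      =ᶠ[𝓝 0] fun _ => 0 := by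
    filter_upwards [hF.eventually_immJets b hy] with t ht
    have hI := hF.add_smul hb t
    have := hI.meanCurv_normal ⟨hy, ht⟩ k
    rw [hI.meanCurv_eq_jetH ⟨hy, ht⟩, hF.jet_add_smul hF.smooth hb t hy] at this
    rw [← this, ← hF.jet_add_smul hF.smooth hb t hy]; rfl
  have e3 := h1.unique ((hasDerivAt_const (0 : ℝ) (0 : ℝ)).congr_of_eventuallyEq e2)
  simp only [zero_smul, add_zero] at e3
  rw [← hF.meanCurv_eq_jetH hy] at e3
  have e4 : (jet F y).1 k = pd k F y := rfl
  rw [e4] at e3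
  linarith

/-- Normal Hessians computed with and without projecting the first derivative. -/
lemma nproj_hessian (hb : ContDiffOn ℝ ∞ b U) (hbn : ∀ z ∈ U, ∀ k, ⟪b z, pd k F z⟫_ℝ = 0)
    (hy : y ∈ U) (i j : Fin 4) : nproj F y (nablaLow F (fun k => pd k b) i j y)
      = nproj F y (nablaLow F (fun k => normalPd F k b) i j y)
        - ∑ l, (∑ k, metricInv F y k l * ⟪b y, sff F j k y⟫_ℝ) • sff F i l y := by
  have hβ : ∀ k, ContDiffOn ℝ ∞ (fun z => ⟪b z, sff F j k z⟫_ℝ) U := fun k =>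
    hb.inner ℝ (hF.sff_smooth j k)
  have hc : ∀ j l, ContDiffOn ℝ ∞
      (fun z => ∑ k, metricInv F z k l * ⟪b z, sff F j k z⟫_ℝ) U := fun j l =>
    ContDiffOn.sum fun k _ => (hF.metricInv_smooth k l).mul (hb.inner ℝ (hF.sff_smooth j k))
  have h1 : ∀ j, ∀ z ∈ U, pd j b z = normalPd F j b z
      - ∑ l, (∑ k, metricInv F z k l * ⟪b z, sff F j k z⟫_ℝ) • pd l F z := by
    intro j z hz
    rw [normalPd, normalPart_eq, nproj_apply, Finset.sum_comm]
    simp only [hF.inner_pd_normal hb hbn hz, Finset.sum_smul, mul_neg, neg_smul,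
      Finset.sum_neg_distrib]
    abel
  have h2 : ∀ j, nproj F y (pd j b y) = nproj F y (normalPd F j b y) := by
    intro j
    rw [h1 j y hy]
    simp [hF.nproj_frame hy]
  rw [nablaLow, nablaLow, map_sub, map_sub, map_sum, map_sum]
  simp only [map_smul, h2]
  rw [hF.pd_congr (h1 j) hy, hF.pd_sub (f := normalPd F j b)
    (g := fun z => ∑ l, (∑ k, metricInv F z k l * ⟪b z, sff F j k z⟫_ℝ) • pd l F z)
    (hF.normalPd_smooth hb j) (ContDiffOn.sum fun l _ => (hc j l).smul (hF.pd_frame_smooth l)) hy,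
    hF.pd_sum (f := fun l z => (∑ k, metricInv F z k l * ⟪b z, sff F j k z⟫_ℝ) • pd l F z) _
      (fun l _ => (hc j l).smul (hF.pd_frame_smooth l)) hy, map_sub, map_sum]
  have h3 : ∀ l, nproj F y
      (pd i (fun z => (∑ k, metricInv F z k l * ⟪b z, sff F j k z⟫_ℝ) • pd l F z) y)
      = (∑ k, metricInv F y k l * ⟪b y, sff F j k y⟫_ℝ) • sff F i l y := by
    intro l
    rw [hF.pd_smul (hc j l) (hF.pd_frame_smooth l) hy, map_add, map_smul, map_smul,
      hF.nproj_frame hy, smul_zero, zero_add, hF.sff_eq hy]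
  simp only [h3]
  abel

/-- The trace of the normal part of the covariant Hessian of a normal field differs from `Δ_⊥ b` by
the second derivative terms that the tangential part of `∇b` produces. -/
lemma sum_metricInv_nproj_hessian (hb : ContDiffOn ℝ ∞ b U)
    (hbn : ∀ z ∈ U, ∀ k, ⟪b z, pd k F z⟫_ℝ = 0) (hy : y ∈ U) :
    ∑ i, ∑ j, metricInv F y i j • nproj F y (nablaLow F (fun k => pd k b) i j y)
      = lapPerp F b y - ∑ i, ∑ j, ⟪b y, sffUp F i j y⟫_ℝ • sff F i j y := by
  simp only [hF.nproj_hessian hb hbn hy, smul_sub, Finset.sum_sub_distrib]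
  congr 1
  refine Finset.sum_congr rfl fun i _ => ?_
  simp only [inner_sffUp, Finset.smul_sum, smul_smul, Finset.sum_smul]
  rw [Finset.sum_comm]
  refine Finset.sum_congr rfl fun l _ => Finset.sum_congr rfl fun j _ =>
    Finset.sum_congr rfl fun k _ => ?_
  rw [metricInv_symm k l, mul_assoc]

/-- The normal part of the variation of the mean curvature. -/
lemma nproj_varH (hb : ContDiffOn ℝ ∞ b U) (hbn : ∀ z ∈ U, ∀ k, ⟪b z, pd k F z⟫_ℝ = 0)
    (hy : y ∈ U) : nproj F y (varH F b y)
      = (1 / 4 : ℝ) • (lapPerp F b y + ∑ i, ∑ j, ⟪b y, sffUp F i j y⟫_ℝ • sff F i j y) := by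
  have hs : ∀ i j, HasDerivAt (fun t : ℝ => (jet F y + t • jet b y).2 i j) (pd i (pd j b) y) 0 :=
    fun i j => hasDerivAt_line (pd i (pd j F) y) (pd i (pd j b) y)
  have hG := hF.hasDerivAt_gramInv hb hbn hy
  have e0 : ∀ k l, (gram (jet F y + (0 : ℝ) • jet b y).1)⁻¹ k l = metricInv F y k l := by
    intro k l
    rw [zero_smul, add_zero]; rfl
  have hγ : ∀ i j l, ∃ c, HasDerivAt (fun t : ℝ => ∑ k, (gram (jet F y + t • jet b y).1)⁻¹ k l *
      ⟪(jet F y + t • jet b y).2 i j, (jet F y + t • jet b y).1 k⟫_ℝ) c 0 := fun i j l =>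
    ⟨_, HasDerivAt.fun_sum fun k _ => (hG k l).mul ((hs i j).inner ℝ (hasDerivAt_frame F b y k))⟩
  choose c hc using hγ
  have h := (HasDerivAt.fun_sum (u := Finset.univ) fun i _ =>
    HasDerivAt.fun_sum (u := Finset.univ) fun j _ => (hG i j).smul
    ((hs i j).sub (HasDerivAt.fun_sum (u := Finset.univ) fun l _ =>
      (hc i j l).smul (hasDerivAt_frame F b y l)))).const_smul (1 / 4 : ℝ)
  have h2 := (hF.hasDerivAt_jetH (b := b) hy).unique h
  rw [h2]
  simp only [e0]
  simp only [Pi.sub_apply, Pi.smul_apply', zero_smul, add_zero, map_sum, map_smul, map_add, map_sub]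
  have e1 : ∀ k, (jet F y).1 k = pd k F y := fun k => rfl
  have e2 : ∀ i j, (jet F y).2 i j = pd i (pd j F) y := fun i j => rfl
  have e3 : ∀ i j l, ∑ k, metricInv F y k l * ⟪pd i (pd j F) y, pd k F y⟫_ℝ
      = christoffel F l i j y := fun i j l => by
    rw [hF.christoffel_eq hy]
    exact Finset.sum_congr rfl fun k _ => by rw [metricInv_symm]
  simp only [e1, e2, e3, hF.nproj_frame hy, smul_zero, Finset.sum_const_zero, sub_zero, add_zero,
    ← hF.sff_eq hy]
  have e4 : ∀ i j, nproj F y (pd i (pd j b) y) - ∑ l, christoffel F l i j y • nproj F y (pd l b y)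
      = nproj F y (nablaLow F (fun k => pd k b) i j y) := fun i j => by
    rw [nablaLow, map_sub, map_sum]; simp only [map_smul]
  simp only [e4, Finset.sum_add_distrib, hF.sum_metricInv_nproj_hessian hb hbn hy, mul_smul,
    two_smul]
  congr 1
  abel

end Imm
end

/-! ### The first variation of the energy density -/

section
variable {m : ℕ} {F b : Coord → Amb m} {U : Set Coord} {y : Coord}

lemma sum_comm_pairs {ι R : Type*} [Fintype ι] [AddCommMonoid R] (f : ι → ι → ι → ι → R) :
    ∑ i, ∑ j, ∑ k, ∑ l, f i j k l = ∑ k, ∑ l, ∑ i, ∑ j, f i j k l := by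
  have h1 : ∀ i, ∑ j, ∑ k, ∑ l, f i j k l = ∑ k, ∑ l, ∑ j, f i j k l := fun i => by
    rw [Finset.sum_comm]
    exact Finset.sum_congr rfl fun k _ => Finset.sum_comm
  simp only [h1]
  rw [Finset.sum_comm]
  exact Finset.sum_congr rfl fun k _ => Finset.sum_comm

/-- The vector field `(h^j_i · ∇^i H) H`. -/
def hGradH (F : Coord → Amb m) (j : Fin 4) (z : Coord) : Amb m :=
  ∑ i, ⟪sffMixed F j i z, grad F (meanCurv F) i z⟫_ℝ • meanCurv F z

/-- The vector field `(H · h^j_i) π_n ∇^i H`. -/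
def HhGrad (F : Coord → Amb m) (j : Fin 4) (z : Coord) : Amb m :=
  ∑ i, ⟪meanCurv F z, sffMixed F j i z⟫_ℝ • normalGrad F (meanCurv F) i z

namespace Imm
variable (hF : Imm F U)
include hF

lemma hGradH_smooth (j : Fin 4) : ContDiffOn ℝ ∞ (hGradH F j) U :=
  ContDiffOn.sum fun i _ => ((hF.sffMixed_smooth j i).inner ℝ
    (hF.grad_smooth hF.meanCurv_smooth i)).smul hF.meanCurv_smooth

lemma HhGrad_smooth (j : Fin 4) : ContDiffOn ℝ ∞ (HhGrad F j) U :=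
  ContDiffOn.sum fun i _ => (hF.meanCurv_smooth.inner ℝ (hF.sffMixed_smooth j i)).smul
    (hF.normalGrad_smooth hF.meanCurv_smooth i)

lemma normalGrad_normal (X : Coord → Amb m) (hy : y ∈ U) (i k : Fin 4) :
    ⟪normalGrad F X i y, pd k F y⟫_ℝ = 0 := by
  rw [normalGrad, normalPart_eq, hF.inner_nproj_frame hy]

lemma sffMixed_normal (hy : y ∈ U) (i j k : Fin 4) : ⟪sffMixed F i j y, pd k F y⟫_ℝ = 0 := by
  simp [sffMixed, sum_inner, real_inner_smul_left, hF.sff_normal hy]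

/-- The variation of the mean curvature, split into its normal and tangential parts. -/
lemma varH_eq (hb : ContDiffOn ℝ ∞ b U) (hy : y ∈ U) :
    varH F b y = normalPart F (varH F b) y
      - ∑ k, (∑ l, metricInv F y l k * ⟪meanCurv F y, pd l b y⟫_ℝ) • pd k F y := by
  rw [normalPart_eq, nproj_apply, Finset.sum_comm]
  simp only [hF.inner_varH_frame hb hy, Finset.sum_smul, mul_neg, neg_smul,
    Finset.sum_neg_distrib]
  abel

/-- The tangential part of the variation of the mean curvature contributes to the normal part of its
derivative through the second fundamental form. -/
lemma inner_pd_varH (hb : ContDiffOn ℝ ∞ b U) (hy : y ∈ U) {n : Amb m}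
    (hn : ∀ k, ⟪n, pd k F y⟫_ℝ = 0) (j : Fin 4) :
    ⟪n, pd j (varH F b) y⟫_ℝ = ⟪n, pd j (normalPart F (varH F b)) y⟫_ℝ
      - ∑ l, ⟪n, sffMixed F l j y⟫_ℝ * ⟪meanCurv F y, pd l b y⟫_ℝ := by
  have hc : ∀ k, ContDiffOn ℝ ∞
      (fun z => ∑ l, metricInv F z l k * ⟪meanCurv F z, pd l b z⟫_ℝ) U := fun k =>
    ContDiffOn.sum fun l _ => (hF.metricInv_smooth l k).mul
      (hF.meanCurv_smooth.inner ℝ (hF.pd_smooth hb l))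
  rw [hF.pd_congr (fun z hz => hF.varH_eq hb hz) hy, hF.pd_sub (f := normalPart F (varH F b))
    (g := fun z => ∑ k, (∑ l, metricInv F z l k * ⟪meanCurv F z, pd l b z⟫_ℝ) • pd k F z)
    (hF.normalPart_smooth (hF.varH_smooth hb))
    (ContDiffOn.sum fun k _ => (hc k).smul (hF.pd_frame_smooth k)) hy,
    hF.pd_sum (f := fun k z => (∑ l, metricInv F z l k * ⟪meanCurv F z, pd l b z⟫_ℝ) • pd k F z) _
      (fun k _ => (hc k).smul (hF.pd_frame_smooth k)) hy, inner_sub_right, inner_sum]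
  congr 1
  have h3 : ∀ k, ⟪n, pd j
      (fun z => (∑ l, metricInv F z l k * ⟪meanCurv F z, pd l b z⟫_ℝ) • pd k F z) y⟫_ℝ
      = ∑ l, metricInv F y l k * ⟪meanCurv F y, pd l b y⟫_ℝ * ⟪n, sff F k j y⟫_ℝ := by
    intro k
    rw [hF.pd_smul (hc k) (hF.pd_frame_smooth k) hy, inner_add_right, real_inner_smul_right,
      real_inner_smul_right, hn, mul_zero, zero_add, hF.sff_symm hy, hF.sff_eq hy,
      inner_of_normal_nproj hn, Finset.sum_mul]
  simp only [h3, sffMixed, inner_sum, real_inner_smul_right, Finset.sum_mul]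
  rw [Finset.sum_comm]
  exact Finset.sum_congr rfl fun l _ => Finset.sum_congr rfl fun k _ => by ring

/-- The variation of `π_n ∂_j H`, tested against normal vectors. -/
lemma hasDerivAt_jetProj_jetDH (hb : ContDiffOn ℝ ∞ b U)
    (hbn : ∀ z ∈ U, ∀ k, ⟪b z, pd k F z⟫_ℝ = 0) (hy : y ∈ U) (j : Fin 4) :
    ∃ w, HasDerivAt (fun t : ℝ => jetProj (jet F y + t • jet b y).1
        (jetDH (jet' F y + t • jet' b y) j)) w 0 ∧
      ∀ n : Amb m, (∀ k, ⟪n, pd k F y⟫_ℝ = 0) → ⟪n, w⟫_ℝ = ⟪n, pd j (varH F b) y⟫_ℝ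
        + ∑ l, ⟪meanCurv F y, sffMixed F l j y⟫_ℝ * ⟪n, pd l b y⟫_ℝ := by
  have hG := hF.hasDerivAt_gramInv hb hbn hy
  have hp := hF.hasDerivAt_jetDH hb hy j
  have e0 : ∀ k l, (gram (jet F y + (0 : ℝ) • jet b y).1)⁻¹ k l = metricInv F y k l := by
    intro k l
    rw [zero_smul, add_zero]; rfl
  have hγ : ∀ l, ∃ c, HasDerivAt (fun t : ℝ => ∑ k, (gram (jet F y + t • jet b y).1)⁻¹ k l *
      ⟪jetDH (jet' F y + t • jet' b y) j, (jet F y + t • jet b y).1 k⟫_ℝ) c 0 := fun l =>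
    ⟨_, HasDerivAt.fun_sum fun k _ => (hG k l).mul (hp.inner ℝ (hasDerivAt_frame F b y k))⟩
  choose c hc using hγ
  have h := hp.sub (HasDerivAt.fun_sum (u := Finset.univ) fun l _ =>
      (hc l).smul (hasDerivAt_frame F b y l))
  refine ⟨_, h, fun n hn => ?_⟩
  simp only [e0]
  simp only [zero_smul, add_zero, ← hF.pd_meanCurv hy]
  have e1 : ∀ k, (jet F y).1 k = pd k F y := fun k => rfl
  have e3 : ∀ l, ∑ k, metricInv F y k l * ⟪pd j (meanCurv F) y, pd k F y⟫_ℝ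
      = - ⟪meanCurv F y, sffMixed F l j y⟫_ℝ := fun l => by
    rw [sffMixed, inner_sum, ← Finset.sum_neg_distrib]
    refine Finset.sum_congr rfl fun k _ => ?_
    rw [hF.inner_pd_normal hF.meanCurv_smooth (fun z hz => hF.meanCurv_normal hz) hy,
      metricInv_symm, hF.sff_symm hy, real_inner_smul_right, mul_neg]
  simp only [e1, e3, inner_sub_right, inner_sum, inner_add_right, real_inner_smul_right, hn,
    mul_zero, add_zero, neg_mul, Finset.sum_neg_distrib, sub_neg_eq_add]

/-- The variation of `|π_n ∇H|²`. -/
lemma hasDerivAt_gradTerm (hb : ContDiffOn ℝ ∞ b U)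
    (hbn : ∀ z ∈ U, ∀ k, ⟪b z, pd k F z⟫_ℝ = 0) (hy : y ∈ U) :
    HasDerivAt (fun t : ℝ => ∑ i, ∑ j, (gram (jet F y + t • jet b y).1)⁻¹ i j *
      ⟪jetProj (jet F y + t • jet b y).1 (jetDH (jet' F y + t • jet' b y) i),
        jetProj (jet F y + t • jet b y).1 (jetDH (jet' F y + t • jet' b y) j)⟫_ℝ)
      (2 * ∑ i, ∑ j, ⟪normalPd F i (meanCurv F) y, normalPd F j (meanCurv F) y⟫_ℝ *
          ⟪b y, sffUp F i j y⟫_ℝ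
        + 2 * ∑ j, ⟪normalGrad F (meanCurv F) j y, pd j (normalPart F (varH F b)) y⟫_ℝ
        - 2 * ∑ j, ⟪hGradH F j y, pd j b y⟫_ℝ + 2 * ∑ j, ⟪HhGrad F j y, pd j b y⟫_ℝ) 0 := by
  have hG := hF.hasDerivAt_gramInv hb hbn hy
  choose w hw hwn using hF.hasDerivAt_jetProj_jetDH hb hbn hy
  have h := HasDerivAt.fun_sum (u := Finset.univ) fun i _ =>
    HasDerivAt.fun_sum (u := Finset.univ) fun j _ => (hG i j).mul ((hw i).inner ℝ (hw j))
  refine h.congr_deriv ?_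
  have e0 : ∀ k l, (gram (jet F y + (0 : ℝ) • jet b y).1)⁻¹ k l = metricInv F y k l := by
    intro k l
    rw [zero_smul, add_zero]; rfl
  have e1 : ∀ i, jetProj (jet F y + (0 : ℝ) • jet b y).1
      (jetDH (jet' F y + (0 : ℝ) • jet' b y) i) = normalPd F i (meanCurv F) y := by
    intro i
    rw [zero_smul, add_zero, zero_smul, add_zero, ← hF.pd_meanCurv hy, jetProj_eq]; rfl
  simp only [e0, e1]
  have hZ : ∑ i, ∑ j, metricInv F y i j * (⟪normalPd F i (meanCurv F) y, w j⟫_ℝ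
      + ⟪w i, normalPd F j (meanCurv F) y⟫_ℝ)
      = 2 * ∑ j, ⟪normalGrad F (meanCurv F) j y, w j⟫_ℝ := by
    simp only [normalGrad_eq, sum_inner, real_inner_smul_left, mul_add, Finset.sum_add_distrib,
      two_mul]
    congr 1
    · rw [Finset.sum_comm]
      exact Finset.sum_congr rfl fun i _ => Finset.sum_congr rfl fun j _ => by
        rw [metricInv_symm]
    · exact Finset.sum_congr rfl fun i _ => Finset.sum_congr rfl fun j _ => by
        rw [real_inner_comm]
  have h2 : ∀ j, ⟪normalGrad F (meanCurv F) j y, w j⟫_ℝ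
      = ⟪normalGrad F (meanCurv F) j y, pd j (normalPart F (varH F b)) y⟫_ℝ
      - ∑ l, ⟪normalGrad F (meanCurv F) j y, sffMixed F l j y⟫_ℝ * ⟪meanCurv F y, pd l b y⟫_ℝ
      + ∑ l, ⟪meanCurv F y, sffMixed F l j y⟫_ℝ
        * ⟪normalGrad F (meanCurv F) j y, pd l b y⟫_ℝ := fun j => by
    rw [hwn j _ (hF.normalGrad_normal _ hy j), hF.inner_pd_varH hb hy (hF.normalGrad_normal _ hy j)]
  have h3 : ∑ j, ∑ l, ⟪normalGrad F (meanCurv F) j y, sffMixed F l j y⟫_ℝ *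
      ⟪meanCurv F y, pd l b y⟫_ℝ = ∑ j, ⟪hGradH F j y, pd j b y⟫_ℝ := by
    rw [Finset.sum_comm]
    refine Finset.sum_congr rfl fun l _ => ?_
    simp only [hGradH, sum_inner, real_inner_smul_left]
    refine Finset.sum_congr rfl fun j _ => ?_
    rw [normalGrad, normalPart_eq, inner_nproj_of_normal (hF.sffMixed_normal hy l j),
      real_inner_comm]
  have h4 : ∑ j, ∑ l, ⟪meanCurv F y, sffMixed F l j y⟫_ℝ
        * ⟪normalGrad F (meanCurv F) j y, pd l b y⟫_ℝ = ∑ j, ⟪HhGrad F j y, pd j b y⟫_ℝ := by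
    rw [Finset.sum_comm]
    simp only [HhGrad, sum_inner, real_inner_smul_left]
  rw [← h3, ← h4]
  simp only [Finset.sum_add_distrib, hZ, h2, Finset.sum_sub_distrib]
  have h5 : ∑ i, ∑ j, 2 * ⟪b y, sffUp F i j y⟫_ℝ *
      ⟪normalPd F i (meanCurv F) y, normalPd F j (meanCurv F) y⟫_ℝ
      = 2 * ∑ i, ∑ j, ⟪normalPd F i (meanCurv F) y, normalPd F j (meanCurv F) y⟫_ℝ *
          ⟪b y, sffUp F i j y⟫_ℝ := by
    simp only [Finset.mul_sum]
    exact Finset.sum_congr rfl fun i _ => Finset.sum_congr rfl fun j _ => by ring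
  rw [h5]
  ring

/-- The variation of `H · h_{ij}`. The tangential part of the variation of `H` supplies the
Christoffel term of the covariant Hessian of `b`. -/
lemma inner_varH_hessian (hb : ContDiffOn ℝ ∞ b U) (hy : y ∈ U) (i j : Fin 4) :
    ⟪varH F b y, pd i (pd j F) y⟫_ℝ + ⟪meanCurv F y, pd i (pd j b) y⟫_ℝ
      = ⟪normalPart F (varH F b) y, sff F i j y⟫_ℝ
        + ⟪meanCurv F y, nablaLow F (fun k => pd k b) i j y⟫_ℝ := by
  have h1 : ∑ k, (∑ l, metricInv F y l k * ⟪meanCurv F y, pd l b y⟫_ℝ) *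
      ⟪pd k F y, pd i (pd j F) y⟫_ℝ
      = ∑ l, christoffel F l i j y * ⟪meanCurv F y, pd l b y⟫_ℝ := by
    simp only [hF.christoffel_eq hy, Finset.sum_mul]
    rw [Finset.sum_comm]
    exact Finset.sum_congr rfl fun l _ => Finset.sum_congr rfl fun k _ => by
      rw [real_inner_comm (pd k F y)]; ring
  have h2 : ⟪normalPart F (varH F b) y, sff F i j y⟫_ℝ
      = ⟪normalPart F (varH F b) y, pd i (pd j F) y⟫_ℝ := by
    rw [hF.sff_eq hy, normalPart_eq, hF.inner_nproj_nproj hy]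
  rw [hF.varH_eq hb hy, inner_sub_left, sum_inner, h2, nablaLow, inner_sub_right, inner_sum]
  simp only [real_inner_smul_left, real_inner_smul_right, h1]
  ring

lemma inner_H_sff_symm (hy : y ∈ U) (i j : Fin 4) :
    ⟪meanCurv F y, sff F i j y⟫_ℝ = ⟪meanCurv F y, sff F j i y⟫_ℝ := by rw [hF.sff_symm hy]

/-- The variation of `|H · h|²`. -/
lemma hasDerivAt_HhTerm (hb : ContDiffOn ℝ ∞ b U)
    (hbn : ∀ z ∈ U, ∀ k, ⟪b z, pd k F z⟫_ℝ = 0) (hy : y ∈ U) :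
    HasDerivAt (fun t : ℝ => ∑ i, ∑ j, (∑ k, ∑ l, (gram (jet F y + t • jet b y).1)⁻¹ i k *
        (gram (jet F y + t • jet b y).1)⁻¹ j l *
        ⟪jetH (jet F y + t • jet b y), (jet F y + t • jet b y).2 k l⟫_ℝ) *
        ⟪jetH (jet F y + t • jet b y), (jet F y + t • jet b y).2 i j⟫_ℝ)
      (4 * ∑ i, ∑ j, ∑ k, ⟪meanCurv F y, sff F i j y⟫_ℝ * ⟪meanCurv F y, sffMixed F i k y⟫_ℝ *
          ⟪b y, sffUp F j k y⟫_ℝ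
        + 2 * ⟪hhH F y, normalPart F (varH F b) y⟫_ℝ
        + 2 * ∑ i, ∑ j, ⟪HhH F i j y, nablaLow F (fun k => pd k b) i j y⟫_ℝ) 0 := by
  have hG := hF.hasDerivAt_gramInv hb hbn hy
  have hs : ∀ i j, HasDerivAt (fun t : ℝ => (jet F y + t • jet b y).2 i j) (pd i (pd j b) y) 0 :=
    fun i j => hasDerivAt_line (pd i (pd j F) y) (pd i (pd j b) y)
  have hA : ∀ i j, HasDerivAt (fun t : ℝ =>
      ⟪jetH (jet F y + t • jet b y), (jet F y + t • jet b y).2 i j⟫_ℝ)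
      (⟪normalPart F (varH F b) y, sff F i j y⟫_ℝ
        + ⟪meanCurv F y, nablaLow F (fun k => pd k b) i j y⟫_ℝ) 0 := fun i j => by
    refine ((hF.hasDerivAt_jetH (b := b) hy).inner ℝ (hs i j)).congr_deriv ?_
    rw [← hF.inner_varH_hessian hb hy, zero_smul, add_zero, ← hF.meanCurv_eq_jetH hy, add_comm]
    rfl
  have h := HasDerivAt.fun_sum (u := Finset.univ) fun i _ =>
    HasDerivAt.fun_sum (u := Finset.univ) fun j _ => (HasDerivAt.fun_sum (u := Finset.univ)
      fun k _ => HasDerivAt.fun_sum (u := Finset.univ) fun l _ =>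
        ((hG i k).mul (hG j l)).mul (hA k l)).mul (hA i j)
  refine h.congr_deriv ?_
  have e0 : ∀ k l, (gram (jet F y + (0 : ℝ) • jet b y).1)⁻¹ k l = metricInv F y k l := by
    intro k l
    rw [zero_smul, add_zero]; rfl
  have e1 : ∀ i j, ⟪jetH (jet F y + (0 : ℝ) • jet b y), (jet F y + (0 : ℝ) • jet b y).2 i j⟫_ℝ
      = ⟪meanCurv F y, sff F i j y⟫_ℝ := fun i j => by
    rw [zero_smul, add_zero, ← hF.meanCurv_eq_jetH hy, hF.inner_meanCurv_sff hy]; rfl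
  simp only [Pi.mul_apply, e0, e1]
  set G := metricInv F y with hGdef
  have hGs : ∀ i j, G i j = G j i := fun i j => metricInv_symm i j
  set A : Fin 4 → Fin 4 → ℝ := fun i j => ⟪meanCurv F y, sff F i j y⟫_ℝ with hAdef
  have hAs : ∀ i j, A i j = A j i := fun i j => hF.inner_H_sff_symm hy i j
  set β : Fin 4 → Fin 4 → ℝ := fun i j => ⟪b y, sffUp F i j y⟫_ℝ with hβdef
  set a : Fin 4 → Fin 4 → ℝ := fun i j => ⟪normalPart F (varH F b) y, sff F i j y⟫_ℝ
        + ⟪meanCurv F y, nablaLow F (fun k => pd k b) i j y⟫_ℝ with hadef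
  have e2 : ∀ i k, ⟪meanCurv F y, sffMixed F i k y⟫_ℝ = ∑ p, G i p * A p k := fun i k => by
    simp only [sffMixed, inner_sum, real_inner_smul_right, A, G]
  have e3 : ∀ i j, ⟪meanCurv F y, sffUp F i j y⟫_ℝ = ∑ k, ∑ l, G i k * G j l * A k l :=
    fun i j => inner_sffUp _ i j
  have e4 : ⟪hhH F y, normalPart F (varH F b) y⟫_ℝ
      + ∑ i, ∑ j, ⟪HhH F i j y, nablaLow F (fun k => pd k b) i j y⟫_ℝ
      = ∑ i, ∑ j, ∑ k, ∑ l, G i k * G j l * A k l * a i j := by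
    simp only [hhH, HhH, sum_inner, real_inner_smul_left, e3, ← Finset.sum_add_distrib,
      Finset.sum_mul, a, mul_add]
    simp only [Finset.sum_add_distrib, real_inner_comm (normalPart F (varH F b) y)]
  have s1 : ∑ i, ∑ j, ∑ k, ∑ l, 2 * β i k * G j l * A k l * A i j
      = 2 * ∑ i, ∑ j, ∑ k, A i j * (∑ p, G i p * A p k) * β j k := by
    rw [Finset.sum_comm]
    simp only [Finset.mul_sum, Finset.sum_mul]
    refine Finset.sum_congr rfl fun i _ => Finset.sum_congr rfl fun j _ =>
      Finset.sum_congr rfl fun k _ => Finset.sum_congr rfl fun l _ => ?_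
    rw [hAs j i, hAs k l]; ring
  have s2 : ∑ i, ∑ j, ∑ k, ∑ l, G i k * (2 * β j l) * A k l * A i j
      = 2 * ∑ i, ∑ j, ∑ k, A i j * (∑ p, G i p * A p k) * β j k := by
    simp only [Finset.mul_sum, Finset.sum_mul]
    refine Finset.sum_congr rfl fun i _ => Finset.sum_congr rfl fun j _ => ?_
    rw [Finset.sum_comm]
    refine Finset.sum_congr rfl fun k _ => Finset.sum_congr rfl fun l _ => ?_
    ring
  have s3 : ∑ i, ∑ j, ∑ k, ∑ l, G i k * G j l * a k l * A i j
      = ∑ i, ∑ j, ∑ k, ∑ l, G i k * G j l * A k l * a i j := by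
    rw [sum_comm_pairs]
    refine Finset.sum_congr rfl fun i _ => Finset.sum_congr rfl fun j _ =>
      Finset.sum_congr rfl fun k _ => Finset.sum_congr rfl fun l _ => ?_
    rw [hGs k i, hGs l j]; ring
  simp only [e2]
  have e5 : ∀ i j, ⟪b y, sffUp F i j y⟫_ℝ = β i j := fun i j => rfl
  have e6 : ∀ i j, ⟪meanCurv F y, sff F i j y⟫_ℝ = A i j := fun i j => rfl
  have e7 : ∀ i j, ⟪normalPart F (varH F b) y, sff F i j y⟫_ℝ
        + ⟪meanCurv F y, nablaLow F (fun k => pd k b) i j y⟫_ℝ = a i j := fun i j => rfl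
  simp only [e5, e6, e7]
  simp only [add_mul, Finset.sum_add_distrib, Finset.sum_mul]
  rw [s1, s2, s3]
  linarith [e4]

end Imm
end

section
variable {m : ℕ} {F b : Coord → Amb m} {U : Set Coord} {y : Coord}

namespace Imm
variable (hF : Imm F U)
include hF

/-- The variation of the energy density, before integration by parts. -/
lemma hasDerivAt_jetDensity (hb : ContDiffOn ℝ ∞ b U)
    (hbn : ∀ z ∈ U, ∀ k, ⟪b z, pd k F z⟫_ℝ = 0) (hy : y ∈ U) :
    HasDerivAt (fun t : ℝ => jetDensity (jet' F y + t • jet' b y))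
      ((2 * ∑ i, ∑ j, ⟪normalPd F i (meanCurv F) y, normalPd F j (meanCurv F) y⟫_ℝ *
          ⟪b y, sffUp F i j y⟫_ℝ
        + 2 * ∑ j, ⟪normalGrad F (meanCurv F) j y, pd j (normalPart F (varH F b)) y⟫_ℝ
        - 2 * ∑ j, ⟪hGradH F j y, pd j b y⟫_ℝ + 2 * ∑ j, ⟪HhGrad F j y, pd j b y⟫_ℝ)
      - (4 * ∑ i, ∑ j, ∑ k, ⟪meanCurv F y, sff F i j y⟫_ℝ * ⟪meanCurv F y, sffMixed F i k y⟫_ℝ *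
          ⟪b y, sffUp F j k y⟫_ℝ
        + 2 * ⟪hhH F y, normalPart F (varH F b) y⟫_ℝ
        + 2 * ∑ i, ∑ j, ⟪HhH F i j y, nablaLow F (fun k => pd k b) i j y⟫_ℝ)
      + 28 * ⟪cubicH F y, normalPart F (varH F b) y⟫_ℝ) 0 := by
  have h3 : HasDerivAt (fun t : ℝ => 7 * (‖jetH (jet F y + t • jet b y)‖ ^ 2) ^ 2)
      (28 * ⟪cubicH F y, normalPart F (varH F b) y⟫_ℝ) 0 := by
    have h := (((hF.hasDerivAt_jetH (b := b) hy).norm_sq).pow 2).const_mul 7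
    refine h.congr_deriv ?_
    rw [zero_smul, add_zero, ← hF.meanCurv_eq_jetH hy, cubicH, real_inner_smul_left, normalPart_eq,
      inner_of_normal_nproj (hF.meanCurv_normal hy)]
    push_cast
    ring
  exact ((hF.hasDerivAt_gradTerm hb hbn hy).sub (hF.hasDerivAt_HhTerm hb hbn hy)).add h3

lemma sffUp_symm (hy : y ∈ U) (i j : Fin 4) : sffUp F i j y = sffUp F j i y := by
  rw [sffUp, sffUp, Finset.sum_comm]
  refine Finset.sum_congr rfl fun k _ => Finset.sum_congr rfl fun l _ => ?_
  rw [hF.sff_symm hy, mul_comm]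

lemma HhH_symm (hy : y ∈ U) (i j : Fin 4) : HhH F i j y = HhH F j i y := by
  rw [HhH, HhH, hF.sffUp_symm hy]

/-- By symmetry of `h`, both divergences of the tensor `(H · h^{ij}) H` agree. -/
lemma sum_nablaUpUp_HhH (hy : y ∈ U) (j : Fin 4) :
    ∑ i, nablaUpUp F (HhH F) i i j y = divHhH F j y := by
  refine Finset.sum_congr rfl fun i _ => ?_
  simp only [nablaUpUp, hF.pd_congr (fun z hz => hF.HhH_symm hz i j) hy, hF.HhH_symm hy _ j,
    hF.HhH_symm hy _ i]
  abel

omit hF in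
lemma sum_inner_sffUp_mul (u v : Amb m) :
    ∑ i, ∑ j, ⟪u, sffUp F i j y⟫_ℝ * ⟪v, sff F i j y⟫_ℝ
      = ∑ i, ∑ j, ⟪u, sff F i j y⟫_ℝ * ⟪v, sffUp F i j y⟫_ℝ := by
  simp only [inner_sffUp, Finset.sum_mul, Finset.mul_sum]
  rw [sum_comm_pairs]
  refine Finset.sum_congr rfl fun i _ => Finset.sum_congr rfl fun j _ =>
    Finset.sum_congr rfl fun k _ => Finset.sum_congr rfl fun l _ => ?_
  rw [metricInv_symm k i, metricInv_symm l j]; ring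

/-- Pairing with the normal variation of the mean curvature. -/
lemma inner_normalPart_varH (hb : ContDiffOn ℝ ∞ b U)
    (hbn : ∀ z ∈ U, ∀ k, ⟪b z, pd k F z⟫_ℝ = 0) (hy : y ∈ U) (X : Amb m) :
    ⟪X, normalPart F (varH F b) y⟫_ℝ = 1 / 4 * (⟪X, lapPerp F b y⟫_ℝ
      + ∑ i, ∑ j, ⟪X, sff F i j y⟫_ℝ * ⟪b y, sffUp F i j y⟫_ℝ) := by
  rw [normalPart_eq, hF.nproj_varH hb hbn hy, real_inner_smul_right, inner_add_right]
  simp only [inner_sum, real_inner_smul_right]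
  congr 2
  exact Finset.sum_congr rfl fun i _ => Finset.sum_congr rfl fun j _ => mul_comm _ _

lemma cubicH_normal (hy : y ∈ U) (k : Fin 4) : ⟪cubicH F y, pd k F y⟫_ℝ = 0 := by
  rw [cubicH, real_inner_smul_left, hF.meanCurv_normal hy, mul_zero]

lemma hhH_normal (hy : y ∈ U) (k : Fin 4) : ⟪hhH F y, pd k F y⟫_ℝ = 0 := by
  simp [hhH, sum_inner, real_inner_smul_left, hF.sff_normal hy]

lemma sum_inner_pd {X : Fin 4 → Coord → Amb m} (hX : ∀ k, ContDiffOn ℝ ∞ (X k) U)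
    (hb : ContDiffOn ℝ ∞ b U) (hy : y ∈ U) :
    ∑ j, ⟪X j y, pd j b y⟫_ℝ
      = divUp F (fun j z => ⟪X j z, b z⟫_ℝ) y - ⟪divUp F X y, b y⟫_ℝ := by
  rw [hF.divUp_inner hX hb hy]; ring

/-- The flux field as the sum of the fields that arise in the integrations by parts. -/
lemma localFlux_eq (hb : ContDiffOn ℝ ∞ b U)
    (hbn : ∀ z ∈ U, ∀ k, ⟪b z, pd k F z⟫_ℝ = 0) (hy : y ∈ U) (j : Fin 4) :
    localFlux F b j y =
      2 * ⟪normalGrad F (meanCurv F) j y, normalPart F (varH F b) y⟫_ℝ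
      + (-2) * ⟪hGradH F j y, b y⟫_ℝ + 2 * ⟪HhGrad F j y, b y⟫_ℝ
      + (-1 / 2) * ⟪lapPerp F (meanCurv F) y, grad F b j y⟫_ℝ
      + 1 / 2 * ⟪normalGrad F (lapPerp F (meanCurv F)) j y, b y⟫_ℝ
      + (-1 / 2) * ⟪hhH F y, grad F b j y⟫_ℝ + 1 / 2 * ⟪normalGrad F (hhH F) j y, b y⟫_ℝ
      + (-2) * ∑ i, ⟪HhH F j i y, pd i b y⟫_ℝ + 2 * ⟪divHhH F j y, b y⟫_ℝ
      + 7 * ⟪cubicH F y, grad F b j y⟫_ℝ + (-7) * ⟪normalGrad F (cubicH F) j y, b y⟫_ℝ := by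
  have hNG : ∀ (X : Coord → Amb m) (v : Amb m) i, (∀ k, ⟪v, pd k F y⟫_ℝ = 0) →
      ⟪normalGrad F X i y, v⟫_ℝ = ⟪grad F X i y, v⟫_ℝ := fun X v i hv => by
    rw [normalGrad, normalPart_eq, inner_nproj_of_normal hv]
  have t1 : 2 * ⟪normalGrad F (meanCurv F) j y, normalPart F (varH F b) y⟫_ℝ
      = (1 / 2) * ∑ i, ∑ k, ⟪grad F (meanCurv F) j y, sffUp F i k y⟫_ℝ * ⟪b y, sff F i k y⟫_ℝ
        + (1 / 2) * ⟪grad F (meanCurv F) j y, lapPerp F b y⟫_ℝ := by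
    rw [hF.inner_normalPart_varH hb hbn hy, hNG _ _ _ (hF.lapPerp_normal b hy),
      sum_inner_sffUp_mul]
    simp only [hNG _ _ _ (hF.sff_normal hy _ _)]
    ring
  have t2 : ⟪hGradH F j y, b y⟫_ℝ
      = (∑ i, ⟪grad F (meanCurv F) i y, sffMixed F j i y⟫_ℝ) * ⟪meanCurv F y, b y⟫_ℝ := by
    simp only [hGradH, sum_inner, real_inner_smul_left, Finset.sum_mul]
    exact Finset.sum_congr rfl fun i _ => by rw [real_inner_comm (sffMixed F j i y)]
  have t3 : ⟪HhGrad F j y, b y⟫_ℝ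
      = ∑ i, ⟪grad F (meanCurv F) i y, b y⟫_ℝ * ⟪meanCurv F y, sffMixed F j i y⟫_ℝ := by
    simp only [HhGrad, sum_inner, real_inner_smul_left, hNG _ _ _ (hbn y hy)]
    exact Finset.sum_congr rfl fun i _ => mul_comm _ _
  have t4 : ∑ i, ⟪HhH F j i y, pd i b y⟫_ℝ
      = ∑ i, ⟪meanCurv F y, sffUp F i j y⟫_ℝ * ⟪meanCurv F y, pd i b y⟫_ℝ := by
    refine Finset.sum_congr rfl fun i _ => ?_
    rw [HhH, real_inner_smul_left, hF.sffUp_symm hy]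
  have t5 : ⟪normalPart F (fun z => ∑ i, nablaUpUp F (HhH F) i i j z) y, b y⟫_ℝ
      = ⟪divHhH F j y, b y⟫_ℝ := by
    rw [normalPart_eq, inner_nproj_of_normal (hbn y hy), hF.sum_nablaUpUp_HhH hy]
  have t6 : ⟪hhH F y, grad F b j y⟫_ℝ
      = ∑ i, ∑ k, ⟪meanCurv F y, sffUp F i k y⟫_ℝ * ⟪sff F i k y, grad F b j y⟫_ℝ := by
    simp only [hhH, sum_inner, real_inner_smul_left]
  have t7 : ⟪cubicH F y, grad F b j y⟫_ℝ = ‖meanCurv F y‖ ^ 2 * ⟪meanCurv F y, grad F b j y⟫_ℝ := by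
    rw [cubicH, real_inner_smul_left]
  rw [localFlux, t1, t2, t3, t4, ← t5, t6, t7, hNG _ _ _ (hbn y hy)]
  rw [← hNG (lapPerp F (meanCurv F)) _ _ (hbn y hy)]
  ring

omit hF in
/-- The `4`-Willmore operator paired with a normal field. -/
lemma inner_localWillmore (hbn : ∀ k, ⟪b y, pd k F y⟫_ℝ = 0) :
    ⟪b y, localWillmore F y⟫_ℝ =
      -(1 / 2) * ⟪lapPerp F (lapPerp F (meanCurv F)) y, b y⟫_ℝ
      - 1 / 2 * ∑ i, ∑ j, ⟪lapPerp F (meanCurv F) y, sff F i j y⟫_ℝ * ⟪b y, sffUp F i j y⟫_ℝ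
      - 4 * normSqNormalGradH F y * ⟪b y, meanCurv F y⟫_ℝ
      + 2 * ⟪divUp F (hGradH F) y, b y⟫_ℝ - 2 * ⟪divUp F (HhGrad F) y, b y⟫_ℝ
      + 2 * ∑ i, ∑ j, ⟪normalPd F i (meanCurv F) y, normalPd F j (meanCurv F) y⟫_ℝ *
          ⟪b y, sffUp F i j y⟫_ℝ
      - 1 / 2 * ⟪lapPerp F (hhH F) y, b y⟫_ℝ - 2 * ⟪divUp F (divHhH F) y, b y⟫_ℝ
      - 28 * ‖meanCurv F y‖ ^ 4 * ⟪b y, meanCurv F y⟫_ℝ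
      - 1 / 2 * ∑ i, ∑ j, ⟪hhH F y, sff F i j y⟫_ℝ * ⟪b y, sffUp F i j y⟫_ℝ
      - 4 * ∑ i, ∑ j, ∑ k, ⟪meanCurv F y, sff F i j y⟫_ℝ * ⟪meanCurv F y, sffMixed F i k y⟫_ℝ *
          ⟪b y, sffUp F j k y⟫_ℝ
      + 4 * normSqHh F y * ⟪b y, meanCurv F y⟫_ℝ
      + 7 * ⟪lapPerp F (cubicH F) y, b y⟫_ℝ
      + 7 * ∑ i, ∑ j, ⟪cubicH F y, sff F i j y⟫_ℝ * ⟪b y, sffUp F i j y⟫_ℝ := by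
  have hn : ∀ X : Coord → Amb m, ⟪b y, normalPart F X y⟫_ℝ = ⟪X y, b y⟫_ℝ := fun X => by
    rw [normalPart_eq, inner_of_normal_nproj hbn, real_inner_comm]
  have hq : ∑ i, ∑ j, ∑ p, ∑ q, (⟪meanCurv F y, sffUp F i j y⟫_ℝ *
        ⟪sff F i j y, sff F p q y⟫_ℝ) * ⟪b y, sffUp F p q y⟫_ℝ
      = ∑ i, ∑ j, ⟪hhH F y, sff F i j y⟫_ℝ * ⟪b y, sffUp F i j y⟫_ℝ := by
    simp only [hhH, sum_inner, real_inner_smul_left, Finset.sum_mul]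
    exact sum_comm_pairs _
  have hc : ∑ i, ∑ j, ⟪cubicH F y, sff F i j y⟫_ℝ * ⟪b y, sffUp F i j y⟫_ℝ
      = ‖meanCurv F y‖ ^ 2 * ∑ i, ∑ j, ⟪meanCurv F y, sff F i j y⟫_ℝ * ⟪b y, sffUp F i j y⟫_ℝ := by
    simp only [cubicH, real_inner_smul_left, Finset.mul_sum, mul_assoc]
  have hl : ∑ i, ∑ k, ⟪sff F i k y, lapPerp F (meanCurv F) y⟫_ℝ * ⟪b y, sffUp F i k y⟫_ℝ
      = ∑ i, ∑ j, ⟪lapPerp F (meanCurv F) y, sff F i j y⟫_ℝ * ⟪b y, sffUp F i j y⟫_ℝ :=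
    Finset.sum_congr rfl fun i _ => Finset.sum_congr rfl fun j _ => by
      rw [real_inner_comm]
  rw [localWillmore]
  simp only [inner_add_right, inner_sub_right, real_inner_smul_right, inner_sum, hn]
  rw [hq, hc, hl, real_inner_comm (b y) (lapPerp F (lapPerp F (meanCurv F)) y),
    real_inner_comm (b y) (lapPerp F (hhH F) y), real_inner_comm (b y) (lapPerp F (cubicH F) y)]
  change _ * _ - _ - _ + 2 * ⟪divUp F (hGradH F) y, b y⟫_ℝ - 2 * ⟪divUp F (HhGrad F) y, b y⟫_ℝ
    + _ - _ - 2 * ⟪divUp F (divHhH F) y, b y⟫_ℝ - _ - _ - _ + _ + _ + _ = _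
  ring

/-- The first variation formula in a chart, in pointwise form. -/
theorem hasDerivAt_jetEnergy (hb : ContDiffOn ℝ ∞ b U)
    (hbn : ∀ z ∈ U, ∀ k, ⟪b z, pd k F z⟫_ℝ = 0) (hy : y ∈ U) :
    HasDerivAt (fun t : ℝ => jetEnergy (jet' F y + t • jet' b y))
      (volDensity F y * (⟪b y, localWillmore F y⟫_ℝ + divUp F (localFlux F b) y)) 0 := by
  have h := (hF.hasDerivAt_jetDensity hb hbn hy).mul (hF.hasDerivAt_vol hb hbn hy)
  refine h.congr_deriv ?_
  have e0 : jetDensity (jet' F y + (0 : ℝ) • jet' b y) = localDensity F y := by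
    rw [zero_smul, add_zero, hF.localDensity_eq hy]
  have e1 : Real.sqrt (gram (jet F y + (0 : ℝ) • jet b y).1).det = volDensity F y := by
    rw [zero_smul, add_zero]; rfl
  rw [e0, e1]
  set N := normalPart F (varH F b) with hN
  have hNs : ContDiffOn ℝ ∞ N U := hF.normalPart_smooth (hF.varH_smooth hb)
  have hH := hF.meanCurv_smooth
  have hL := hF.lapPerp_smooth hH
  have sZ := fun j => hF.normalGrad_smooth hH j
  have s1 := fun j => (sZ j).inner ℝ hNs
  have s2 := fun j => (hF.hGradH_smooth j).inner ℝ hb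
  have s3 := fun j => (hF.HhGrad_smooth j).inner ℝ hb
  have s4 := fun j => hL.inner ℝ (hF.grad_smooth hb j)
  have s5 := fun j => (hF.normalGrad_smooth hL j).inner ℝ hb
  have s6 := fun j => hF.hhH_smooth.inner ℝ (hF.grad_smooth hb j)
  have s7 := fun j => (hF.normalGrad_smooth hF.hhH_smooth j).inner ℝ hb
  have s8 : ∀ j, ContDiffOn ℝ ∞ (fun z => ∑ i, ⟪HhH F j i z, pd i b z⟫_ℝ) U := fun j =>
    ContDiffOn.sum fun i _ => (hF.HhH_smooth j i).inner ℝ (hF.pd_smooth hb i)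
  have s9 := fun j => (hF.divHhH_smooth j).inner ℝ hb
  have s10 := fun j => hF.cubicH_smooth.inner ℝ (hF.grad_smooth hb j)
  have s11 := fun j => (hF.normalGrad_smooth hF.cubicH_smooth j).inner ℝ hb
  have c : ∀ (a : ℝ) {f : Coord → ℝ}, ContDiffOn ℝ ∞ f U → ContDiffOn ℝ ∞ (fun z => a * f z) U :=
    fun a _ h => contDiffOn_const.mul h
  have hdiv : divUp F (localFlux F b) y =
      2 * divUp F (fun j z => ⟪normalGrad F (meanCurv F) j z, N z⟫_ℝ) y
      + (-2) * divUp F (fun j z => ⟪hGradH F j z, b z⟫_ℝ) y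
      + 2 * divUp F (fun j z => ⟪HhGrad F j z, b z⟫_ℝ) y
      + (-1 / 2) * divUp F (fun j z => ⟪lapPerp F (meanCurv F) z, grad F b j z⟫_ℝ) y
      + 1 / 2 * divUp F (fun j z => ⟪normalGrad F (lapPerp F (meanCurv F)) j z, b z⟫_ℝ) y
      + (-1 / 2) * divUp F (fun j z => ⟪hhH F z, grad F b j z⟫_ℝ) y
      + 1 / 2 * divUp F (fun j z => ⟪normalGrad F (hhH F) j z, b z⟫_ℝ) y
      + (-2) * divUp F (fun j z => ∑ i, ⟪HhH F j i z, pd i b z⟫_ℝ) y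
      + 2 * divUp F (fun j z => ⟪divHhH F j z, b z⟫_ℝ) y
      + 7 * divUp F (fun j z => ⟪cubicH F z, grad F b j z⟫_ℝ) y
      + (-7) * divUp F (fun j z => ⟪normalGrad F (cubicH F) j z, b z⟫_ℝ) y := by
    rw [hF.divUp_congr (fun j z hz => hF.localFlux_eq hb hbn hz j) hy]
    have a1 := fun j => c 2 (s1 j)
    have a2 := fun j => (a1 j).add (c (-2) (s2 j))
    have a3 := fun j => (a2 j).add (c 2 (s3 j))
    have a4 := fun j => (a3 j).add (c (-1 / 2) (s4 j))
    have a5 := fun j => (a4 j).add (c (1 / 2) (s5 j))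
    have a6 := fun j => (a5 j).add (c (-1 / 2) (s6 j))
    have a7 := fun j => (a6 j).add (c (1 / 2) (s7 j))
    have a8 := fun j => (a7 j).add (c (-2) (s8 j))
    have a9 := fun j => (a8 j).add (c 2 (s9 j))
    have a10 := fun j => (a9 j).add (c 7 (s10 j))
    refine (hF.divUp_add a10 (fun j => c (-7) (s11 j)) hy).trans (congrArg₂ _ ?_
      (hF.divUp_const_mul s11 _ hy))
    refine (hF.divUp_add a9 (fun j => c 7 (s10 j)) hy).trans (congrArg₂ _ ?_
      (hF.divUp_const_mul s10 _ hy))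
    refine (hF.divUp_add a8 (fun j => c 2 (s9 j)) hy).trans (congrArg₂ _ ?_
      (hF.divUp_const_mul s9 _ hy))
    refine (hF.divUp_add a7 (fun j => c (-2) (s8 j)) hy).trans (congrArg₂ _ ?_
      (hF.divUp_const_mul s8 _ hy))
    refine (hF.divUp_add a6 (fun j => c (1 / 2) (s7 j)) hy).trans (congrArg₂ _ ?_
      (hF.divUp_const_mul s7 _ hy))
    refine (hF.divUp_add a5 (fun j => c (-1 / 2) (s6 j)) hy).trans (congrArg₂ _ ?_
      (hF.divUp_const_mul s6 _ hy))
    refine (hF.divUp_add a4 (fun j => c (1 / 2) (s5 j)) hy).trans (congrArg₂ _ ?_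
      (hF.divUp_const_mul s5 _ hy))
    refine (hF.divUp_add a3 (fun j => c (-1 / 2) (s4 j)) hy).trans (congrArg₂ _ ?_
      (hF.divUp_const_mul s4 _ hy))
    refine (hF.divUp_add a2 (fun j => c 2 (s3 j)) hy).trans (congrArg₂ _ ?_
      (hF.divUp_const_mul s3 _ hy))
    exact (hF.divUp_add a1 (fun j => c (-2) (s2 j)) hy).trans (congrArg₂ _
      (hF.divUp_const_mul s1 _ hy) (hF.divUp_const_mul s2 _ hy))
  -- the integrations by parts
  have p1 := hF.divUp_inner sZ hNs hy
  have p2 := hF.sum_inner_pd hF.hGradH_smooth hb hy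
  have p3 := hF.sum_inner_pd hF.HhGrad_smooth hb hy
  have p4 := hF.inner_lapPerp hL hb (fun z hz => hF.lapPerp_normal _ hz) hbn hy
  have p5 := hF.inner_lapPerp hF.hhH_smooth hb (fun z hz => hF.hhH_normal hz) hbn hy
  have p6 := hF.inner_lapPerp hF.cubicH_smooth hb (fun z hz => hF.cubicH_normal hz) hbn hy
  have p7 := hF.sum_inner_hessian hF.HhH_smooth hb hy
  have p8 := hF.sum_inner_pd hF.divHhH_smooth hb hy
  simp only [hF.sum_nablaUpUp_HhH hy] at p7
  -- the pairings with the variation of the mean curvature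
  have q1 : ⟪divUp F (normalGrad F (meanCurv F)) y, N y⟫_ℝ
      = ⟪lapPerp F (meanCurv F) y, N y⟫_ℝ := by
    rw [hF.lapPerp_eq hH hy, inner_nproj_of_normal]
    exact fun k => hF.inner_nproj_frame hy _ k
  have q2 := hF.inner_normalPart_varH hb hbn hy (lapPerp F (meanCurv F) y)
  have q3 := hF.inner_normalPart_varH hb hbn hy (hhH F y)
  have q4 := hF.inner_normalPart_varH hb hbn hy (cubicH F y)
  rw [← hN] at q2 q3 q4
  rw [hdiv, inner_localWillmore (hbn y hy), localDensity, p2, p3, p7, p8, q3, q4, p5, p6]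
  rw [q1, q2, p4] at p1
  linear_combination (-2 * volDensity F y) * p1

end Imm
end

/-! ### Tensor calculus at a point under a change of frame -/

section Tensor

variable {V W W' : Type*} [AddCommGroup V] [Module ℝ V] [AddCommGroup W] [Module ℝ W]
  [AddCommGroup W'] [Module ℝ W'] {J : Matrix (Fin 4) (Fin 4) ℝ}

/-- Components with one lower index transform by `J`. -/
def Lo1 (J : Matrix (Fin 4) (Fin 4) ℝ) (t' t : Fin 4 → W) : Prop :=
  ∀ j, t' j = ∑ b, J b j • t b

/-- Components with one upper index transform by the inverse of `J`. -/
def Up1 (J : Matrix (Fin 4) (Fin 4) ℝ) (s' s : Fin 4 → W) : Prop :=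
  ∀ a, ∑ i, J a i • s' i = s a

/-- Components with two lower indices. -/
def Lo2 (J : Matrix (Fin 4) (Fin 4) ℝ) (t' t : Fin 4 → Fin 4 → W) : Prop :=
  ∀ i j, t' i j = ∑ a, ∑ b, (J a i * J b j) • t a b

/-- Components with two upper indices. -/
def Up2 (J : Matrix (Fin 4) (Fin 4) ℝ) (s' s : Fin 4 → Fin 4 → W) : Prop :=
  ∀ a b, ∑ i, ∑ j, (J a i * J b j) • s' i j = s a b

/-- Components with a first upper and a second lower index. -/
def Mix (J : Matrix (Fin 4) (Fin 4) ℝ) (s' s : Fin 4 → Fin 4 → W) : Prop :=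
  ∀ a, Lo1 J (fun j => ∑ i, J a i • s' i j) (s a)

lemma Lo1.map {t' t : Fin 4 → W} (h : Lo1 J t' t) (L : W →ₗ[ℝ] W') :
    Lo1 J (fun j => L (t' j)) (fun b => L (t b)) := fun j => by
  simp only [h j, map_sum, map_smul]

lemma Up1.map {t' t : Fin 4 → W} (h : Up1 J t' t) (L : W →ₗ[ℝ] W') :
    Up1 J (fun j => L (t' j)) (fun b => L (t b)) := fun j => by
  simp only [← h j, map_sum, map_smul]

lemma Lo2.map {t' t : Fin 4 → Fin 4 → W} (h : Lo2 J t' t) (L : W →ₗ[ℝ] W') :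
    Lo2 J (fun i j => L (t' i j)) (fun a b => L (t a b)) := fun i j => by
  simp only [h i j, map_sum, map_smul]

lemma Up2.map {t' t : Fin 4 → Fin 4 → W} (h : Up2 J t' t) (L : W →ₗ[ℝ] W') :
    Up2 J (fun i j => L (t' i j)) (fun a b => L (t a b)) := fun i j => by
  simp only [← h i j, map_sum, map_smul]

lemma contract_lo_up {t' t : Fin 4 → V} {s' s : Fin 4 → W} (ht : Lo1 J t' t) (hs : Up1 J s' s)
    (B : V →ₗ[ℝ] W →ₗ[ℝ] W') : ∑ i, B (t' i) (s' i) = ∑ a, B (t a) (s a) := by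
  have h1 : ∀ i, B (t' i) (s' i) = ∑ a, J a i • B (t a) (s' i) := fun i => by
    rw [ht i]; simp
  have h2 : ∀ a, B (t a) (s a) = ∑ i, J a i • B (t a) (s' i) := fun a => by
    rw [← hs a]; simp
  simp only [h1, h2]
  exact Finset.sum_comm

lemma contract_lo2_up2 {t' t : Fin 4 → Fin 4 → V} {s' s : Fin 4 → Fin 4 → W} (ht : Lo2 J t' t)
    (hs : Up2 J s' s) (B : V →ₗ[ℝ] W →ₗ[ℝ] W') :
    ∑ i, ∑ j, B (t' i j) (s' i j) = ∑ a, ∑ b, B (t a b) (s a b) := by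
  have h1 : ∀ i j, B (t' i j) (s' i j) = ∑ a, ∑ b, (J a i * J b j) • B (t a b) (s' i j) :=
    fun i j => by rw [ht i j]; simp
  have h2 : ∀ a b, B (t a b) (s a b) = ∑ i, ∑ j, (J a i * J b j) • B (t a b) (s' i j) :=
    fun a b => by rw [← hs a b]; simp
  simp only [h1, h2]
  exact sum_comm_pairs _

/-- A trace is invariant under conjugation. -/
lemma contract_mix (hJ : J.det ≠ 0) {s' s : Fin 4 → Fin 4 → W} (h : Mix J s' s) :
    ∑ i, s' i i = ∑ a, s a a := by
  have hK : J⁻¹ * J = 1 := Matrix.nonsing_inv_mul _ hJ.isUnit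
  have hK' : J * J⁻¹ = 1 := Matrix.mul_nonsing_inv _ hJ.isUnit
  have h1 : ∀ l j, s' l j = ∑ a, ∑ c, (J⁻¹ l a * J c j) • s a c := by
    intro l j
    have e1 : ∑ a, J⁻¹ l a • ∑ i, J a i • s' i j = s' l j := by
      simp only [Finset.smul_sum, smul_smul]
      rw [Finset.sum_comm]
      simp only [← Finset.sum_smul, ← Matrix.mul_apply, hK, Matrix.one_apply, ite_smul, one_smul,
        zero_smul]
      simp
    rw [← e1]
    refine Finset.sum_congr rfl fun a _ => ?_
    have := h a j
    simp only at this
    rw [this, Finset.smul_sum]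
    simp only [smul_smul]
  simp only [h1]
  rw [Finset.sum_comm]
  refine Finset.sum_congr rfl fun a _ => ?_
  rw [Finset.sum_comm]
  simp only [← Finset.sum_smul]
  have h2 : ∀ c, ∑ i, J⁻¹ i a * J c i = (1 : Matrix _ _ ℝ) c a := fun c => by
    rw [← hK', Matrix.mul_apply]
    exact Finset.sum_congr rfl fun i _ => mul_comm _ _
  simp [h2, Matrix.one_apply]

/-- Raising an index. -/
lemma Lo1.raise {t' t : Fin 4 → W} (ht : Lo1 J t' t) {G' G : Fin 4 → Fin 4 → ℝ} (hG : Up2 J G' G) :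
    Up1 J (fun i => ∑ j, G' i j • t' j) (fun a => ∑ b, G a b • t b) := fun a => by
  have hs : Up1 J (fun j => ∑ i, J a i • G' i j) (G a) := fun b => by
    rw [← hG a b]
    simp only [smul_eq_mul, Finset.mul_sum]
    rw [Finset.sum_comm]
    exact Finset.sum_congr rfl fun i _ => Finset.sum_congr rfl fun j _ => by ring
  have := contract_lo_up ht hs (LinearMap.lsmul ℝ W).flip
  simp only [LinearMap.flip_apply, LinearMap.lsmul_apply] at this
  refine Eq.trans ?_ this
  simp only [Finset.smul_sum, Finset.sum_smul, smul_smul, smul_eq_mul]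
  exact Finset.sum_comm

/-- Raising the first index. -/
lemma Lo2.raise {t' t : Fin 4 → Fin 4 → W} (ht : Lo2 J t' t) {G' G : Fin 4 → Fin 4 → ℝ}
    (hG : Up2 J G' G) :
    Mix J (fun i j => ∑ k, G' i k • t' k j) (fun a b => ∑ c, G a c • t c b) := fun a j => by
  have h1 : Lo1 J (fun k => t' k j) (fun c => ∑ b, J b j • t c b) := fun k => by
    simp only [ht k j, Finset.smul_sum, smul_smul]
  refine (h1.raise hG a).trans ?_
  simp only [Finset.smul_sum, smul_smul]
  rw [Finset.sum_comm]
  exact Finset.sum_congr rfl fun i _ => Finset.sum_congr rfl fun j _ => by rw [mul_comm]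

/-- Raising both indices. -/
lemma Lo2.raise2 {t' t : Fin 4 → Fin 4 → W} (ht : Lo2 J t' t) {G' G : Fin 4 → Fin 4 → ℝ}
    (hG : Up2 J G' G) :
    Up2 J (fun i j => ∑ k, ∑ l, (G' i k * G' j l) • t' k l)
      (fun a b => ∑ c, ∑ d, (G a c * G b d) • t c d) := fun a b => by
  have h2 := Lo1.raise (ht.raise hG a) hG b
  have e1 : ∀ i j, ∑ k, ∑ l, (G' i k * G' j l) • t' k l
      = ∑ l, G' j l • ∑ k, G' i k • t' k l := fun i j => by
    simp only [Finset.smul_sum, smul_smul]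
    rw [Finset.sum_comm]
    exact Finset.sum_congr rfl fun i _ => Finset.sum_congr rfl fun j _ => by rw [mul_comm]
  have e2 : ∑ c, ∑ d, (G a c * G b d) • t c d = ∑ d, G b d • ∑ c, G a c • t c d := by
    simp only [Finset.smul_sum, smul_smul]
    rw [Finset.sum_comm]
    exact Finset.sum_congr rfl fun i _ => Finset.sum_congr rfl fun j _ => by rw [mul_comm]
  refine Eq.trans ?_ (h2.trans e2.symm)
  rw [Finset.sum_comm]
  refine Finset.sum_congr rfl fun j _ => ?_
  simp only [e1, Finset.smul_sum, smul_smul]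
  rw [Finset.sum_comm]
  refine Finset.sum_congr rfl fun l _ => Finset.sum_congr rfl fun i _ =>
    Finset.sum_congr rfl fun k _ => ?_
  congr 1
  ring

end Tensor

/-! ### Invariance under changes of coordinates -/

section

variable {m : ℕ}

/-- The Jacobian matrix of a change of coordinates. -/
def jac (ψ : Coord → Coord) (y : Coord) : Matrix (Fin 4) (Fin 4) ℝ :=
  Matrix.of fun a i => (pd i ψ y) a

/-- `ψ` is a change of coordinates from `U'` into `U` under which `F` reads `F'`. -/
structure Transition (F' F : Coord → Amb m) (ψ : Coord → Coord) (U' U : Set Coord) : Prop where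
  relOpen : RelOpen U'
  imm : Imm F U
  smooth : ContDiffOn ℝ ∞ ψ U'
  mapsTo : Set.MapsTo ψ U' U
  eq : ∀ y ∈ U', F' y = F (ψ y)
  det_ne : ∀ y ∈ U', (jac ψ y).det ≠ 0

namespace Transition

variable {F' F : Coord → Amb m} {ψ : Coord → Coord} {U' U : Set Coord} {y : Coord} {W : Type*}
  [NormedAddCommGroup W] [NormedSpace ℝ W] (T : Transition F' F ψ U' U)
include T

lemma jac_smooth (a i : Fin 4) : ContDiffOn ℝ ∞ (fun z => jac ψ z a i) U' := by
  have h := T.relOpen.pd_smooth T.smooth i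
  exact (EuclideanSpace.proj (𝕜 := ℝ) a).contDiff.comp_contDiffOn h

lemma pd_comp {f : Coord → W} (hf : ContDiffOn ℝ ∞ f U) (hy : y ∈ U') (i : Fin 4) :
    pd i (fun z => f (ψ z)) y = ∑ a, jac ψ y a i • pd a f (ψ y) := by
  have hy' := T.mapsTo hy
  have h1 : HasFDerivWithinAt f (fderivWithin ℝ f halfSpace (ψ y)) U (ψ y) :=
    (T.imm.hasFDerivWithinAt hf hy').mono T.imm.subset
  have h2 : HasFDerivWithinAt ψ (fderivWithin ℝ ψ halfSpace y) U' y :=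
    (T.relOpen.hasFDerivWithinAt T.smooth hy).mono T.relOpen.subset
  have h3 := (h1.comp y h2 T.mapsTo).fderivWithin (T.relOpen.uniqueDiffOn y hy)
  rw [T.relOpen.pd_eq hy]
  refine (congrArg (fun L => L (EuclideanSpace.single i 1)) h3).trans ?_
  change fderivWithin ℝ f halfSpace (ψ y) (pd i ψ y) = _
  conv_lhs => rw [← (EuclideanSpace.basisFun (Fin 4) ℝ).sum_repr (pd i ψ y)]
  simp only [map_sum, map_smul, EuclideanSpace.basisFun_repr, EuclideanSpace.basisFun_apply]
  rfl

lemma pd_eq {f' f : Coord → W} (hf : ContDiffOn ℝ ∞ f U) (h : ∀ z ∈ U', f' z = f (ψ z))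
    (hy : y ∈ U') : Lo1 (jac ψ y) (fun i => pd i f' y) (fun a => pd a f (ψ y)) := fun i => by
  simp only [T.relOpen.pd_congr h hy]
  exact T.pd_comp hf hy i

lemma frame (hy : y ∈ U') : Lo1 (jac ψ y) (fun i => pd i F' y) (fun a => pd a F (ψ y)) :=
  T.pd_eq T.imm.smooth T.eq hy

lemma metric_eq (hy : y ∈ U') :
    metric F' y = (jac ψ y).transpose * metric F (ψ y) * jac ψ y := by
  ext i j
  simp only [metric_apply, T.frame hy i, T.frame hy j, Matrix.mul_apply, Matrix.transpose_apply,
    sum_inner, inner_sum, real_inner_smul_left, real_inner_smul_right, Finset.sum_mul]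
  exact Finset.sum_congr rfl fun a _ => Finset.sum_congr rfl fun b _ => by ring

lemma det_metric (hy : y ∈ U') :
    (metric F' y).det = (jac ψ y).det ^ 2 * (metric F (ψ y)).det := by
  rw [T.metric_eq hy, Matrix.det_mul, Matrix.det_mul, Matrix.det_transpose]; ring

lemma imm' : Imm F' U' where
  toRelOpen := T.relOpen
  smooth := (T.imm.smooth.comp T.smooth T.mapsTo).congr T.eq
  det_pos y hy := by
    rw [T.det_metric hy]
    have := T.det_ne y hy
    have := T.imm.det_pos _ (T.mapsTo hy)
    positivity

lemma volDensity_eq (hy : y ∈ U') :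
    volDensity F' y = |(jac ψ y).det| * volDensity F (ψ y) := by
  rw [volDensity, T.det_metric hy, Real.sqrt_mul (sq_nonneg _), Real.sqrt_sq_eq_abs]; rfl

lemma metricInv_matrix (hy : y ∈ U') :
    jac ψ y * metricInv F' y * (jac ψ y).transpose = metricInv F (ψ y) := by
  have hJ := (T.det_ne y hy).isUnit
  have hJ' : IsUnit (jac ψ y).transpose.det := by rwa [Matrix.det_transpose]
  rw [metricInv, T.metric_eq hy, Matrix.mul_inv_rev, Matrix.mul_inv_rev, ← Matrix.mul_assoc,
    Matrix.mul_nonsing_inv _ hJ, Matrix.one_mul, Matrix.mul_assoc, Matrix.nonsing_inv_mul _ hJ',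
    Matrix.mul_one]
  rfl

lemma metricInv_eq (hy : y ∈ U') : Up2 (jac ψ y) (metricInv F' y) (metricInv F (ψ y)) :=
  fun a b => by
  rw [← T.metricInv_matrix hy, Matrix.mul_apply]
  simp only [Matrix.mul_apply, Matrix.transpose_apply, Finset.sum_mul, smul_eq_mul]
  rw [Finset.sum_comm]
  exact Finset.sum_congr rfl fun a _ => Finset.sum_congr rfl fun b _ => by ring

lemma nproj_eq (hy : y ∈ U') (v : Amb m) : nproj F' y v = nproj F (ψ y) v := by
  rw [nproj_apply, nproj_apply]
  congr 1
  have h1 : Lo1 (jac ψ y) (fun i => ⟪v, pd i F' y⟫_ℝ) (fun a => ⟪v, pd a F (ψ y)⟫_ℝ) :=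
    (T.frame hy).map (innerₗ (Amb m) v)
  have h2 := contract_lo_up h1 ((T.frame hy).raise (T.metricInv_eq hy)) (LinearMap.lsmul ℝ _)
  simpa only [LinearMap.lsmul_apply, Finset.smul_sum, smul_smul, mul_comm] using h2

lemma pd_pd (hy : y ∈ U') (i j : Fin 4) : pd i (pd j F') y
    = ∑ a, pd i (fun z => jac ψ z a j) y • pd a F (ψ y)
      + ∑ a, ∑ b, (jac ψ y a i * jac ψ y b j) • pd a (pd b F) (ψ y) := by
  have hs : ∀ b, ContDiffOn ℝ ∞ (fun z => pd b F (ψ z)) U' := fun b =>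
    (T.imm.pd_frame_smooth b).comp T.smooth T.mapsTo
  rw [T.relOpen.pd_congr (fun z hz => T.frame hz j) hy,
    T.relOpen.pd_sum (f := fun b z => jac ψ z b j • pd b F (ψ z)) _
      (fun b _ => (T.jac_smooth b j).smul (hs b)) hy]
  have h : ∀ b, pd i (fun z => jac ψ z b j • pd b F (ψ z)) y
      = pd i (fun z => jac ψ z b j) y • pd b F (ψ y)
        + ∑ a, (jac ψ y a i * jac ψ y b j) • pd a (pd b F) (ψ y) := fun b => by
    rw [T.relOpen.pd_smul (T.jac_smooth b j) (hs b) hy, T.pd_comp (T.imm.pd_frame_smooth b) hy,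
      Finset.smul_sum]
    simp only [smul_smul, mul_comm]
  simp only [h, Finset.sum_add_distrib]
  congr 1
  exact Finset.sum_comm

lemma sff_eq (hy : y ∈ U') :
    Lo2 (jac ψ y) (fun i j => sff F' i j y) (fun a b => sff F a b (ψ y)) := fun i j => by
  simp only [T.imm'.sff_eq hy, T.imm.sff_eq (T.mapsTo hy), T.nproj_eq hy, T.pd_pd hy, map_add,
    map_sum, map_smul, T.imm.nproj_frame (T.mapsTo hy), smul_zero, Finset.sum_const_zero, zero_add]

omit T in
/-- The frame of an immersion is linearly independent. -/
lemma _root_.FourWillmore.Imm.frame_indep (hF : Imm F U) (hy : y ∈ U) {c d : Fin 4 → ℝ}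
    (h : ∑ k, c k • pd k F y = ∑ k, d k • pd k F y) : c = d := by
  have h1 : ∀ j, ∑ k, (c k - d k) * metric F y k j = 0 := fun j => by
    have := congrArg (fun v => ⟪v, pd j F y⟫_ℝ) h
    simp only [sum_inner, real_inner_smul_left] at this
    simp only [sub_mul, Finset.sum_sub_distrib, metric_apply, this, sub_self]
  funext l
  have h2 : ∑ j, (∑ k, (c k - d k) * metric F y k j) * metricInv F y j l = 0 := by simp [h1]
  simp only [Finset.sum_mul] at h2
  rw [Finset.sum_comm] at h2
  simp only [mul_assoc, ← Finset.mul_sum, hF.metric_mul_inv hy] at h2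
  simp at h2
  linarith

/-- The transformation law of the Christoffel symbols. -/
lemma christoffel_eq (hy : y ∈ U') (i j c : Fin 4) :
    pd i (fun z => jac ψ z c j) y = ∑ k, christoffel F' k i j y * jac ψ y c k
      - ∑ a, ∑ b, jac ψ y a i * jac ψ y b j * christoffel F c a b (ψ y) := by
  have h1 := T.imm'.sum_christoffel_frame hy i j
  have h2 := T.imm.sum_christoffel_frame (T.mapsTo hy)
  have h3 : ∑ c, (∑ k, christoffel F' k i j y * jac ψ y c k) • pd c F (ψ y)
      = ∑ c, (pd i (fun z => jac ψ z c j) y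
        + ∑ a, ∑ b, jac ψ y a i * jac ψ y b j * christoffel F c a b (ψ y)) • pd c F (ψ y) := by
    have e1 : ∑ c, (∑ k, christoffel F' k i j y * jac ψ y c k) • pd c F (ψ y)
        = ∑ k, christoffel F' k i j y • pd k F' y := by
      simp only [T.frame hy _, Finset.sum_smul, Finset.smul_sum, smul_smul]
      exact Finset.sum_comm
    have e2 : ∑ c, (∑ a, ∑ b, jac ψ y a i * jac ψ y b j * christoffel F c a b (ψ y)) •
        pd c F (ψ y) = ∑ a, ∑ b, (jac ψ y a i * jac ψ y b j) •
          ∑ c, christoffel F c a b (ψ y) • pd c F (ψ y) := by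
      simp only [Finset.sum_smul, Finset.smul_sum, smul_smul]
      rw [Finset.sum_comm]
      exact Finset.sum_congr rfl fun a _ => Finset.sum_comm
    simp only [add_smul, Finset.sum_add_distrib]
    rw [e1, e2, h1, T.nproj_eq hy, T.pd_pd hy]
    simp only [h2, map_add, map_sum, map_smul, T.imm.nproj_frame (T.mapsTo hy), smul_zero,
      Finset.sum_const_zero, zero_add, smul_sub, Finset.sum_sub_distrib]
    abel
  have := congrFun (T.imm.frame_indep (T.mapsTo hy) h3) c
  linarith

lemma nablaLow_eq {t' t : Fin 4 → Coord → W} (ht : ∀ k, ContDiffOn ℝ ∞ (t k) U)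
    (h : ∀ z ∈ U', Lo1 (jac ψ z) (fun i => t' i z) (fun a => t a (ψ z))) (hy : y ∈ U') :
    Lo2 (jac ψ y) (fun i j => nablaLow F' t' i j y) (fun a b => nablaLow F t a b (ψ y)) :=
  fun i j => by
  have hs : ∀ b, ContDiffOn ℝ ∞ (fun z => t b (ψ z)) U' := fun b =>
    (ht b).comp T.smooth T.mapsTo
  have h1 : pd i (t' j) y = ∑ c, pd i (fun z => jac ψ z c j) y • t c (ψ y)
      + ∑ a, ∑ b, (jac ψ y a i * jac ψ y b j) • pd a (t b) (ψ y) := by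
    rw [T.relOpen.pd_congr (fun z hz => h z hz j) hy,
      T.relOpen.pd_sum (f := fun b z => jac ψ z b j • t b (ψ z)) _
        (fun b _ => (T.jac_smooth b j).smul (hs b)) hy, Finset.sum_comm (γ := Fin 4),
        ← Finset.sum_add_distrib]
    refine Finset.sum_congr rfl fun b _ => ?_
    rw [T.relOpen.pd_smul (T.jac_smooth b j) (hs b) hy, T.pd_comp (ht b) hy, Finset.smul_sum]
    simp only [smul_smul, mul_comm]
  have h2 : ∑ c, (∑ k, christoffel F' k i j y * jac ψ y c k) • t c (ψ y)
      = ∑ k, christoffel F' k i j y • t' k y := by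
    simp only [h y hy _, Finset.sum_smul, Finset.smul_sum, smul_smul]
    exact Finset.sum_comm
  have h3 : ∑ c, (∑ a, ∑ b, jac ψ y a i * jac ψ y b j * christoffel F c a b (ψ y)) • t c (ψ y)
      = ∑ a, ∑ b, (jac ψ y a i * jac ψ y b j) • ∑ c, christoffel F c a b (ψ y) • t c (ψ y) := by
    simp only [Finset.sum_smul, Finset.smul_sum, smul_smul]
    rw [Finset.sum_comm]
    exact Finset.sum_congr rfl fun a _ => Finset.sum_comm
  simp only [nablaLow, h1, T.christoffel_eq hy, sub_smul, Finset.sum_sub_distrib, h2, h3, smul_sub]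
  abel

lemma nablaUp_eq {t' t : Fin 4 → Coord → W} (ht' : ∀ k, ContDiffOn ℝ ∞ (t' k) U')
    (ht : ∀ k, ContDiffOn ℝ ∞ (t k) U)
    (h : ∀ z ∈ U', Up1 (jac ψ z) (fun i => t' i z) (fun a => t a (ψ z))) (hy : y ∈ U')
    (i c : Fin 4) : ∑ j, jac ψ y c j • nablaUp F' t' i j y
      = ∑ a, jac ψ y a i • nablaUp F t a c (ψ y) := by
  have h1 := T.pd_eq (f' := fun z => ∑ j, jac ψ z c j • t' j z) (ht c) (fun z hz => h z hz c) hy i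
  simp only at h1
  rw [T.relOpen.pd_sum (f := fun j z => jac ψ z c j • t' j z) _
    (fun j _ => (T.jac_smooth c j).smul (ht' j)) hy] at h1
  have h2 : ∀ j, pd i (fun z => jac ψ z c j • t' j z) y
      = (∑ k, christoffel F' k i j y * jac ψ y c k) • t' j y
        - (∑ a, ∑ b, jac ψ y a i * jac ψ y b j * christoffel F c a b (ψ y)) • t' j y
        + jac ψ y c j • pd i (t' j) y := fun j => by
    rw [T.relOpen.pd_smul (T.jac_smooth c j) (ht' j) hy, T.christoffel_eq hy, sub_smul]
  simp only [h2, Finset.sum_add_distrib, Finset.sum_sub_distrib] at h1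
  have h3 : ∑ j, (∑ k, christoffel F' k i j y * jac ψ y c k) • t' j y
      = ∑ k, jac ψ y c k • ∑ j, christoffel F' k i j y • t' j y := by
    simp only [Finset.sum_smul, Finset.smul_sum, smul_smul]
    rw [Finset.sum_comm]
    exact Finset.sum_congr rfl fun a _ => Finset.sum_congr rfl fun b _ => by rw [mul_comm]
  have h4 : ∑ j, (∑ a, ∑ b, jac ψ y a i * jac ψ y b j * christoffel F c a b (ψ y)) • t' j y
      = ∑ a, jac ψ y a i • ∑ b, christoffel F c a b (ψ y) • t b (ψ y) := by
    have e : ∀ b, t b (ψ y) = ∑ j, jac ψ y b j • t' j y := fun b => (h y hy b).symm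
    simp only [e, Finset.sum_smul, Finset.smul_sum, smul_smul]
    rw [Finset.sum_comm]
    refine Finset.sum_congr rfl fun a _ => ?_
    rw [Finset.sum_comm]
    exact Finset.sum_congr rfl fun b _ => Finset.sum_congr rfl fun j _ => by congr 1; ring
  simp only [nablaUp, smul_add, Finset.sum_add_distrib, ← h3, ← h4, ← h1]
  abel

lemma divUp_eq {t' t : Fin 4 → Coord → W} (ht' : ∀ k, ContDiffOn ℝ ∞ (t' k) U')
    (ht : ∀ k, ContDiffOn ℝ ∞ (t k) U)
    (h : ∀ z ∈ U', Up1 (jac ψ z) (fun i => t' i z) (fun a => t a (ψ z))) (hy : y ∈ U') :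
    divUp F' t' y = divUp F t (ψ y) :=
  contract_mix (T.det_ne y hy) (s' := fun j i => nablaUp F' t' i j y)
    (s := fun b a => nablaUp F t a b (ψ y)) fun c i => T.nablaUp_eq ht' ht h hy i c

end Transition
end

section

variable {m : ℕ}

namespace Transition

variable {F' F : Coord → Amb m} {ψ : Coord → Coord} {U' U : Set Coord} {y : Coord} {W : Type*}
  [NormedAddCommGroup W] [NormedSpace ℝ W] (T : Transition F' F ψ U' U)
include T

lemma meanCurv_eq : ∀ y ∈ U', meanCurv F' y = meanCurv F (ψ y) := fun y hy => by
  have h := contract_lo2_up2 (T.sff_eq hy) (T.metricInv_eq hy) (LinearMap.lsmul ℝ (Amb m)).flip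
  simp only [LinearMap.flip_apply, LinearMap.lsmul_apply] at h
  rw [meanCurv, meanCurv, h]

lemma sffMixed_eq (hy : y ∈ U') :
    Mix (jac ψ y) (fun i j => sffMixed F' i j y) (fun a b => sffMixed F a b (ψ y)) :=
  (T.sff_eq hy).raise (T.metricInv_eq hy)

lemma sffUp_eq (hy : y ∈ U') :
    Up2 (jac ψ y) (fun i j => sffUp F' i j y) (fun a b => sffUp F a b (ψ y)) :=
  (T.sff_eq hy).raise2 (T.metricInv_eq hy)

lemma grad_eq {X' X : Coord → Amb m} (hX : ContDiffOn ℝ ∞ X U)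
    (h : ∀ y ∈ U', X' y = X (ψ y)) (hy : y ∈ U') :
    Up1 (jac ψ y) (fun i => grad F' X' i y) (fun a => grad F X a (ψ y)) :=
  (T.pd_eq hX h hy).raise (T.metricInv_eq hy)

lemma normalPd_eq {X' X : Coord → Amb m} (hX : ContDiffOn ℝ ∞ X U)
    (h : ∀ y ∈ U', X' y = X (ψ y)) (hy : y ∈ U') :
    Lo1 (jac ψ y) (fun i => normalPd F' i X' y) (fun a => normalPd F a X (ψ y)) := by
  simp only [normalPd, FourWillmore.normalPart_eq, T.nproj_eq hy]
  exact (T.pd_eq hX h hy).map (nproj F (ψ y))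

lemma normalGrad_eq {X' X : Coord → Amb m} (hX : ContDiffOn ℝ ∞ X U)
    (h : ∀ y ∈ U', X' y = X (ψ y)) (hy : y ∈ U') :
    Up1 (jac ψ y) (fun i => normalGrad F' X' i y) (fun a => normalGrad F X a (ψ y)) := by
  simp only [normalGrad, FourWillmore.normalPart_eq, T.nproj_eq hy]
  exact (T.grad_eq hX h hy).map (nproj F (ψ y))

lemma lapPerp_eq {X' X : Coord → Amb m} (hX : ContDiffOn ℝ ∞ X U)
    (h : ∀ y ∈ U', X' y = X (ψ y)) : ∀ y ∈ U', lapPerp F' X' y = lapPerp F X (ψ y) :=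
  fun y hy => by
  have h1 := T.nablaLow_eq (fun k => T.imm.normalPd_smooth hX k)
    (fun z hz => T.normalPd_eq hX h hz) hy
  have h2 := contract_lo2_up2 (h1.map (nproj F (ψ y))) (T.metricInv_eq hy)
    (LinearMap.lsmul ℝ (Amb m)).flip
  simp only [LinearMap.flip_apply, LinearMap.lsmul_apply] at h2
  simp only [lapPerp, FourWillmore.normalPart_eq, T.nproj_eq hy]
  exact h2

lemma inner_H_sffUp (hy : y ∈ U') : Up2 (jac ψ y) (fun i j => ⟪meanCurv F' y, sffUp F' i j y⟫_ℝ)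
    (fun a b => ⟪meanCurv F (ψ y), sffUp F a b (ψ y)⟫_ℝ) := by
  rw [T.meanCurv_eq y hy]
  exact (T.sffUp_eq hy).map (innerₗ _ _)

lemma normSqHh_eq (hy : y ∈ U') : normSqHh F' y = normSqHh F (ψ y) := by
  have h1 := (T.sff_eq hy).map (innerₗ _ (meanCurv F (ψ y)))
  have h := contract_lo2_up2 h1 (T.inner_H_sffUp hy) (LinearMap.lsmul ℝ ℝ).flip
  simp only [innerₗ_apply_apply, LinearMap.flip_apply, LinearMap.lsmul_apply, smul_eq_mul] at h
  simp only [normSqHh]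
  rw [← h, T.meanCurv_eq y hy]

lemma hhH_eq : ∀ y ∈ U', hhH F' y = hhH F (ψ y) := fun y hy => by
  have h := contract_lo2_up2 (T.sff_eq hy) (T.inner_H_sffUp hy) (LinearMap.lsmul ℝ (Amb m)).flip
  simp only [LinearMap.flip_apply, LinearMap.lsmul_apply] at h
  exact h

lemma cubicH_eq : ∀ y ∈ U', cubicH F' y = cubicH F (ψ y) := fun y hy => by
  rw [cubicH, cubicH, T.meanCurv_eq y hy]

lemma HhH_eq (hy : y ∈ U') :
    Up2 (jac ψ y) (fun i j => HhH F' i j y) (fun a b => HhH F a b (ψ y)) := by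
  have h := (T.inner_H_sffUp hy).map (LinearMap.toSpanSingleton ℝ _ (meanCurv F (ψ y)))
  simp only [LinearMap.toSpanSingleton_apply] at h
  simp only [HhH]
  rw [T.meanCurv_eq y hy] at h ⊢
  exact h

lemma normSqNormalGradH_eq (hy : y ∈ U') :
    normSqNormalGradH F' y = normSqNormalGradH F (ψ y) := by
  have h1 := T.normalPd_eq T.imm.meanCurv_smooth T.meanCurv_eq hy
  have h := contract_lo_up h1 (h1.raise (T.metricInv_eq hy)) (innerₗ (Amb m))
  simp only [innerₗ_apply_apply, inner_sum, real_inner_smul_right] at h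
  exact h

lemma localDensity_eq (hy : y ∈ U') : localDensity F' y = localDensity F (ψ y) := by
  rw [localDensity, localDensity, T.normSqHh_eq hy, T.normSqNormalGradH_eq hy, T.meanCurv_eq y hy]

lemma sum_nablaUpUp_eq {S' S : Fin 4 → Fin 4 → Coord → W}
    (hS' : ∀ i j, ContDiffOn ℝ ∞ (S' i j) U') (hS : ∀ i j, ContDiffOn ℝ ∞ (S i j) U)
    (h : ∀ z ∈ U', Up2 (jac ψ z) (fun i j => S' i j z) (fun a b => S a b (ψ z))) (hy : y ∈ U') :
    Up1 (jac ψ y) (fun k => ∑ i, nablaUpUp F' S' i i k y)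
      (fun c => ∑ a, nablaUpUp F S a a c (ψ y)) := fun b => by
  -- contracting the second index with a row of the Jacobian leaves a tensor with one upper index
  have hmix : Mix (jac ψ y) (fun j i => ∑ k, jac ψ y b k • nablaUpUp F' S' i j k y)
      (fun a c => nablaUpUp F S c a b (ψ y)) := fun a i => by
    have h1 := T.pd_eq (f' := fun z => ∑ j, ∑ k, (jac ψ z a j * jac ψ z b k) • S' j k z) (hS a b)
      (fun z hz => h z hz a b) hy i
    simp only at h1
    rw [T.relOpen.pd_sum (f := fun j z => ∑ k, (jac ψ z a j * jac ψ z b k) • S' j k z) _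
      (fun j _ => ContDiffOn.sum fun k _ =>
        ((T.jac_smooth a j).mul (T.jac_smooth b k)).smul (hS' j k)) hy] at h1
    have h2 : ∀ j, pd i (fun z => ∑ k, (jac ψ z a j * jac ψ z b k) • S' j k z) y
        = ∑ k, (((∑ l, christoffel F' l i j y * jac ψ y a l) * jac ψ y b k) • S' j k y
          - ((∑ c, ∑ d, jac ψ y c i * jac ψ y d j * christoffel F a c d (ψ y)) * jac ψ y b k) •
              S' j k y
          + ((jac ψ y a j * (∑ l, christoffel F' l i k y * jac ψ y b l)) • S' j k y
          - (jac ψ y a j * (∑ c, ∑ d, jac ψ y c i * jac ψ y d k * christoffel F b c d (ψ y))) •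
              S' j k y)
          + (jac ψ y a j * jac ψ y b k) • pd i (S' j k) y) := fun j => by
      rw [T.relOpen.pd_sum (f := fun k z => (jac ψ z a j * jac ψ z b k) • S' j k z) _
        (fun k _ => ((T.jac_smooth a j).mul (T.jac_smooth b k)).smul (hS' j k)) hy]
      refine Finset.sum_congr rfl fun k _ => ?_
      rw [T.relOpen.pd_smul ((T.jac_smooth a j).mul (T.jac_smooth b k)) (hS' j k) hy,
        T.relOpen.pd_mul (T.jac_smooth a j) (T.jac_smooth b k) hy, T.christoffel_eq hy,
        T.christoffel_eq hy, sub_mul, mul_sub, add_smul, sub_smul, sub_smul]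
    simp only [h2, Finset.sum_add_distrib, Finset.sum_sub_distrib] at h1
    have e : ∀ a b, S a b (ψ y) = ∑ j, ∑ k, (jac ψ y a j * jac ψ y b k) • S' j k y :=
      fun a b => (h y hy a b).symm
    have h3 : ∑ j, ∑ k, ((∑ l, christoffel F' l i j y * jac ψ y a l) * jac ψ y b k) • S' j k y
        = ∑ j, jac ψ y a j • ∑ k, jac ψ y b k • ∑ l, christoffel F' j i l y • S' l k y := by
      simp only [Finset.sum_smul, Finset.smul_sum, smul_smul, Finset.sum_mul]
      have : ∀ j, ∑ k, ∑ l, (christoffel F' l i j y * jac ψ y a l * jac ψ y b k) • S' j k y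
        = ∑ l, ∑ k, (christoffel F' l i j y * jac ψ y a l * jac ψ y b k) • S' j k y :=
        fun j => Finset.sum_comm
      simp only [this]
      rw [Finset.sum_comm]
      refine Finset.sum_congr rfl fun l _ => ?_
      rw [Finset.sum_comm]
      refine Finset.sum_congr rfl fun k _ => Finset.sum_congr rfl fun j _ => ?_
      congr 1; ring
    have h4 : ∑ j, ∑ k, (jac ψ y a j * (∑ l, christoffel F' l i k y * jac ψ y b l)) • S' j k y
        = ∑ j, jac ψ y a j • ∑ k, jac ψ y b k • ∑ l, christoffel F' k i l y • S' j l y := by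
      simp only [Finset.sum_smul, Finset.smul_sum, smul_smul, Finset.mul_sum]
      refine Finset.sum_congr rfl fun j _ => ?_
      rw [Finset.sum_comm]
      refine Finset.sum_congr rfl fun k _ => Finset.sum_congr rfl fun l _ => ?_
      congr 1; ring
    have h5 : ∑ j, ∑ k, ((∑ c, ∑ d, jac ψ y c i * jac ψ y d j * christoffel F a c d (ψ y)) *
        jac ψ y b k) • S' j k y
        = ∑ c, jac ψ y c i • ∑ d, christoffel F a c d (ψ y) • S d b (ψ y) := by
      simp only [e, Finset.sum_smul, Finset.smul_sum, smul_smul, Finset.sum_mul]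
      rw [sum_comm_pairs]
      refine Finset.sum_congr rfl fun c _ => Finset.sum_congr rfl fun d _ =>
        Finset.sum_congr rfl fun j _ => Finset.sum_congr rfl fun k _ => ?_
      congr 1; ring
    have h6 : ∑ j, ∑ k, (jac ψ y a j * (∑ c, ∑ d, jac ψ y c i * jac ψ y d k *
        christoffel F b c d (ψ y))) • S' j k y
        = ∑ c, jac ψ y c i • ∑ d, christoffel F b c d (ψ y) • S a d (ψ y) := by
      simp only [e, Finset.sum_smul, Finset.smul_sum, smul_smul, Finset.mul_sum]
      rw [sum_comm_pairs]
      refine Finset.sum_congr rfl fun c _ => Finset.sum_congr rfl fun d _ =>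
        Finset.sum_congr rfl fun j _ => Finset.sum_congr rfl fun k _ => ?_
      congr 1; ring
    have h7 : ∑ j, ∑ k, (jac ψ y a j * jac ψ y b k) • pd i (S' j k) y
        = ∑ j, jac ψ y a j • ∑ k, jac ψ y b k • pd i (S' j k) y := by
      simp only [Finset.smul_sum, smul_smul]
    rw [h3, h4, h5, h6, h7] at h1
    simp only [nablaUpUp, smul_add, Finset.sum_add_distrib, ← h1]
    abel
  have := contract_mix (T.det_ne y hy) hmix
  refine Eq.trans ?_ this
  simp only [Finset.smul_sum]
  exact Finset.sum_comm

/-- The flux field transforms as a vector field. -/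
lemma localFlux_eq {b' b : Coord → Amb m} (hb : ContDiffOn ℝ ∞ b U)
    (h : ∀ y ∈ U', b' y = b (ψ y)) (hy : y ∈ U') :
    Up1 (jac ψ y) (fun j => localFlux F' b' j y) (fun a => localFlux F b a (ψ y)) := by
  have hH := T.meanCurv_eq y hy
  have hHs := T.imm.meanCurv_smooth
  have hgH := T.grad_eq hHs T.meanCurv_eq hy
  have hgb := T.grad_eq hb h hy
  have hgL := T.grad_eq (T.imm.lapPerp_smooth hHs) (T.lapPerp_eq hHs T.meanCurv_eq) hy
  have hL := T.lapPerp_eq hHs T.meanCurv_eq y hy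
  have hLb := T.lapPerp_eq hb h y hy
  have hb0 := h y hy
  have hHU := T.inner_H_sffUp hy
  -- the contraction of `h^{ik} ⊗ h_{ik}` with two vectors
  have c1 : ∀ u v : Amb m, ∑ i, ∑ k, ⟪u, sffUp F' i k y⟫_ℝ * ⟪v, sff F' i k y⟫_ℝ
      = ∑ i, ∑ k, ⟪u, sffUp F i k (ψ y)⟫_ℝ * ⟪v, sff F i k (ψ y)⟫_ℝ := fun u v => by
    have := contract_lo2_up2 ((T.sff_eq hy).map (innerₗ _ v)) ((T.sffUp_eq hy).map (innerₗ _ u))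
      (LinearMap.lsmul ℝ ℝ).flip
    simpa only [innerₗ_apply_apply, LinearMap.flip_apply, LinearMap.lsmul_apply,
      smul_eq_mul] using this
  intro a
  have hmix : Lo1 (jac ψ y) (fun i => ∑ j, jac ψ y a j • sffMixed F' j i y)
    (fun c => sffMixed F a c (ψ y)) := T.sffMixed_eq hy a
  simp only [localFlux, smul_eq_mul, mul_add, mul_sub, Finset.sum_add_distrib,
    Finset.sum_sub_distrib]
  have key : ∀ (f' : Fin 4 → Amb m) (f : Fin 4 → Amb m) (u : Amb m), Up1 (jac ψ y) f' f →
      ∑ j, jac ψ y a j * ⟪f' j, u⟫_ℝ = ⟪f a, u⟫_ℝ := fun f' f u hf => by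
    rw [← hf a, sum_inner]; simp only [real_inner_smul_left]
  have key' : ∀ (f' : Fin 4 → Amb m) (f : Fin 4 → Amb m) (u : Amb m), Up1 (jac ψ y) f' f →
      ∑ j, jac ψ y a j * ⟪u, f' j⟫_ℝ = ⟪u, f a⟫_ℝ := fun f' f u hf => by
    rw [← hf a, inner_sum]; simp only [real_inner_smul_right]
  have swap : ∀ (c : ℝ) (g : Fin 4 → ℝ), ∑ j, jac ψ y a j * (c * g j)
      = c * ∑ j, jac ψ y a j * g j := fun c g => by
    rw [Finset.mul_sum]; exact Finset.sum_congr rfl fun j _ => by ring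
  refine congrArg₂ (· - ·) (congrArg₂ (· + ·) (congrArg₂ (· + ·) (congrArg₂ (· - ·)
    (congrArg₂ (· + ·) (congrArg₂ (· - ·) (congrArg₂ (· + ·) (congrArg₂ (· - ·)
    (congrArg₂ (· + ·) (congrArg₂ (· - ·) (congrArg₂ (· + ·) ?_ ?_) ?_) ?_) ?_) ?_) ?_) ?_) ?_)
    ?_) ?_) ?_
  · rw [swap]
    simp only [c1, hb0]
    congr 1
    simp only [Finset.mul_sum]
    rw [Finset.sum_comm]
    refine Finset.sum_congr rfl fun i _ => ?_
    rw [Finset.sum_comm]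
    refine Finset.sum_congr rfl fun k _ => ?_
    simp only [← mul_assoc, ← Finset.sum_mul]
    rw [key _ _ _ hgH]
  · rw [swap, hLb, key _ _ _ hgH]
  · have : ∑ j, jac ψ y a j * ∑ i, ⟪grad F' (meanCurv F') i y, sffMixed F' j i y⟫_ℝ
        = ∑ i, ⟪grad F (meanCurv F) i (ψ y), sffMixed F a i (ψ y)⟫_ℝ := by
      have h1 := contract_lo_up hmix hgH (innerₗ (Amb m))
      simp only [innerₗ_apply_apply] at h1
      simp only [real_inner_comm (sffMixed F a _ (ψ y)), ← h1, Finset.mul_sum, sum_inner,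
        real_inner_smul_left]
      rw [Finset.sum_comm]
      exact Finset.sum_congr rfl fun i _ => Finset.sum_congr rfl fun j _ => by
        rw [real_inner_comm]
    rw [← this, hH, hb0, Finset.mul_sum, Finset.sum_mul]
    exact Finset.sum_congr rfl fun j _ => by ring
  · rw [swap]
    congr 1
    have h1 := contract_lo_up (hmix.map (innerₗ _ (meanCurv F (ψ y))))
      (hgH.map (innerₗ _ (b (ψ y)))) (LinearMap.lsmul ℝ ℝ).flip
    simp only [innerₗ_apply_apply, LinearMap.flip_apply, LinearMap.lsmul_apply,
      smul_eq_mul, real_inner_comm _ (b (ψ y))] at h1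
    rw [hH, hb0, ← h1]
    simp only [Finset.mul_sum, inner_sum, real_inner_smul_right]
    rw [Finset.sum_comm]
    exact Finset.sum_congr rfl fun i _ => Finset.sum_congr rfl fun j _ => by ring
  · rw [swap, hL, key' _ _ _ hgb]
  · rw [swap, hb0, key _ _ _ hgL]
  · rw [swap, hH]
    simp only [real_inner_comm (grad _ _ _ _) (sff _ _ _ _), c1]
    congr 1
    simp only [Finset.mul_sum]
    rw [Finset.sum_comm]
    refine Finset.sum_congr rfl fun i _ => ?_
    rw [Finset.sum_comm]
    refine Finset.sum_congr rfl fun k _ => ?_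
    simp only [mul_left_comm (jac ψ y a _), ← Finset.mul_sum]
    rw [key _ _ _ hgb]
  · rw [swap, hb0, key _ _ _ (T.normalGrad_eq T.imm.hhH_smooth T.hhH_eq hy)]
  · rw [swap]
    congr 1
    have h0 : Up1 (jac ψ y) (fun i => ∑ j, jac ψ y a j • ⟪meanCurv F' y, sffUp F' i j y⟫_ℝ)
        (fun c => ⟪meanCurv F (ψ y), sffUp F c a (ψ y)⟫_ℝ) := fun c => by
      refine Eq.trans ?_ (hHU c a)
      simp only [smul_eq_mul, Finset.mul_sum, mul_assoc]
    have h1 := contract_lo_up ((T.pd_eq hb h hy).map (innerₗ _ (meanCurv F (ψ y)))) h0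
      (LinearMap.lsmul ℝ ℝ).flip
    simp only [innerₗ_apply_apply, LinearMap.flip_apply, LinearMap.lsmul_apply, smul_eq_mul] at h1
    rw [← h1, ← hH]
    simp only [Finset.mul_sum, Finset.sum_mul, mul_assoc]
    exact Finset.sum_comm
  · have h1 := T.sum_nablaUpUp_eq T.imm'.HhH_smooth T.imm.HhH_smooth (fun z hz => T.HhH_eq hz) hy
    have h2 := h1.map (nproj F (ψ y))
    simp only [FourWillmore.normalPart_eq, T.nproj_eq hy]
    rw [swap, hb0, key _ _ _ h2]
  · simp only [mul_assoc]
    rw [swap, swap, hH, key' _ _ _ hgb]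
  · rw [swap, hb0, key _ _ _ (T.normalGrad_eq T.imm.cubicH_smooth T.cubicH_eq hy)]

end Transition
end

section

variable {m : ℕ}

lemma Imm.metric_posDef {F : Coord → Amb m} {U : Set Coord} (hF : Imm F U) {y : Coord}
    (hy : y ∈ U) :
    (metric F y).PosDef :=
  (Matrix.posSemidef_gram ℝ fun i => pd i F y).posDef_iff_isUnit.2
    ((Matrix.isUnit_iff_isUnit_det _).2 (hF.isUnit_det hy))

lemma Imm.metricInv_zero_pos {F : Coord → Amb m} {U : Set Coord} (hF : Imm F U) {y : Coord}
    (hy : y ∈ U) : 0 < metricInv F y 0 0 :=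
  (hF.metric_posDef hy).inv.diag_pos

/-- The boundary density is `√g |dy⁰|`. -/
lemma Imm.bdryDensity_eq {F : Coord → Amb m} {U : Set Coord} (hF : Imm F U) {y : Coord}
    (hy : y ∈ U) : bdryDensity F y = volDensity F y * Real.sqrt (metricInv F y 0 0) := by
  have h0 := hF.det_pos y hy
  rw [bdryDensity, volDensity, ← Real.sqrt_mul h0.le]
  congr 1
  have : metricInv F y 0 0 = (metric F y).det⁻¹ * (metric F y).adjugate 0 0 := by
    rw [metricInv, Matrix.inv_def, Ring.inverse_eq_inv']; rfl
  rw [this, mul_inv_cancel_left₀ h0.ne', Matrix.adjugate_fin_succ_eq_det_submatrix]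
  simp

lemma Imm.bdryDensity_smooth {F : Coord → Amb m} {U : Set Coord} (hF : Imm F U) :
    ContDiffOn ℝ ∞ (bdryDensity F) U :=
  ((hF.volDensity_smooth).mul ((hF.metricInv_smooth 0 0).sqrt
    fun _ hy => (hF.metricInv_zero_pos hy).ne')).congr fun _ hy => hF.bdryDensity_eq hy

/-- The flux density of the boundary in coordinates is `-√g V⁰`. -/
lemma Imm.flux_mul_bdryDensity {F : Coord → Amb m} {U : Set Coord} (hF : Imm F U) {y : Coord}
    (hy : y ∈ U) (V : Fin 4 → ℝ) :
    (∑ j, V j * conormal F j y) * bdryDensity F y = -(volDensity F y * V 0) := by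
  have h0 := Real.sqrt_pos.2 (hF.metricInv_zero_pos hy)
  rw [hF.bdryDensity_eq hy]
  simp only [conormal, mul_ite, mul_zero, Finset.sum_ite_eq', Finset.mem_univ, if_true]
  field_simp

namespace Transition

variable {F' F : Coord → Amb m} {ψ : Coord → Coord} {U' U : Set Coord} {y : Coord}
  (T : Transition F' F ψ U' U)
include T

/-- A change of coordinates between two readings of a map is one between the readings of its
variation, where this remains an immersion. -/
lemma add_smul {b' b : Coord → Amb m} (hb : ContDiffOn ℝ ∞ b U) (h : ∀ y ∈ U', b' y = b (ψ y))
    (t : ℝ) : Transition (F' + t • b') (F + t • b) ψ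
      (U' ∩ ψ ⁻¹' (U ∩ {z | jet F z + t • jet b z ∈ immJets m}))
      (U ∩ {z | jet F z + t • jet b z ∈ immJets m}) where
  relOpen := by
    have hc : ContinuousOn (fun z => jet F (ψ z) + t • jet b (ψ z)) U' :=
      (((T.imm.jet_smooth T.imm.smooth).continuousOn.add
      ((T.imm.jet_smooth hb).continuousOn.const_smul t))).comp T.smooth.continuousOn T.mapsTo
    have h := T.relOpen.inter_preimage hc isOpen_immJets
    convert h using 1
    ext z
    exact ⟨fun h => ⟨h.1, h.2.2⟩, fun h => ⟨h.1, T.mapsTo h.1, h.2⟩⟩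
  imm := T.imm.add_smul hb t
  smooth := T.smooth.mono fun _ h => h.1
  mapsTo := fun _ h => h.2
  eq := fun y hy => by simp [T.eq y hy.1, h y hy.1]
  det_ne := fun y hy => T.det_ne y hy.1

lemma div_localFlux_eq {b' b : Coord → Amb m} (hb : ContDiffOn ℝ ∞ b U)
    (h : ∀ y ∈ U', b' y = b (ψ y)) (hy : y ∈ U') :
    divUp F' (localFlux F' b') y = divUp F (localFlux F b) (ψ y) :=
  T.divUp_eq (T.imm'.localFlux_smooth ((hb.comp T.smooth T.mapsTo).congr h))
    (T.imm.localFlux_smooth hb) (fun _ hz => T.localFlux_eq hb h hz) hy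

/-- Invariance of `b · 𝒲`: both the energy, hence its first variation, and the divergence of the
flux field are invariant. -/
lemma inner_localWillmore_eq {b' b : Coord → Amb m} (hb : ContDiffOn ℝ ∞ b U)
    (h : ∀ y ∈ U', b' y = b (ψ y)) (hbn : ∀ z ∈ U, ∀ k, ⟪b z, pd k F z⟫_ℝ = 0) (hy : y ∈ U') :
    ⟪b' y, localWillmore F' y⟫_ℝ = ⟪b (ψ y), localWillmore F (ψ y)⟫_ℝ := by
  have hb' : ContDiffOn ℝ ∞ b' U' := (hb.comp T.smooth T.mapsTo).congr h
  have hbn' : ∀ z ∈ U', ∀ k, ⟪b' z, pd k F' z⟫_ℝ = 0 := fun z hz k => by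
    have hk : pd k F' z = _ := T.frame hz k
    rw [hk, h z hz, inner_sum]
    exact Finset.sum_eq_zero fun a _ => by rw [inner_smul_right, hbn _ (T.mapsTo hz), mul_zero]
  have h1 := T.imm'.hasDerivAt_jetEnergy hb' hbn' hy
  have h2 := (T.imm.hasDerivAt_jetEnergy hb hbn (T.mapsTo hy)).const_mul |(jac ψ y).det|
  have h3 : (fun t : ℝ => jetEnergy (jet' F' y + t • jet' b' y)) =ᶠ[𝓝 0]
      fun t => |(jac ψ y).det| * jetEnergy (jet' F (ψ y) + t • jet' b (ψ y)) := by
    filter_upwards [T.imm'.eventually_immJets b' hy, T.imm.eventually_immJets b (T.mapsTo hy)]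
      with t ht ht'
    have hy2 : y ∈ U' ∩ ψ ⁻¹' (U ∩ {z | jet F z + t • jet b z ∈ immJets m}) :=
      ⟨hy, T.mapsTo hy, ht'⟩
    rw [← T.imm'.density_mul_vol_add_smul hb' hy ht,
      ← T.imm.density_mul_vol_add_smul hb (T.mapsTo hy) ht',
      (T.add_smul hb h t).localDensity_eq hy2, (T.add_smul hb h t).volDensity_eq hy2]
    ring
  -- both sides of the first variation formula in the two coordinate systems; the volume factors and
  -- the divergences cancel
  have h4 := h1.unique (h2.congr_of_eventuallyEq h3)
  rw [T.volDensity_eq hy, T.div_localFlux_eq hb h hy, mul_assoc] at h4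
  have h5 := mul_left_cancel₀ (abs_pos.2 (T.det_ne y hy)).ne' h4
  have h6 := mul_left_cancel₀ (T.imm.volDensity_pos (T.mapsTo hy)).ne' h5
  linarith

/-! ### Changes of coordinates at the boundary -/

/-- Where a change of coordinates reaches the boundary, it maps vectors pointing into the half space
to vectors with nonnegative `0`-th component. -/
lemma deriv_nonneg (h0 : (ψ y) 0 = 0) (hy : y ∈ U') {v : Coord}
    (hv : ∀ᶠ s : ℝ in 𝓝[>] 0, y + s • v ∈ halfSpace) :
    0 ≤ (fderivWithin ℝ ψ halfSpace y v) 0 := by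
  have h1 : IsLocalMinOn (fun z => (ψ z) 0) halfSpace y := by
    filter_upwards [T.relOpen.mem_nhdsWithin y hy] with z hz
    rw [h0]
    exact T.imm.subset (T.mapsTo hz)
  have h2 := (EuclideanSpace.proj (𝕜 := ℝ) (0 : Fin 4)).hasFDerivAt.comp_hasFDerivWithinAt y
    (T.relOpen.hasFDerivWithinAt T.smooth hy)
  exact h1.hasFDerivWithinAt_nonneg h2 (mem_posTangentConeAt_of_frequently_mem hv.frequently)

/-- Where a change of coordinates reaches the boundary, it maps vectors tangent to the half space to
vectors tangent to the boundary. -/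
lemma deriv_eq_zero (h0 : (ψ y) 0 = 0) (hy : y ∈ U') {v : Coord}
    (hv : ∀ᶠ s : ℝ in 𝓝 0, y + s • v ∈ halfSpace) :
    (fderivWithin ℝ ψ halfSpace y v) 0 = 0 := by
  refine le_antisymm ?_ (T.deriv_nonneg h0 hy (hv.filter_mono nhdsWithin_le_nhds))
  have h := T.deriv_nonneg h0 hy (v := -v) (by
    have h1 : Tendsto (fun s : ℝ => -s) (𝓝[>] 0) (𝓝 0) := by
      have : Tendsto (fun s : ℝ => -s) (𝓝 0) (𝓝 (-0)) := tendsto_id.neg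
      rw [neg_zero] at this
      exact this.mono_left nhdsWithin_le_nhds
    filter_upwards [h1.eventually hv] with s hs
    simpa using hs)
  rw [map_neg, PiLp.neg_apply] at h
  linarith

/-- Changes of coordinates preserve the interior. -/
lemma interior (hy : y ∈ U') (h : 0 < y 0) : 0 < (ψ y) 0 := by
  have h' : 0 ≤ (ψ y) 0 := T.imm.subset (T.mapsTo hy)
  refine h'.lt_of_ne fun h0 => T.det_ne y hy (Matrix.det_eq_zero_of_row_eq_zero 0 fun i => ?_)
  refine T.deriv_eq_zero h0.symm hy ?_
  have hc : ContinuousAt (fun s : ℝ => (y + s • EuclideanSpace.single i (1 : ℝ) : Coord) 0) 0 := by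
    fun_prop
  filter_upwards [hc.eventually_const_lt (u := 0) (by simpa using h)] with s hs using hs.le

lemma jac_zero_succ (hy : y ∈ U') (h0 : (ψ y) 0 = 0) (i : Fin 3) : jac ψ y 0 i.succ = 0 := by
  refine T.deriv_eq_zero h0 hy (Eventually.of_forall fun s => ?_)
  have := T.relOpen.subset hy
  simpa [halfSpace] using this

lemma jac_zero_zero (hy : y ∈ U') (h0 : (ψ y) 0 = 0) : 0 < jac ψ y 0 0 := by
  have h : 0 ≤ jac ψ y 0 0 := by
    refine T.deriv_nonneg h0 hy ?_
    filter_upwards [self_mem_nhdsWithin] with s hs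
    have h1 : 0 ≤ y 0 := T.relOpen.subset hy
    have h2 : 0 < s := hs
    simp only [halfSpace, Set.mem_ofPred_eq, PiLp.add_apply, PiLp.smul_apply,
      PiLp.single_apply, if_true, smul_eq_mul, mul_one]
    linarith
  refine h.lt_of_ne fun h1 => T.det_ne y hy (Matrix.det_eq_zero_of_row_eq_zero 0 fun i => ?_)
  refine Fin.cases h1.symm (fun i => T.jac_zero_succ hy h0 i) i

/-- Change of variables for the boundary density. At the boundary the Jacobian matrix is block
triangular, so that the boundary metric transforms by its lower right block. -/
lemma bdryDensity_eq (hy : y ∈ U') (h0 : (ψ y) 0 = 0) : bdryDensity F' y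
    = |((jac ψ y).submatrix Fin.succ Fin.succ).det| * bdryDensity F (ψ y) := by
  have h : (metric F' y).submatrix Fin.succ Fin.succ
      = ((jac ψ y).submatrix Fin.succ Fin.succ).transpose
        * (metric F (ψ y)).submatrix Fin.succ Fin.succ * (jac ψ y).submatrix Fin.succ Fin.succ := by
    ext i j
    rw [T.metric_eq hy]
    simp only [Matrix.submatrix_apply, Matrix.mul_apply, Matrix.transpose_apply,
      Fin.sum_univ_succ (n := 3), T.jac_zero_succ hy h0, zero_mul, mul_zero, zero_add]
  rw [bdryDensity, h, Matrix.det_mul, Matrix.det_mul, Matrix.det_transpose, mul_comm, ← mul_assoc,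
    ← pow_two, Real.sqrt_mul (sq_nonneg _), Real.sqrt_sq_eq_abs]
  rfl

/-- Invariance of the flux through the boundary. -/
lemma flux_eq {b' b : Coord → Amb m} (hb : ContDiffOn ℝ ∞ b U)
    (h : ∀ y ∈ U', b' y = b (ψ y)) (hy : y ∈ U') (h0 : (ψ y) 0 = 0) :
    ∑ j, localFlux F' b' j y * conormal F' j y
      = ∑ j, localFlux F b j (ψ y) * conormal F j (ψ y) := by
  have h1 := T.localFlux_eq hb h hy 0
  have h2 := T.metricInv_eq hy 0 0
  simp only [Fin.sum_univ_succ (n := 3), T.jac_zero_succ hy h0, zero_mul, mul_zero,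
    Finset.sum_const_zero, add_zero, smul_eq_mul] at h1 h2
  have hJ := T.jac_zero_zero hy h0
  simp only [conormal, mul_ite, mul_zero, Finset.sum_ite_eq', Finset.mem_univ, if_true]
  rw [← h1, ← h2, Real.sqrt_mul (by positivity), Real.sqrt_mul_self hJ.le]
  have := Real.sqrt_pos.2 (T.imm'.metricInv_zero_pos hy)
  field_simp

end Transition
end

/-! ### The divergence theorem in the half space -/

lemma relOpen_halfSpace : RelOpen halfSpace := ⟨subset_rfl, fun _ _ => self_mem_nhdsWithin⟩

lemma RelOpen.exists_isOpen {U : Set Coord} (hU : RelOpen U) :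
    ∃ O, IsOpen O ∧ U = halfSpace ∩ O := by
  refine ⟨_root_.interior (U ∪ halfSpaceᶜ), isOpen_interior, ?_⟩
  ext y
  refine ⟨fun h => ⟨hU.subset h, ?_⟩, fun h => ?_⟩
  · rw [mem_interior_iff_mem_nhds]
    filter_upwards [mem_nhdsWithin_iff_eventually.1 (hU.mem_nhdsWithin y h)] with z hz
    by_cases h : z ∈ halfSpace
    · exact Or.inl (hz h)
    · exact Or.inr h
  · exact (interior_subset h.2).resolve_right fun h' => h' h.1

lemma RelOpen.measurableSet {U : Set Coord} (hU : RelOpen U) : MeasurableSet U := by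
  obtain ⟨O, hO, rfl⟩ := hU.exists_isOpen
  exact isClosed_halfSpace.measurableSet.inter hO.measurableSet

lemma continuous_bdryPoint : Continuous bdryPoint := by
  refine (PiLp.continuous_toLp 2 _).comp (continuous_pi fun i => ?_)
  refine Fin.cases ?_ (fun j => ?_) i
  · exact continuous_const
  · simp only [Fin.cons_succ]; fun_prop

lemma bdryPoint_zero (z : EuclideanSpace ℝ (Fin 3)) : bdryPoint z 0 = 0 := rfl

lemma bdryPoint_succ (z : EuclideanSpace ℝ (Fin 3)) (i : Fin 3) : bdryPoint z i.succ = z i := rfl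

/-- The divergence theorem in the half space for fields with compact support, from the divergence
theorem on a large box. -/
lemma integral_divergence_halfSpace {g : Fin 4 → Coord → ℝ}
    (hg : ∀ j, ContDiffOn ℝ ∞ (g j) halfSpace) {C : Set Coord} (hC : IsCompact C)
    (h0 : ∀ j, ∀ z ∉ C, g j z = 0) :
    ∫ y in halfSpace, ∑ j, pd j (g j) y = -∫ z, g 0 (bdryPoint z) := by
  obtain ⟨R, hR0, hR⟩ : ∃ R : ℝ, 0 < R ∧ ∀ z ∈ C, ∀ i, |z i| < R := by
    obtain ⟨R, hR⟩ := hC.isBounded.exists_norm_le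
    refine ⟨max R 0 + 1, by positivity, fun z hz i => ?_⟩
    have h1 := (PiLp.norm_apply_le z i).trans (hR z hz)
    rw [Real.norm_eq_abs] at h1
    have := le_max_left R 0
    linarith
  let a : Fin 4 → ℝ := Fin.cons 0 fun _ => -R
  let b : Fin 4 → ℝ := fun _ => R
  have hab : a ≤ b := fun i => Fin.cases hR0.le (fun _ => by simp [a, b]; linarith) i
  have hbox : ∀ x ∈ Set.Icc a b, WithLp.toLp 2 x ∈ halfSpace := fun x hx => hx.1 0
  -- the divergence vanishes off the box
  have hpd0 : ∀ y ∈ halfSpace, y ∉ C → ∀ j, pd j (g j) y = 0 := fun y hy hyC j => by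
    have hU := relOpen_halfSpace.inter_isOpen hC.isClosed.isOpen_compl
    rw [hU.pd_congr (fun z hz => h0 j z hz.2) ⟨hy, hyC⟩, pd_const hU ⟨hy, hyC⟩]
  have key := integral_divergence_of_hasFDerivAt_off_countable' a b hab
    (fun j x => g j (WithLp.toLp 2 x))
    (fun j x => (fderivWithin ℝ (g j) halfSpace (WithLp.toLp 2 x)).comp
      (PiLp.continuousLinearEquiv 2 ℝ fun _ : Fin 4 => ℝ).symm.toContinuousLinearMap)
    ∅ Set.countable_empty
    (fun j => (hg j).continuousOn.comp (PiLp.continuous_toLp 2 _).continuousOn hbox)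
    (fun x hx j => by
      have hx0 : WithLp.toLp 2 x ∈ _root_.interior halfSpace := by
        refine mem_interior.2 ⟨{y | 0 < y 0}, fun y (hy : 0 < y 0) => hy.le,
          isOpen_lt continuous_const (by fun_prop), ?_⟩
        exact (hx.1 0 trivial).1
      have h1 := (relOpen_halfSpace.hasFDerivWithinAt (hg j) (interior_subset hx0)).hasFDerivAt
        (mem_interior_iff_mem_nhds.1 hx0)
      exact h1.comp x (PiLp.continuousLinearEquiv 2 ℝ fun _ : Fin 4 => ℝ).symm.hasFDerivAt)
    (ContinuousOn.integrableOn_Icc (continuousOn_finsetSum _ fun j _ =>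
      (relOpen_halfSpace.pd_smooth (hg j) j).continuousOn.comp
        (PiLp.continuous_toLp 2 _).continuousOn hbox))
  have hdiv : ∀ x, ∑ j, ((fderivWithin ℝ (g j) halfSpace (WithLp.toLp 2 x)).comp
      (PiLp.continuousLinearEquiv 2 ℝ fun _ : Fin 4 => ℝ).symm.toContinuousLinearMap)
        (Pi.single j 1) = ∑ j, pd j (g j) (WithLp.toLp 2 x) := fun x => rfl
  simp only [hdiv] at key
  have hL : ∫ y in halfSpace, ∑ j, pd j (g j) y
      = ∫ x in Set.Icc a b, ∑ j, pd j (g j) (WithLp.toLp 2 x) := by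
    have h1 := (PiLp.volume_preserving_toLp (Fin 4)).setIntegral_preimage_emb
      (MeasurableEquiv.toLp 2 (Fin 4 → ℝ)).measurableEmbedding
      (fun y => ∑ j, pd j (g j) y) halfSpace
    rw [← h1]
    refine setIntegral_eq_of_subset_of_forall_sdiff_eq_zero
      ((PiLp.continuous_toLp 2 _).measurable isClosed_halfSpace.measurableSet)
      hbox (fun x hx => Finset.sum_eq_zero fun j _ => hpd0 _ hx.1 (fun hxC => hx.2 ?_) j)
    have h2 := hR _ hxC
    refine ⟨fun i => ?_, fun i => (abs_lt.1 (h2 i)).2.le⟩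
    exact Fin.cases hx.1 (fun j => (abs_lt.1 (h2 j.succ)).1.le) i
  rw [hL, key]
  -- only the face in the boundary of the half space contributes
  have hf : ∀ i (x : Fin 3 → ℝ), g i (WithLp.toLp 2 (i.insertNth (b i) x)) = 0 := fun i x =>
    h0 _ _ fun h => by
      have := hR _ h i
      simp [b, abs_of_pos hR0] at this
  have hb' : ∀ (i : Fin 3) (x : Fin 3 → ℝ),
      g i.succ (WithLp.toLp 2 (i.succ.insertNth (a i.succ) x)) = 0 := fun i x =>
    h0 _ _ fun h => by
      have := hR _ h i.succ
      simp [a, abs_of_pos hR0] at this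
  simp only [hf, integral_zero, zero_sub, Fin.sum_univ_succ (n := 3), hb', neg_zero,
    Finset.sum_const_zero, add_zero]
  congr 1
  have h1 := (PiLp.volume_preserving_toLp (Fin 3)).integral_comp
      (MeasurableEquiv.toLp 2 (Fin 3 → ℝ)).measurableEmbedding (fun z => g 0 (bdryPoint z))
  rw [← h1]
  have h2 : ∀ x : Fin 3 → ℝ, (WithLp.toLp 2 ((0 : Fin 4).insertNth (a 0) x) : Coord)
      = bdryPoint (WithLp.toLp 2 x) := fun x => by
    rw [Fin.insertNth_zero']; rfl
  simp only [h2]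
  refine setIntegral_eq_integral_of_forall_compl_eq_zero fun x hx => h0 _ _ fun hxC => hx ?_
  have h3 := hR _ hxC
  exact ⟨fun i => (abs_lt.1 (h3 i.succ)).1.le, fun i => (abs_lt.1 (h3 i.succ)).2.le⟩

/-- The divergence theorem for fields with compact support in a relatively open subset of the half
space. -/
lemma RelOpen.integral_divergence {U : Set Coord} (hU : RelOpen U) {f : Fin 4 → Coord → ℝ}
    (hf : ∀ j, ContDiffOn ℝ ∞ (f j) U) {C : Set Coord} (hC : IsCompact C) (hCU : C ⊆ U)
    (h0 : ∀ j, ∀ z ∈ U, z ∉ C → f j z = 0) :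
    ∫ y in U, ∑ j, pd j (f j) y = -∫ z in bdryPoint ⁻¹' U, f 0 (bdryPoint z) := by
  let g : Fin 4 → Coord → ℝ := fun j => C.indicator (f j)
  have hg0 : ∀ j, ∀ z ∉ C, g j z = 0 := fun j z hz => Set.indicator_of_notMem hz _
  have hgf : ∀ j, ∀ z ∈ U, g j z = f j z := fun j z hz => by
    by_cases h : z ∈ C
    · exact Set.indicator_of_mem h _
    · rw [hg0 j z h, h0 j z hz h]
  -- the extension by zero is smooth up to the boundary of the half space
  have hg : ∀ j, ContDiffOn ℝ ∞ (g j) halfSpace := fun j y hy => by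
    by_cases h : y ∈ C
    · have h1 := ((hf j).congr (hgf j)) y (hCU h)
      exact h1.mono_of_mem_nhdsWithin (hU.mem_nhdsWithin y (hCU h))
    · refine (contDiffAt_const (c := (0 : ℝ))).congr_of_eventuallyEq ?_ |>.contDiffWithinAt
      filter_upwards [hC.isClosed.isOpen_compl.mem_nhds h] with z hz using hg0 j z hz
  have h1 := integral_divergence_halfSpace hg hC hg0
  have h2 : ∫ y in U, ∑ j, pd j (f j) y = ∫ y in halfSpace, ∑ j, pd j (g j) y := by
    rw [setIntegral_congr_fun (g := fun y => ∑ j, pd j (g j) y) hU.measurableSet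
      fun y hy => Finset.sum_congr rfl fun j _ => (hU.pd_congr (hgf j) hy j).symm]
    refine (setIntegral_eq_of_subset_of_forall_sdiff_eq_zero isClosed_halfSpace.measurableSet
      hU.subset fun y hy => Finset.sum_eq_zero fun j _ => ?_).symm
    have hV := relOpen_halfSpace.inter_isOpen hC.isClosed.isOpen_compl
    have hyV : y ∈ halfSpace ∩ Cᶜ := ⟨hy.1, fun h => hy.2 (hCU h)⟩
    rw [hV.pd_congr (fun z hz => hg0 j z hz.2) hyV, pd_const hV hyV]
  have h3 : ∫ z in bdryPoint ⁻¹' U, f 0 (bdryPoint z) = ∫ z, g 0 (bdryPoint z) := by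
    rw [setIntegral_congr_fun (g := fun z => g 0 (bdryPoint z))
      (continuous_bdryPoint.measurable hU.measurableSet) fun z hz => (hgf 0 _ hz).symm]
    exact setIntegral_eq_integral_of_forall_compl_eq_zero fun z hz => hg0 _ _ fun h => hz (hCU h)
  rw [h2, h1, h3]

section

variable {m : ℕ} {F : Coord → Amb m} {U : Set Coord} {y : Coord}

namespace Imm
variable (hF : Imm F U)
include hF

lemma grad_add {X Y : Coord → Amb m} (hX : ContDiffOn ℝ ∞ X U) (hY : ContDiffOn ℝ ∞ Y U)
    (hy : y ∈ U) (i : Fin 4) : grad F (X + Y) i y = grad F X i y + grad F Y i y := by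
  simp only [grad, ← Finset.sum_add_distrib, ← smul_add]
  exact Finset.sum_congr rfl fun j _ => congrArg _ (hF.pd_add hX hY hy j)

lemma lapPerp_add {X Y : Coord → Amb m} (hX : ContDiffOn ℝ ∞ X U) (hY : ContDiffOn ℝ ∞ Y U)
    (hy : y ∈ U) : lapPerp F (X + Y) y = lapPerp F X y + lapPerp F Y y := by
  have h1 : ∀ k, ∀ z ∈ U, normalPd F k (X + Y) z = normalPd F k X z + normalPd F k Y z :=
    fun k z hz => by
      simp only [normalPd, normalPart_eq]
      rw [← map_add]
      exact congrArg _ (hF.pd_add hX hY hz k)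
  simp only [lapPerp, normalPart_eq, ← Finset.sum_add_distrib, ← smul_add, ← map_add]
  refine Finset.sum_congr rfl fun i _ => Finset.sum_congr rfl fun j _ => ?_
  congr 2
  simp only [nablaLow, hF.pd_congr (h1 j) hy, h1 _ y hy,
    hF.pd_add (hF.normalPd_smooth hX _) (hF.normalPd_smooth hY _) hy, smul_add,
    Finset.sum_add_distrib]
  abel

lemma localFlux_add {b c : Coord → Amb m} (hb : ContDiffOn ℝ ∞ b U) (hc : ContDiffOn ℝ ∞ c U)
    (hy : y ∈ U) (j : Fin 4) : localFlux F (b + c) j y = localFlux F b j y + localFlux F c j y := by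
  have h1 : ∀ i, pd i (b + c) y = pd i b y + pd i c y := fun i => hF.pd_add hb hc hy i
  simp only [localFlux, hF.grad_add hb hc hy, hF.lapPerp_add hb hc hy, h1, Pi.add_apply,
    inner_add_left, inner_add_right, mul_add, add_mul, Finset.sum_add_distrib]
  ring

lemma localFlux_congr {b c : Coord → Amb m} (h : ∀ z ∈ U, b z = c z) (hy : y ∈ U) (j : Fin 4) :
    localFlux F b j y = localFlux F c j y := by
  have h1 : ∀ i, ∀ z ∈ U, pd i b z = pd i c z := fun i z hz => hF.pd_congr h hz i
  have h2 : ∀ i, ∀ z ∈ U, normalPd F i b z = normalPd F i c z := fun i z hz => by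
    rw [normalPd, normalPd, normalPart_eq, normalPart_eq, h1 i z hz]
  have h3 : lapPerp F b y = lapPerp F c y := by
    simp only [lapPerp, normalPart_eq]
    refine Finset.sum_congr rfl fun i _ => Finset.sum_congr rfl fun j _ => ?_
    congr 2
    simp only [nablaLow, hF.pd_congr (h2 j) hy, h2 _ y hy]
  have h4 : ∀ i, grad F b i y = grad F c i y := fun i => by simp only [grad, h1 _ y hy]
  simp only [localFlux, h3, h4, h y hy, h1 _ y hy]

lemma localFlux_zero (hy : y ∈ U) (j : Fin 4) : localFlux F 0 j y = 0 := by
  have := hF.localFlux_add (b := 0) (c := 0) contDiffOn_const contDiffOn_const hy j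
  rw [add_zero] at this
  linarith

/-- Stokes' theorem for the flux field of a compactly supported variation. -/
lemma integral_div_localFlux {b : Coord → Amb m} (hb : ContDiffOn ℝ ∞ b U) {C : Set Coord}
    (hC : IsCompact C) (hCU : C ⊆ U) (h0 : ∀ z ∈ U, z ∉ C → b z = 0) :
    ∫ y in U, volDensity F y * divUp F (localFlux F b) y
      = ∫ z in bdryPoint ⁻¹' U, bdryDensity F (bdryPoint z) *
        ∑ j, localFlux F b j (bdryPoint z) * conormal F j (bdryPoint z) := by
  have hs := fun j => hF.localFlux_smooth hb j
  rw [setIntegral_congr_fun hF.measurableSet fun y hy => hF.volDensity_mul_divUp hs hy,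
    setIntegral_congr_fun (continuous_bdryPoint.measurable hF.measurableSet) fun z hz =>
      (mul_comm _ _).trans (hF.flux_mul_bdryDensity hz _), integral_neg]
  refine hF.integral_divergence (fun j => hF.volDensity_smooth.mul (hs j)) hC hCU
    fun j z hz hzC => ?_
  have hU' := hF.inter_isOpen hC.isClosed.isOpen_compl
  have hF' : Imm F (U ∩ Cᶜ) := ⟨hU', hF.smooth.mono fun _ h => h.1, fun y hy => hF.det_pos y hy.1⟩
  rw [hF'.localFlux_congr (c := 0) (fun y hy => h0 y hy.1 hy.2) ⟨hz, hzC⟩,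
    hF'.localFlux_zero ⟨hz, hzC⟩, mul_zero]

end Imm
end

/-! ### Immersions of a manifold read in charts -/

section

variable {m : ℕ} {M : Type*} [TopologicalSpace M] [ChartedSpace (EuclideanHalfSpace 4) M]

/-- The preferred chart at `x`, with values in the half space. -/
abbrev chart (x : M) : PartialEquiv M Coord := extChartAt (𝓡∂ 4) x

/-- The change of coordinates from the preferred chart at `x'` to the one at `x`. -/
abbrev trans (x' x : M) : Coord → Coord := chart x ∘ (chart x').symm

/-- The image, in the preferred chart at `x'`, of its overlap with the one at `x`. -/
abbrev overlap (x' x : M) : Set Coord := ((chart x').symm.trans (chart x)).source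

lemma relOpen_target (x : M) : RelOpen (chart x).target where
  subset := by rw [halfSpace_eq_range]; exact extChartAt_target_subset_range x
  mem_nhdsWithin y hy := by
    rw [halfSpace_eq_range]; exact extChartAt_target_mem_nhdsWithin_of_mem hy

lemma isOpen_source (x : M) : IsOpen (chart x).source := isOpen_extChartAt_source x

lemma mem_source (x : M) : x ∈ (chart x).source := mem_extChartAt_source x

lemma mem_overlap {x' x : M} {y : Coord} :
    y ∈ overlap x' x ↔ y ∈ (chart x').target ∧ (chart x').symm y ∈ (chart x).source := by
  rw [overlap, PartialEquiv.trans_source]; rfl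

lemma chart_mem_overlap {x' x p : M} (h' : p ∈ (chart x').source) (h : p ∈ (chart x).source) :
    chart x' p ∈ overlap x' x :=
  mem_overlap.2 ⟨(chart x').map_source h', by rwa [(chart x').left_inv h']⟩

lemma trans_chart {x' x p : M} (h' : p ∈ (chart x').source) :
    trans x' x (chart x' p) = chart x p := by
  rw [trans, Function.comp_apply, (chart x').left_inv h']

lemma relOpen_overlap (x' x : M) : RelOpen (overlap x' x) := by
  have h := (relOpen_target x').inter_preimage (continuousOn_extChartAt_symm x') (isOpen_source x)
  convert h using 1
  ext y
  exact mem_overlap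

lemma trans_mapsTo (x' x : M) : Set.MapsTo (trans x' x) (overlap x' x) (overlap x x') :=
  fun y hy => by
  have h := mem_overlap.1 hy
  exact mem_overlap.2 ⟨(chart x).map_source h.2, by
    rw [trans, Function.comp_apply, (chart x).left_inv h.2]; exact (chart x').map_target h.1⟩

lemma trans_trans {x' x : M} {y : Coord} (hy : y ∈ overlap x' x) :
    trans x x' (trans x' x y) = y := by
  have h := mem_overlap.1 hy
  simp only [trans, Function.comp_apply]
  rw [(chart x).left_inv h.2, (chart x').right_inv h.1]

lemma symm_trans {x' x : M} {y : Coord} (hy : y ∈ overlap x' x) :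
    (chart x).symm (trans x' x y) = (chart x').symm y :=
  (chart x).left_inv (mem_overlap.1 hy).2

lemma read_eq (X : M → Amb m) {x' x : M} {y : Coord} (hy : y ∈ overlap x' x) :
    read X x' y = read X x (trans x' x y) := by
  rw [read, read, Function.comp_apply, Function.comp_apply, symm_trans hy]

section

variable [IsManifold (𝓡∂ 4) ∞ M]

lemma trans_smooth (x' x : M) : ContDiffOn ℝ ∞ (trans x' x) (overlap x' x) :=
  contDiffOn_ext_coord_change x x'

lemma det_jac_trans_ne_zero {x' x : M} {y : Coord} (hy : y ∈ overlap x' x) :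
    (jac (trans x' x) y).det ≠ 0 := by
  have hU := relOpen_overlap x' x
  have hV := relOpen_overlap x x'
  have hy' := trans_mapsTo x' x hy
  have h1 := (hV.hasFDerivWithinAt (trans_smooth x x') hy').mono hV.subset
  have h2 := (hU.hasFDerivWithinAt (trans_smooth x' x) hy).mono hU.subset
  have h3 := h1.comp y h2 (trans_mapsTo x' x)
  have h4 : HasFDerivWithinAt (trans x x' ∘ trans x' x) (ContinuousLinearMap.id ℝ Coord)
      (overlap x' x) y :=
    (hasFDerivWithinAt_id y _).congr (fun z hz => trans_trans hz) (trans_trans hy)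
  have h5 := (hU.uniqueDiffOn y hy).eq h3 h4
  have h6 : jac (trans x x') (trans x' x y) * jac (trans x' x) y = 1 := by
    ext a i
    have h7 := congrArg (fun L : Coord →L[ℝ] Coord => L (EuclideanSpace.single i 1) a) h5
    simp only [ContinuousLinearMap.comp_apply, ContinuousLinearMap.id_apply,
      PiLp.single_apply] at h7
    rw [Matrix.one_apply, ← h7, Matrix.mul_apply]
    conv_rhs => rw [← (EuclideanSpace.basisFun (Fin 4) ℝ).sum_repr
      (fderivWithin ℝ (trans x' x) halfSpace y (EuclideanSpace.single i 1))]
    simp only [map_sum, map_smul, EuclideanSpace.basisFun_repr, EuclideanSpace.basisFun_apply,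
      WithLp.ofLp_sum, Finset.sum_apply, PiLp.smul_apply, smul_eq_mul]
    exact Finset.sum_congr rfl fun b _ => mul_comm _ _
  intro h0
  have := congrArg Matrix.det h6
  rw [Matrix.det_mul, h0, mul_zero, Matrix.det_one] at this
  exact zero_ne_one this

lemma read_smooth {X : M → Amb m} (hX : ContMDiff (𝓡∂ 4) 𝓘(ℝ, Amb m) ∞ X) (x : M) :
    ContDiffOn ℝ ∞ (read X x) (chart x).target :=
  contMDiffOn_iff_contDiffOn.1
    (hX.comp_contMDiffOn (contMDiffOn_extChartAt_symm x))

/-- Where the metric is nondegenerate, a smooth map is an immersion. -/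
lemma imm_immJets {F : Coord → Amb m} {U : Set Coord} (hU : RelOpen U) (hF : ContDiffOn ℝ ∞ F U) :
    Imm F (U ∩ jet F ⁻¹' immJets m) where
  toRelOpen := hU.inter_preimage (hU.jet_smooth hF).continuousOn isOpen_immJets
  smooth := hF.mono Set.inter_subset_left
  det_pos _ h := h.2

/-- The change of charts for a smooth map that need not be an immersion, over the set where it is
one. It shows that being immersive at a point does not depend on the chart. -/
lemma transition_immJets {X : M → Amb m} (hX : ContMDiff (𝓡∂ 4) 𝓘(ℝ, Amb m) ∞ X) (x' x : M) :
    Transition (read X x') (read X x) (trans x' x)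
      (overlap x' x ∩ trans x' x ⁻¹' ((chart x).target ∩ jet (read X x) ⁻¹' immJets m))
      ((chart x).target ∩ jet (read X x) ⁻¹' immJets m) where
  relOpen := by
    have hU := relOpen_overlap x' x
    have hm : Set.MapsTo (trans x' x) (overlap x' x) (chart x).target := fun y hy =>
      (mem_overlap.1 (trans_mapsTo x' x hy)).1
    have hc : ContinuousOn (fun y => jet (read X x) (trans x' x y)) (overlap x' x) :=
      ((relOpen_target x).jet_smooth (read_smooth hX x)).continuousOn.comp
        (trans_smooth x' x).continuousOn hm
    convert hU.inter_preimage hc isOpen_immJets using 1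
    ext y
    exact ⟨fun h => ⟨h.1, h.2.2⟩, fun h => ⟨h.1, hm h.1, h.2⟩⟩
  imm := imm_immJets (relOpen_target x) (read_smooth hX x)
  smooth := (trans_smooth x' x).mono Set.inter_subset_left
  mapsTo := fun _ h => h.2
  eq := fun _ h => read_eq X h.1
  det_ne := fun _ h => det_jac_trans_ne_zero h.1

/-- `X` is immersive at `p`. -/
def ImmAt (X : M → Amb m) (p : M) : Prop := jet (read X p) (pt p) ∈ immJets m

lemma immJets_of_immJets {X : M → Amb m} (hX : ContMDiff (𝓡∂ 4) 𝓘(ℝ, Amb m) ∞ X) {x' x p : M}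
    (h' : p ∈ (chart x').source) (h : p ∈ (chart x).source)
    (hp : jet (read X x) (chart x p) ∈ immJets m) : jet (read X x') (chart x' p) ∈ immJets m := by
  refine (transition_immJets hX x' x).imm'.jet_mem ⟨chart_mem_overlap h' h, ?_⟩
  rw [Set.mem_preimage, trans_chart h']
  exact ⟨(chart x).map_source h, hp⟩

lemma immAt_iff {X : M → Amb m} (hX : ContMDiff (𝓡∂ 4) 𝓘(ℝ, Amb m) ∞ X) {x p : M}
    (h : p ∈ (chart x).source) : ImmAt X p ↔ jet (read X x) (chart x p) ∈ immJets m :=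
  ⟨fun hp => immJets_of_immJets hX h (mem_source p) hp,
    fun hp => immJets_of_immJets hX (mem_source p) h hp⟩

/-- `Φ` is a smooth immersion. -/
structure IsImm (Φ : M → Amb m) : Prop where
  smooth : ContMDiff (𝓡∂ 4) 𝓘(ℝ, Amb m) ∞ Φ
  immAt : ∀ p, ImmAt Φ p

lemma IsImm.imm {Φ : M → Amb m} (hΦ : IsImm Φ) (x : M) : Imm (read Φ x) (chart x).target where
  toRelOpen := relOpen_target x
  smooth := read_smooth hΦ.smooth x
  det_pos y hy := by
    have h := (immAt_iff hΦ.smooth ((chart x).map_target hy)).1 (hΦ.immAt ((chart x).symm y))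
    rwa [(chart x).right_inv hy] at h

lemma IsImm.transition {Φ : M → Amb m} (hΦ : IsImm Φ) (x' x : M) :
    Transition (read Φ x') (read Φ x) (trans x' x) (overlap x' x) (chart x).target where
  relOpen := relOpen_overlap x' x
  imm := hΦ.imm x
  smooth := trans_smooth x' x
  mapsTo := fun _ hy => (mem_overlap.1 (trans_mapsTo x' x hy)).1
  eq := fun _ h => read_eq Φ h
  det_ne := fun _ h => det_jac_trans_ne_zero h

omit [IsManifold (𝓡∂ 4) ∞ M] in
lemma mfderiv_eq {X : M → Amb m} (hX : ContMDiff (𝓡∂ 4) 𝓘(ℝ, Amb m) ∞ X) (p : M) :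
    mfderiv (𝓡∂ 4) 𝓘(ℝ, Amb m) X p = fderivWithin ℝ (read X p) halfSpace (pt p) := by
  have h : MDifferentiableAt (𝓡∂ 4) 𝓘(ℝ, Amb m) X p := (hX p).mdifferentiableAt (by simp)
  rw [halfSpace_eq_range]
  exact h.mfderiv

omit [IsManifold (𝓡∂ 4) ∞ M] in
/-- An injective derivative makes the Gram matrix of the coordinate frame positive definite. -/
lemma isImm_of_mfderiv {Φ : M → Amb m} (hΦ : ContMDiff (𝓡∂ 4) 𝓘(ℝ, Amb m) ∞ Φ)
    (himm : ∀ p : M, Function.Injective (mfderiv (𝓡∂ 4) 𝓘(ℝ, Amb m) Φ p)) : IsImm Φ where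
  smooth := hΦ
  immAt p := by
    have h0 : Function.Injective (fderivWithin ℝ (read Φ p) halfSpace (pt p)) := by
      rw [← mfderiv_eq hΦ p]; exact himm p
    have h1 : LinearIndependent ℝ fun i => pd i (read Φ p) (pt p) := by
      have h2 := (EuclideanSpace.basisFun (Fin 4) ℝ).toBasis.linearIndependent.map'
        (fderivWithin ℝ (read Φ p) halfSpace (pt p)).toLinearMap (LinearMap.ker_eq_bot.2 h0)
      have e : (fun i => pd i (read Φ p) (pt p))
          = fderivWithin ℝ (read Φ p) halfSpace (pt p) ∘ EuclideanSpace.basisFun (Fin 4) ℝ :=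
        funext fun i => by rw [Function.comp_apply, EuclideanSpace.basisFun_apply]; rfl
      rw [e]
      exact h2
    exact (Matrix.posDef_gram_of_linearIndependent h1).det_pos

/-- `B` is a smooth field that is normal to the immersion `Φ`. -/
structure IsNormalField (Φ B : M → Amb m) : Prop where
  smooth : ContMDiff (𝓡∂ 4) 𝓘(ℝ, Amb m) ∞ B
  normal : ∀ x, ∀ y ∈ (chart x).target, ∀ k, ⟪read B x y, pd k (read Φ x) y⟫_ℝ = 0

lemma IsImm.isNormalField {Φ B : M → Amb m} (hΦ : IsImm Φ)
    (hB : ContMDiff (𝓡∂ 4) 𝓘(ℝ, Amb m) ∞ B)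
    (hn : ∀ (p : M) (v : TangentSpace (𝓡∂ 4) p),
      ⟪B p, (mfderiv (𝓡∂ 4) 𝓘(ℝ, Amb m) Φ p v : Amb m)⟫_ℝ = 0) : IsNormalField Φ B where
  smooth := hB
  normal x y hy k := by
    have hp := (chart x).map_target hy
    have hyo : y ∈ overlap x ((chart x).symm y) := mem_overlap.2 ⟨hy, mem_source _⟩
    have h : pd k (read Φ x) y = _ := (hΦ.transition x ((chart x).symm y)).frame hyo k
    rw [h, inner_sum]
    refine Finset.sum_eq_zero fun a _ => ?_
    have h2 := hn ((chart x).symm y) (EuclideanSpace.single a (1 : ℝ) : Coord)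
    rw [mfderiv_eq hΦ.smooth] at h2
    rw [inner_smul_right]
    exact mul_eq_zero_of_right _ h2

/-- Whether a point lies on the boundary can be read off in any chart. -/
lemma pt_zero_eq_zero_iff {Φ : M → Amb m} (hΦ : IsImm Φ) {x p : M} (h : p ∈ (chart x).source) :
    pt p 0 = 0 ↔ chart x p 0 = 0 := by
  have h1 : 0 ≤ pt p 0 := (relOpen_target p).subset (mem_extChartAt_target p)
  have h2 : 0 ≤ chart x p 0 := (relOpen_target x).subset ((chart x).map_source h)
  have h3 := (hΦ.transition p x).interior (chart_mem_overlap (mem_source p) h)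
  have h4 := (hΦ.transition x p).interior (chart_mem_overlap h (mem_source p))
  rw [trans_chart (mem_source p)] at h3
  rw [trans_chart h] at h4
  constructor
  · intro h0
    exact le_antisymm (not_lt.1 fun h5 => (h4 h5).ne' h0) h2
  · intro h0
    exact le_antisymm (not_lt.1 fun h5 => (h3 h5).ne' h0) h1

end

end

/-! ### Gluing measures -/

/-- The supremum of a family of measures that agree on overlaps restricts to the given measures. -/
lemma iSup_measure_apply {ι M : Type*} [TopologicalSpace M] [SecondCountableTopology M]
    [MeasurableSpace M] [BorelSpace M] {μ : ι → Measure M} {S : ι → Set M}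
    (hS : ∀ i, IsOpen (S i)) (hcov : ⋃ i, S i = Set.univ) (h0 : ∀ i, μ i (S i)ᶜ = 0)
    (hc : ∀ i j A, MeasurableSet A → A ⊆ S i → A ⊆ S j → μ i A = μ j A) (i : ι) {A : Set M}
    (hA : MeasurableSet A) (hAi : A ⊆ S i) : (⨆ j, μ j) A = μ i A := by
  refine le_antisymm ?_ (Measure.le_iff'.1 (le_iSup μ i) A)
  obtain ⟨T, hT, hTc⟩ := TopologicalSpace.isOpen_iUnion_countable S hS
  obtain ⟨f, hf⟩ := (hT.insert i).exists_eq_range ⟨i, Set.mem_insert _ _⟩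
  have hfc : ⋃ n, S (f n) = Set.univ := by
    refine Set.eq_univ_of_univ_subset ?_
    rw [← hcov, ← hTc]
    refine Set.iUnion₂_subset fun j hj => ?_
    obtain ⟨n, rfl⟩ : j ∈ Set.range f := hf ▸ Set.mem_insert_of_mem i hj
    exact Set.subset_iUnion (fun n => S (f n)) n
  -- a measure built from a partition into pieces of countably many of the sets
  let D : ℕ → Set M := disjointed fun n => S (f n)
  have hDm : ∀ n, MeasurableSet (D n) :=
    MeasurableSet.disjointed fun n => (hS (f n)).measurableSet
  have hDS : ∀ n, D n ⊆ S (f n) := fun n => disjointed_subset _ n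
  have hDu : ∀ A : Set M, A = ⋃ n, A ∩ D n := fun A => by
    rw [← Set.inter_iUnion, iUnion_disjointed, hfc, Set.inter_univ]
  have hDd : ∀ A : Set M, Pairwise (Function.onFun Disjoint fun n => A ∩ D n) := fun A a b hab =>
    (disjoint_disjointed _ hab).mono Set.inter_subset_right Set.inter_subset_right
  have hsum : ∀ (ν : Measure M) {A : Set M}, MeasurableSet A → ν A = ∑' n, ν (A ∩ D n) :=
    fun ν A hA => by
      conv_lhs => rw [hDu A]
      exact measure_iUnion (hDd A) fun n => hA.inter (hDm n)
  have hle : ⨆ j, μ j ≤ Measure.sum fun n => (μ (f n)).restrict (D n) := by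
    refine iSup_le fun j => Measure.le_iff.2 fun A hA => ?_
    rw [hsum (μ j) hA, Measure.sum_apply _ hA]
    refine ENNReal.tsum_le_tsum fun n => ?_
    have h1 : μ j (A ∩ D n) = μ j (A ∩ D n ∩ S j) :=
      (measure_inter_conull (h0 j)).symm
    rw [h1, hc j (f n) _ ((hA.inter (hDm n)).inter (hS j).measurableSet) Set.inter_subset_right
      (Set.inter_subset_left.trans (Set.inter_subset_right.trans (hDS n))),
      Measure.restrict_apply hA]
    exact measure_mono Set.inter_subset_left
  refine (Measure.le_iff.1 hle A hA).trans_eq ?_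
  rw [hsum (μ i) hA, Measure.sum_apply _ hA]
  refine tsum_congr fun n => ?_
  rw [Measure.restrict_apply hA]
  exact hc _ _ _ (hA.inter (hDm n)) (Set.inter_subset_right.trans (hDS n))
    (Set.inter_subset_left.trans hAi)

section Patch

variable {X M : Type*} [TopologicalSpace X] [MeasurableSpace X] [BorelSpace X]
  [TopologicalSpace M] [MeasurableSpace M] [BorelSpace M]

/-- The image under a parametrisation `φ` of `T` of the measure with density `d`. -/
abbrev patch (ν : Measure X) (T : Set X) (φ : X → M) (d : X → ℝ) : Measure M :=
  ((ν.restrict T).withDensity fun z => ENNReal.ofReal (d z)).map φ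

variable {ν : Measure X} {T : Set X} {φ : X → M} {d : X → ℝ} (hT : MeasurableSet T)
  (hφ : ContinuousOn φ T)
include hT hφ

lemma measurableSet_inter_preimage {A : Set M} (hA : MeasurableSet A) :
    MeasurableSet (φ ⁻¹' A ∩ T) := by
  have h : Measurable (T.domRestrict φ) := (continuousOn_iff_continuous_domRestrict.1 hφ).measurable
  have h2 := hT.subtype_image (h hA)
  convert h2 using 1
  ext z
  simp [and_comm]

lemma aemeasurable_patch :
    AEMeasurable φ ((ν.restrict T).withDensity fun z => ENNReal.ofReal (d z)) :=
  (hφ.aemeasurable hT).mono_ac (withDensity_absolutelyContinuous _ _)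

lemma patch_apply {A : Set M} (hA : MeasurableSet A) :
    patch ν T φ d A = ∫⁻ z in φ ⁻¹' A ∩ T, ENNReal.ofReal (d z) ∂ν := by
  have h := (hφ.aemeasurable (μ := ν) hT).nullMeasurableSet_preimage hA
  rw [patch, Measure.map_apply_of_aemeasurable (aemeasurable_patch hT hφ) hA,
    withDensity_apply₀ _ h, Measure.restrict_restrict₀ h]

/-- Integrals over the image are integrals over the parameter domain. -/
lemma setIntegral_patch [SFinite ν] (hd : ContinuousOn d T) (hd0 : ∀ z ∈ T, 0 ≤ d z) {A : Set M}
    (hA : MeasurableSet A) {f : M → ℝ} (hf : ContinuousOn f A) :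
    ∫ p in A, f p ∂(patch ν T φ d) = ∫ z in φ ⁻¹' A ∩ T, d z * f (φ z) ∂ν := by
  have h := (hφ.aemeasurable (μ := ν) hT).nullMeasurableSet_preimage hA
  have ha := aemeasurable_patch (ν := ν) (d := d) hT hφ
  have hf' := hf.aestronglyMeasurable (μ := patch ν T φ d) hA
  rw [patch, Measure.restrict_map_of_aemeasurable ha hA] at hf' ⊢
  rw [integral_map (ha.mono_measure Measure.restrict_le_self) hf',
    setIntegral_withDensity_eq_setIntegral_toReal_smul₀', Measure.restrict_restrict₀ h]
  · refine setIntegral_congr_fun (measurableSet_inter_preimage hT hφ hA) fun z hz => ?_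
    simp only [smul_eq_mul, ENNReal.toReal_ofReal (hd0 z hz.2)]
  · exact ((hd.aemeasurable hT).mono_measure Measure.restrict_le_self).ennreal_ofReal
  · exact ae_of_all _ fun z => ENNReal.ofReal_lt_top

lemma patch_lt_top [IsFiniteMeasureOnCompacts ν] (hd : ContinuousOn d T) {A : Set M}
    (hA : MeasurableSet A) {C : Set X} (hC : IsCompact C) (hCT : C ⊆ T) (hAC : φ ⁻¹' A ∩ T ⊆ C) :
    patch ν T φ d A < ⊤ := by
  rw [patch_apply hT hφ hA]
  obtain ⟨K, hK⟩ := (hC.image_of_continuousOn (hd.mono hCT)).isBounded.bddAbove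
  refine lt_of_le_of_lt (setLIntegral_mono' (measurableSet_inter_preimage hT hφ hA)
    fun z hz => ENNReal.ofReal_le_ofReal (hK ⟨z, hAC hz, rfl⟩)) ?_
  rw [setLIntegral_const]
  exact ENNReal.mul_lt_top ENNReal.ofReal_lt_top ((measure_mono hAC).trans_lt hC.measure_lt_top)

end Patch

/-! ### The volume measures of an immersed manifold and of its boundary -/

lemma det_fderivWithin_eq (L : Coord →L[ℝ] Coord) :
    L.det = (Matrix.of fun a i => L (EuclideanSpace.single i 1) a).det := by
  rw [ContinuousLinearMap.det,
    ← LinearMap.det_toMatrix (EuclideanSpace.basisFun (Fin 4) ℝ).toBasis]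
  congr 1

/-- The last three coordinates. -/
def tailL : Coord →L[ℝ] EuclideanSpace ℝ (Fin 3) :=
  (PiLp.continuousLinearEquiv 2 ℝ fun _ : Fin 3 => ℝ).symm.toContinuousLinearMap.comp
    (ContinuousLinearMap.pi fun i => EuclideanSpace.proj i.succ)

lemma tailL_apply (y : Coord) (i : Fin 3) : tailL y i = y i.succ := rfl

/-- The linear map `bdryPoint`. -/
def bdryL : EuclideanSpace ℝ (Fin 3) →L[ℝ] Coord where
  toFun := bdryPoint
  map_add' z w := by
    ext i
    exact Fin.cases (by simp [bdryPoint_zero]) (fun j => by simp [bdryPoint_succ]) i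
  map_smul' c z := by
    ext i
    exact Fin.cases (by simp [bdryPoint_zero]) (fun j => by simp [bdryPoint_succ]) i
  cont := continuous_bdryPoint

lemma bdryPoint_tailL {y : Coord} (hy : y 0 = 0) : bdryPoint (tailL y) = y := by
  ext i
  exact Fin.cases (by rw [bdryPoint_zero, hy]) (fun j => by rw [bdryPoint_succ, tailL_apply]) i

lemma tailL_bdryPoint (z : EuclideanSpace ℝ (Fin 3)) : tailL (bdryPoint z) = z := by
  ext i
  rw [tailL_apply, bdryPoint_succ]

lemma isometry_bdryPoint : Isometry bdryPoint :=
  AddMonoidHomClass.isometry_of_norm bdryL fun z => by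
    change ‖bdryPoint z‖ = _
    rw [EuclideanSpace.norm_eq, EuclideanSpace.norm_eq, Fin.sum_univ_succ]
    simp [bdryPoint_zero, bdryPoint_succ]

/-- In the coordinates of the boundary, a linear map becomes the lower right block of its matrix. -/
lemma det_bdry (L : Coord →L[ℝ] Coord) : (tailL.comp (L.comp bdryL)).det
    = ((Matrix.of fun a i => L (EuclideanSpace.single i 1) a).submatrix Fin.succ Fin.succ).det := by
  rw [ContinuousLinearMap.det,
    ← LinearMap.det_toMatrix (EuclideanSpace.basisFun (Fin 3) ℝ).toBasis]
  congr 1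
  ext a i
  have h : bdryL (EuclideanSpace.single i 1) = EuclideanSpace.single i.succ 1 := by
    ext j
    change bdryPoint _ j = _
    refine Fin.cases ?_ (fun k => ?_) j
    · rw [bdryPoint_zero, PiLp.single_apply, if_neg (Fin.succ_ne_zero i).symm]
    · rw [bdryPoint_succ, PiLp.single_apply, PiLp.single_apply]
      simp
  simp [LinearMap.toMatrix_apply, h, tailL_apply]

section

variable {m : ℕ} {M : Type*} [TopologicalSpace M] [ChartedSpace (EuclideanHalfSpace 4) M]

/-- The image of the boundary in the preferred chart at `x`, in the coordinates `y 1, y 2, y 3`. -/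
abbrev bdryTarget (x : M) : Set (EuclideanSpace ℝ (Fin 3)) := bdryPoint ⁻¹' (chart x).target

/-- The parametrisation of the boundary given by the preferred chart at `x`. -/
abbrev bdryParam (x : M) : EuclideanSpace ℝ (Fin 3) → M := fun z => (chart x).symm (bdryPoint z)

lemma measurableSet_bdryTarget (x : M) : MeasurableSet (bdryTarget x) :=
  continuous_bdryPoint.measurable (relOpen_target x).measurableSet

lemma continuousOn_bdryParam (x : M) : ContinuousOn (bdryParam x) (bdryTarget x) :=
  (continuousOn_extChartAt_symm x).comp continuous_bdryPoint.continuousOn fun _ h => h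

/-- The boundary of `M`. -/
def bdry (M : Type*) [TopologicalSpace M] [ChartedSpace (EuclideanHalfSpace 4) M] : Set M :=
  {p | pt p 0 = 0}

lemma exists_compact_chart (p : M) : ∃ C : Set Coord, IsCompact C ∧ C ⊆ (chart p).target ∧
    ∃ N : Set M, IsOpen N ∧ p ∈ N ∧ ∀ q ∈ N, q ∈ (chart p).source ∧ chart p q ∈ C := by
  obtain ⟨O, hO, hT⟩ := (relOpen_target p).exists_isOpen
  have hp : pt p ∈ (chart p).target := mem_extChartAt_target p
  obtain ⟨r, hr, hrO⟩ := Metric.nhds_basis_closedBall.mem_iff.1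
    (hO.mem_nhds (show pt p ∈ O from (hT ▸ hp : pt p ∈ halfSpace ∩ O).2))
  refine ⟨halfSpace ∩ Metric.closedBall (pt p) r,
    (isCompact_closedBall _ _).inter_left isClosed_halfSpace, ?_,
    (chart p).source ∩ chart p ⁻¹' Metric.ball (pt p) r,
    (continuousOn_extChartAt p).isOpen_inter_preimage (isOpen_source p) Metric.isOpen_ball,
    ⟨mem_source p, Metric.mem_ball_self hr⟩,
    fun q hq => ⟨hq.1, ?_, Metric.ball_subset_closedBall hq.2⟩⟩
  · rw [hT]
    exact Set.inter_subset_inter_right _ hrO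
  · exact (relOpen_target p).subset ((chart p).map_source hq.1)

lemma iUnion_source : ⋃ x : M, (chart x).source = Set.univ :=
  Set.eq_univ_of_forall fun x => Set.mem_iUnion.2 ⟨x, mem_source x⟩

/-- By second countability, null sets may be recognised chart by chart. -/
lemma measure_eq_zero_of_source [SecondCountableTopology M] [MeasurableSpace M]
    {μ : Measure M} {A : Set M} (h : ∀ x : M, μ (A ∩ (chart x).source) = 0) : μ A = 0 := by
  obtain ⟨T, hT, hTc⟩ := TopologicalSpace.isOpen_iUnion_countable _ (isOpen_source (M := M))
  have : A = ⋃ x ∈ T, A ∩ (chart x).source := by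
    rw [← Set.inter_iUnion₂, hTc, iUnion_source, Set.inter_univ]
  rw [this]
  exact (measure_biUnion_null_iff hT).2 fun x _ => h x

section
variable [MeasurableSpace M] [BorelSpace M] {Φ : M → Amb m}

lemma chartVolume_apply (x : M) {A : Set M} (hA : MeasurableSet A) : chartVolume Φ x A
    = ∫⁻ y in (chart x).symm ⁻¹' A ∩ (chart x).target, ENNReal.ofReal (volDensity (read Φ x) y) :=
  patch_apply (relOpen_target x).measurableSet (continuousOn_extChartAt_symm x) hA

lemma chartBdryVolume_apply (x : M) {A : Set M} (hA : MeasurableSet A) : chartBdryVolume Φ x A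
    = ∫⁻ z in bdryParam x ⁻¹' A ∩ bdryTarget x,
        ENNReal.ofReal (bdryDensity (read Φ x) (bdryPoint z)) :=
  patch_apply (measurableSet_bdryTarget x) (continuousOn_bdryParam x) hA

lemma chartVolume_compl (x : M) : chartVolume Φ x (chart x).sourceᶜ = 0 := by
  rw [chartVolume_apply x (isOpen_source x).measurableSet.compl]
  have : (chart x).symm ⁻¹' (chart x).sourceᶜ ∩ (chart x).target = ∅ :=
    Set.eq_empty_of_forall_notMem fun y hy => hy.1 ((chart x).map_target hy.2)
  rw [this, setLIntegral_empty]

lemma chartBdryVolume_compl (x : M) : chartBdryVolume Φ x (chart x).sourceᶜ = 0 := by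
  rw [chartBdryVolume_apply x (isOpen_source x).measurableSet.compl]
  have : bdryParam x ⁻¹' (chart x).sourceᶜ ∩ bdryTarget x = ∅ :=
    Set.eq_empty_of_forall_notMem fun y hy => hy.1 ((chart x).map_target hy.2)
  rw [this, setLIntegral_empty]

lemma isFiniteMeasureOnCompacts_of_chart {μ : Measure M}
    (h : ∀ p : M, ∀ C ⊆ (chart p).target, IsCompact C → ∀ N ⊆ (chart p).source, MeasurableSet N →
      (∀ q ∈ N, chart p q ∈ C) → μ N < ⊤) : IsFiniteMeasureOnCompacts μ := by
  have : IsLocallyFiniteMeasure μ := ⟨fun p => by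
    obtain ⟨C, hC, hCT, N, hN, hp, hq⟩ := exists_compact_chart p
    exact ⟨N, hN.mem_nhds hp, h p C hCT hC N (fun q hqN => (hq q hqN).1) hN.measurableSet
      fun q hqN => (hq q hqN).2⟩⟩
  infer_instance

end

variable [IsManifold (𝓡∂ 4) ∞ M] {Φ : M → Amb m} (hΦ : IsImm Φ)
include hΦ

lemma isClosed_bdry : IsClosed (bdry M) := by
  rw [← isOpen_compl_iff, isOpen_iff_mem_nhds]
  intro p hp
  have hc : ContinuousAt (fun q => chart p q 0) p :=
    ((EuclideanSpace.proj (𝕜 := ℝ) (0 : Fin 4)).continuous.continuousAt).comp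
      (continuousAt_extChartAt p)
  filter_upwards [(isOpen_source p).mem_nhds (mem_source p), hc.eventually_ne hp] with q hq hq0
  exact fun h => hq0 ((pt_zero_eq_zero_iff hΦ hq).1 h)

/-- Changes of coordinates map boundary points to boundary points. -/
lemma trans_zero {x' x : M} {y : Coord} (hy : y ∈ overlap x' x) (h0 : y 0 = 0) :
    trans x' x y 0 = 0 := by
  have h := (hΦ.transition x x').interior (trans_mapsTo x' x hy)
  rw [trans_trans hy, h0] at h
  exact le_antisymm (not_lt.1 fun h' => (h h').ne rfl)
    ((relOpen_overlap x x').subset (trans_mapsTo x' x hy))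

variable [MeasurableSpace M] [BorelSpace M]

/-- The volume measures computed in two charts agree on the overlap, by the change of variables
formula. -/
lemma chartVolume_compat (x' x : M) {A : Set M} (hA : MeasurableSet A) (h' : A ⊆ (chart x').source)
    (h : A ⊆ (chart x).source) : chartVolume Φ x' A = chartVolume Φ x A := by
  rw [chartVolume_apply x' hA, chartVolume_apply x hA]
  have T := hΦ.transition x' x
  have hsub : (chart x').symm ⁻¹' A ∩ (chart x').target ⊆ overlap x' x :=
    fun y hy => mem_overlap.2 ⟨hy.2, h hy.1⟩
  have hm := measurableSet_inter_preimage (relOpen_target x').measurableSet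
    (continuousOn_extChartAt_symm x') hA
  have himg : trans x' x '' ((chart x').symm ⁻¹' A ∩ (chart x').target)
      = (chart x).symm ⁻¹' A ∩ (chart x).target := by
    ext y
    constructor
    · rintro ⟨w, hw, rfl⟩
      refine ⟨?_, T.mapsTo (hsub hw)⟩
      rw [Set.mem_preimage, symm_trans (hsub hw)]
      exact hw.1
    · intro hy
      have hyo : y ∈ overlap x x' := mem_overlap.2 ⟨hy.2, h' hy.1⟩
      refine ⟨trans x x' y, ⟨?_, (mem_overlap.1 (trans_mapsTo x x' hyo)).1⟩, trans_trans hyo⟩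
      rw [Set.mem_preimage, symm_trans hyo]
      exact hy.1
  have hinj : Set.InjOn (trans x' x) ((chart x').symm ⁻¹' A ∩ (chart x').target) :=
    fun y hy w hw hyw => by
      rw [← trans_trans (hsub hy), hyw, trans_trans (hsub hw)]
  rw [← himg, lintegral_image_eq_lintegral_abs_det_fderiv_mul volume hm (fun y hy =>
    (T.relOpen.hasFDerivWithinAt T.smooth (hsub hy)).mono fun w hw => T.relOpen.subset (hsub hw))
    hinj]
  refine setLIntegral_congr_fun hm fun y hy => ?_
  rw [T.volDensity_eq (hsub hy), ENNReal.ofReal_mul (abs_nonneg _), det_fderivWithin_eq]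
  rfl

/-- The boundary measures computed in two charts agree on the overlap, by the change of variables
formula in the boundary coordinates. -/
lemma chartBdryVolume_compat (x' x : M) {A : Set M} (hA : MeasurableSet A)
    (h' : A ⊆ (chart x').source) (h : A ⊆ (chart x).source) :
    chartBdryVolume Φ x' A = chartBdryVolume Φ x A := by
  rw [chartBdryVolume_apply x' hA, chartBdryVolume_apply x hA]
  have T := hΦ.transition x' x
  have hsub : ∀ z ∈ bdryParam x' ⁻¹' A ∩ bdryTarget x', bdryPoint z ∈ overlap x' x :=
    fun z hz => mem_overlap.2 ⟨hz.2, h hz.1⟩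
  have hm := measurableSet_inter_preimage (measurableSet_bdryTarget x')
    (continuousOn_bdryParam x') hA
  have hpt : ∀ z ∈ bdryParam x' ⁻¹' A ∩ bdryTarget x',
      bdryPoint (tailL (trans x' x (bdryPoint z))) = trans x' x (bdryPoint z) := fun z hz =>
    bdryPoint_tailL (trans_zero hΦ (hsub z hz) (bdryPoint_zero z))
  have himg : (fun z => tailL (trans x' x (bdryPoint z))) ''
      (bdryParam x' ⁻¹' A ∩ bdryTarget x') = bdryParam x ⁻¹' A ∩ bdryTarget x := by
    ext z
    constructor
    · rintro ⟨w, hw, rfl⟩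
      simp only [Set.mem_inter_iff, Set.mem_preimage, bdryParam]
      rw [hpt w hw, symm_trans (hsub w hw)]
      exact ⟨hw.1, T.mapsTo (hsub w hw)⟩
    · intro hz
      have hzo : bdryPoint z ∈ overlap x x' := mem_overlap.2 ⟨hz.2, h' hz.1⟩
      have hz' := bdryPoint_tailL (trans_zero hΦ hzo (bdryPoint_zero z))
      refine ⟨tailL (trans x x' (bdryPoint z)), ?_, ?_⟩
      · simp only [Set.mem_inter_iff, Set.mem_preimage, bdryParam]
        rw [hz', symm_trans hzo]
        exact ⟨hz.1, (mem_overlap.1 (trans_mapsTo x x' hzo)).1⟩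
      · simp only [hz']
        rw [trans_trans hzo, tailL_bdryPoint]
  have hinj : Set.InjOn (fun z => tailL (trans x' x (bdryPoint z)))
      (bdryParam x' ⁻¹' A ∩ bdryTarget x') := fun z hz w hw hzw => by
    have h1 := congrArg bdryPoint hzw
    simp only [hpt z hz, hpt w hw] at h1
    have h2 : bdryPoint z = bdryPoint w := by
      rw [← trans_trans (hsub z hz), h1, trans_trans (hsub w hw)]
    rw [← tailL_bdryPoint z, h2, tailL_bdryPoint]
  have hder : ∀ z ∈ bdryParam x' ⁻¹' A ∩ bdryTarget x',
      HasFDerivWithinAt (fun z => tailL (trans x' x (bdryPoint z)))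
        (tailL.comp ((fderivWithin ℝ (trans x' x) halfSpace (bdryPoint z)).comp bdryL))
        (bdryParam x' ⁻¹' A ∩ bdryTarget x') z := fun z hz =>
    tailL.hasFDerivAt.comp_hasFDerivWithinAt z
      ((T.relOpen.hasFDerivWithinAt T.smooth (hsub z hz)).comp z
        bdryL.hasFDerivAt.hasFDerivWithinAt fun w hw => T.relOpen.subset (hsub w hw))
  rw [← himg, lintegral_image_eq_lintegral_abs_det_fderiv_mul volume hm hder hinj]
  refine setLIntegral_congr_fun hm fun z hz => ?_
  simp only
  rw [hpt z hz, T.bdryDensity_eq (hsub z hz) (trans_zero hΦ (hsub z hz) (bdryPoint_zero z)),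
    ENNReal.ofReal_mul (abs_nonneg _), det_bdry]
  rfl

section
variable [SecondCountableTopology M]

lemma vol_apply (x : M) {A : Set M} (hA : MeasurableSet A) (h : A ⊆ (chart x).source) :
    vol Φ A = chartVolume Φ x A :=
  iSup_measure_apply isOpen_source (iUnion_source) (chartVolume_compl)
    (fun i j _ hA h h' => chartVolume_compat hΦ i j hA h h') x hA h

lemma bdryVol_apply (x : M) {A : Set M} (hA : MeasurableSet A) (h : A ⊆ (chart x).source) :
    bdryVol Φ A = chartBdryVolume Φ x A :=
  iSup_measure_apply isOpen_source (iUnion_source) (chartBdryVolume_compl)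
    (fun i j _ hA h h' => chartBdryVolume_compat hΦ i j hA h h') x hA h

lemma restrict_vol (x : M) {A : Set M} (hA : MeasurableSet A) (h : A ⊆ (chart x).source) :
    (vol Φ).restrict A = (chartVolume Φ x).restrict A := by
  ext B hB
  rw [Measure.restrict_apply hB, Measure.restrict_apply hB,
    vol_apply hΦ x (hB.inter hA) (Set.inter_subset_right.trans h)]

lemma restrict_bdryVol (x : M) {A : Set M} (hA : MeasurableSet A) (h : A ⊆ (chart x).source) :
    (bdryVol Φ).restrict A = (chartBdryVolume Φ x).restrict A := by
  ext B hB
  rw [Measure.restrict_apply hB, Measure.restrict_apply hB,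
    bdryVol_apply hΦ x (hB.inter hA) (Set.inter_subset_right.trans h)]

lemma setIntegral_vol (x : M) {A : Set M} (hA : MeasurableSet A) (h : A ⊆ (chart x).source)
    {f : M → ℝ} (hf : ContinuousOn f A) : ∫ p in A, f p ∂(vol Φ)
      = ∫ y in (chart x).symm ⁻¹' A ∩ (chart x).target,
          volDensity (read Φ x) y * f ((chart x).symm y) := by
  rw [restrict_vol hΦ x hA h]
  exact setIntegral_patch (relOpen_target x).measurableSet (continuousOn_extChartAt_symm x)
    (hΦ.imm x).volDensity_smooth.continuousOn (fun _ _ => Real.sqrt_nonneg _) hA hf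

lemma setIntegral_bdryVol (x : M) {A : Set M} (hA : MeasurableSet A) (h : A ⊆ (chart x).source)
    {f : M → ℝ} (hf : ContinuousOn f A) : ∫ p in A, f p ∂(bdryVol Φ)
      = ∫ z in bdryParam x ⁻¹' A ∩ bdryTarget x,
          bdryDensity (read Φ x) (bdryPoint z) * f (bdryParam x z) := by
  rw [restrict_bdryVol hΦ x hA h]
  exact setIntegral_patch (measurableSet_bdryTarget x) (continuousOn_bdryParam x)
    ((hΦ.imm x).bdryDensity_smooth.continuousOn.comp continuous_bdryPoint.continuousOn fun _ h => h)
    (fun _ _ => Real.sqrt_nonneg _) hA hf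

lemma isFiniteMeasureOnCompacts_vol : IsFiniteMeasureOnCompacts (vol Φ) := by
  refine isFiniteMeasureOnCompacts_of_chart fun p C hCT hC N hN hNm hNC => ?_
  rw [vol_apply hΦ p hNm hN]
  refine patch_lt_top (relOpen_target p).measurableSet (continuousOn_extChartAt_symm p)
    (hΦ.imm p).volDensity_smooth.continuousOn hNm hC hCT fun y hy => ?_
  have h := hNC _ hy.1
  rwa [(chart p).right_inv hy.2] at h

lemma isFiniteMeasureOnCompacts_bdryVol : IsFiniteMeasureOnCompacts (bdryVol Φ) := by
  refine isFiniteMeasureOnCompacts_of_chart fun p C hCT hC N hN hNm hNC => ?_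
  rw [bdryVol_apply hΦ p hNm hN]
  refine patch_lt_top (measurableSet_bdryTarget p) (continuousOn_bdryParam p)
    ((hΦ.imm p).bdryDensity_smooth.continuousOn.comp continuous_bdryPoint.continuousOn
      fun _ h => h) hNm (isometry_bdryPoint.isClosedEmbedding.isCompact_preimage hC)
    (Set.preimage_mono hCT) fun y hy => ?_
  have h := hNC _ hy.1
  rwa [(chart p).right_inv hy.2] at h

/-- The boundary measure is carried by the boundary. -/
lemma bdryVol_compl_bdry : bdryVol Φ (bdry M)ᶜ = 0 := by
  refine measure_eq_zero_of_source fun x => ?_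
  have hm := (isClosed_bdry hΦ).measurableSet.compl.inter (isOpen_source x).measurableSet
  rw [bdryVol_apply hΦ x hm Set.inter_subset_right, chartBdryVolume_apply x hm]
  have : bdryParam x ⁻¹' ((bdry M)ᶜ ∩ (chart x).source) ∩ bdryTarget x = ∅ := by
    refine Set.eq_empty_of_forall_notMem fun z hz => hz.1.1 ?_
    refine (pt_zero_eq_zero_iff hΦ hz.1.2).2 ?_
    rw [(chart x).right_inv hz.2, bdryPoint_zero]
  rw [this, setLIntegral_empty]

/-- The volume measures of two immersions that agree on an open set agree there. -/
lemma restrict_vol_congr {Ψ : M → Amb m} (hΨ : IsImm Ψ) {O : Set M} (hO : IsOpen O)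
    (h : ∀ p ∈ O, Φ p = Ψ p) : (vol Φ).restrict O = (vol Ψ).restrict O := by
  obtain ⟨T, hT, hTc⟩ := TopologicalSpace.isOpen_iUnion_countable _ (isOpen_source (M := M))
  have hO' : O = ⋃ x ∈ T, O ∩ (chart x).source := by
    rw [← Set.inter_iUnion₂, hTc, iUnion_source, Set.inter_univ]
  rw [hO', Measure.restrict_biUnion_congr hT]
  intro x _
  have hm := (hO.inter (isOpen_source x)).measurableSet
  ext B hB
  rw [Measure.restrict_apply hB, Measure.restrict_apply hB,
    vol_apply hΦ x (hB.inter hm) (Set.inter_subset_right.trans Set.inter_subset_right),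
    vol_apply hΨ x (hB.inter hm) (Set.inter_subset_right.trans Set.inter_subset_right),
    chartVolume_apply x (hB.inter hm), chartVolume_apply x (hB.inter hm)]
  refine setLIntegral_congr_fun (measurableSet_inter_preimage (relOpen_target x).measurableSet
    (continuousOn_extChartAt_symm x) (hB.inter hm)) fun y hy => ?_
  have hU := (relOpen_target x).inter_preimage (continuousOn_extChartAt_symm x) hO
  have h1 : metric (read Φ x) y = metric (read Ψ x) y := by
    ext i j
    have h2 : ∀ k, pd k (read Φ x) y = pd k (read Ψ x) y := fun k =>
      hU.pd_congr (fun z hz => h _ hz.2) ⟨hy.2, hy.1.2.1⟩ k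
    rw [metric_apply, metric_apply, h2, h2]
  simp only [volDensity, h1]

end
end

/-! ### Global fields and the divergence theorem on an immersed manifold -/

section

variable {m : ℕ}

lemma Imm.mono {F : Coord → Amb m} {U V : Set Coord} (hF : Imm F U) (hV : RelOpen V) (h : V ⊆ U) :
    Imm F V := ⟨hV, hF.smooth.mono h, fun y hy => hF.det_pos y (h hy)⟩

variable {M : Type*} [TopologicalSpace M] [ChartedSpace (EuclideanHalfSpace 4) M]

/-- The divergence of the flux field of the variation `B`. -/
def divFlux (Φ B : M → Amb m) (p : M) : ℝ :=
  divUp (read Φ p) (localFlux (read Φ p) (read B p)) (pt p)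

/-- A function that reads as a continuous function in every chart is continuous. The global fields
are defined at each point through the preferred chart there, so that this needs their invariance. -/
lemma continuousOn_of_chart {f : M → ℝ} {A : Set M} (g : M → Coord → ℝ)
    (hg : ∀ x, ContinuousOn (g x) (chart x).target)
    (h : ∀ x, ∀ p ∈ (chart x).source, p ∈ A → f p = g x (chart x p)) : ContinuousOn f A := by
  intro p hp
  have h1 : ContinuousOn (fun q => g p (chart p q)) (chart p).source :=
    (hg p).comp (continuousOn_extChartAt p) fun q hq => (chart p).map_source hq
  have h2 := ((h1 p (mem_source p)).continuousAt
    ((isOpen_source p).mem_nhds (mem_source p))).continuousWithinAt (s := A)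
  refine h2.congr_of_eventuallyEq ?_ (h p p (mem_source p) hp)
  filter_upwards [self_mem_nhdsWithin,
    mem_nhdsWithin_of_mem_nhds ((isOpen_source p).mem_nhds (mem_source p))] with q hq hq'
  exact h p q hq' hq

lemma relOpen_inter {x : M} {O : Set M} (hO : IsOpen O) :
    RelOpen ((chart x).target ∩ (chart x).symm ⁻¹' O) :=
  (relOpen_target x).inter_preimage (continuousOn_extChartAt_symm x) hO

lemma pt_mem_inter {p : M} {O : Set M} (hp : p ∈ O) :
    pt p ∈ (chart p).target ∩ (chart p).symm ⁻¹' O :=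
  ⟨mem_extChartAt_target p, by
    rw [Set.mem_preimage]; exact ((chart p).left_inv (mem_source p)).symm ▸ hp⟩

lemma read_pt (X : M → Amb m) (p : M) : read X p (pt p) = X p :=
  congrArg X ((chart p).left_inv (mem_source p))

variable [IsManifold (𝓡∂ 4) ∞ M] {Φ B : M → Amb m} (hΦ : IsImm Φ)
  (hB : ContMDiff (𝓡∂ 4) 𝓘(ℝ, Amb m) ∞ B)
include hΦ

lemma energyDensity_eq {x p : M} (h : p ∈ (chart x).source) :
    energyDensity Φ p = localDensity (read Φ x) (chart x p) := by
  rw [energyDensity, pt, (hΦ.transition p x).localDensity_eq (chart_mem_overlap (mem_source p) h),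
    trans_chart (mem_source p)]

lemma inner_willmore_eq (hB : IsNormalField Φ B) {x p : M} (h : p ∈ (chart x).source) :
    ⟪B p, willmore Φ p⟫_ℝ
      = ⟪read B x (chart x p), localWillmore (read Φ x) (chart x p)⟫_ℝ := by
  have := (hΦ.transition p x).inner_localWillmore_eq (b' := read B p) (read_smooth hB.smooth x)
    (fun _ hy => read_eq B hy) (hB.normal x) (chart_mem_overlap (mem_source p) h)
  rw [trans_chart (mem_source p)] at this
  have e : read B p (chart p p) = B p := read_pt B p
  rw [e] at this
  rw [willmore, pt]
  convert this using 2

include hB in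
lemma divFlux_eq {x p : M} (h : p ∈ (chart x).source) : divFlux Φ B p
    = divUp (read Φ x) (localFlux (read Φ x) (read B x)) (chart x p) := by
  rw [divFlux, pt, (hΦ.transition p x).div_localFlux_eq (read_smooth hB x)
    (fun _ hy => read_eq B hy) (chart_mem_overlap (mem_source p) h), trans_chart (mem_source p)]

include hB in
lemma flux_eq {x p : M} (h : p ∈ (chart x).source) (hp : p ∈ bdry M) : flux Φ B p
    = ∑ j, localFlux (read Φ x) (read B x) j (chart x p) * conormal (read Φ x) j (chart x p) := by
  have h0 : trans p x (chart p p) 0 = 0 := by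
    rw [trans_chart (mem_source p)]
    exact (pt_zero_eq_zero_iff hΦ h).1 hp
  rw [flux, pt, (hΦ.transition p x).flux_eq (read_smooth hB x)
    (fun _ hy => read_eq B hy) (chart_mem_overlap (mem_source p) h) h0, trans_chart (mem_source p)]

lemma continuous_energyDensity : Continuous (energyDensity Φ) :=
  continuousOn_univ.1 <| continuousOn_of_chart (fun x => localDensity (read Φ x))
    (fun x => (hΦ.imm x).localDensity_smooth.continuousOn) fun _ _ h _ => energyDensity_eq hΦ h

include hB in
lemma continuous_divFlux : Continuous (divFlux Φ B) :=
  continuousOn_univ.1 <| continuousOn_of_chart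
    (fun x => divUp (read Φ x) (localFlux (read Φ x) (read B x)))
    (fun x => ((hΦ.imm x).divUp_smooth
      ((hΦ.imm x).localFlux_smooth (read_smooth hB x))).continuousOn)
    fun _ _ h _ => divFlux_eq hΦ hB h

include hB in
lemma continuousOn_flux : ContinuousOn (flux Φ B) (bdry M) := by
  refine continuousOn_of_chart
    (fun x y => -(localFlux (read Φ x) (read B x) 0 y * (Real.sqrt (metricInv (read Φ x) y 0 0))⁻¹))
    (fun x => ?_) fun x p h hp => ?_
  · have hF := hΦ.imm x
    have h1 := (hF.metricInv_smooth 0 0).continuousOn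
    exact ((hF.localFlux_smooth (read_smooth hB x) 0).continuousOn.mul
      ((h1.sqrt).inv₀ fun y hy => (Real.sqrt_pos.2 (hF.metricInv_zero_pos hy)).ne')).neg
  · rw [flux_eq hΦ hB h hp]
    simp only [conormal, mul_ite, mul_zero, Finset.sum_ite_eq', Finset.mem_univ, if_true]
    ring

omit hΦ in
/-- The first variation formula as the derivative of `jetEnergy` along the jet of the variation. -/
lemma fderiv_jetEnergy {F b : Coord → Amb m} {U : Set Coord} (hF : Imm F U)
    (hb : ContDiffOn ℝ ∞ b U) (hbn : ∀ z ∈ U, ∀ k, ⟪b z, pd k F z⟫_ℝ = 0) {y : Coord} (hy : y ∈ U) :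
    fderiv ℝ jetEnergy (jet' F y) (jet' b y)
      = volDensity F y * (⟪b y, localWillmore F y⟫_ℝ + divUp F (localFlux F b) y) := by
  have h1 : DifferentiableAt ℝ jetEnergy (jet' F y) :=
    (jetEnergy_smooth.contDiffAt ((isOpen_immJets.prod isOpen_univ).mem_nhds
      (show jet' F y ∈ immJets m ×ˢ Set.univ from ⟨hF.jet_mem hy, trivial⟩))).differentiableAt
      (by simp)
  have h2 : HasFDerivAt jetEnergy (fderiv ℝ jetEnergy (jet' F y))
      (jet' F y + (0 : ℝ) • jet' b y) := by
    rw [zero_smul, add_zero]; exact h1.hasFDerivAt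
  have h3 := h2.comp_hasDerivAt (0 : ℝ) (hasDerivAt_line (jet' F y) (jet' b y))
  exact h3.unique (hF.hasDerivAt_jetEnergy hb hbn hy)

/-- Continuity of `B · 𝒲`, as the first variation of the energy density less a divergence. -/
lemma continuous_inner_willmore (hB : IsNormalField Φ B) :
    Continuous fun p => ⟪B p, willmore Φ p⟫_ℝ := by
  refine continuousOn_univ.1 <| continuousOn_of_chart
    (fun x y => fderiv ℝ jetEnergy (jet' (read Φ x) y) (jet' (read B x) y)
      * (volDensity (read Φ x) y)⁻¹ - divUp (read Φ x) (localFlux (read Φ x) (read B x)) y)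
    (fun x => ?_) fun x p h _ => ?_
  · have hF := hΦ.imm x
    have hb := read_smooth hB.smooth x
    have hO : IsOpen (immJets m ×ˢ (Set.univ : Set (Fin 4 → Jet m))) :=
      isOpen_immJets.prod isOpen_univ
    have h1 : ContinuousOn (fun y => fderiv ℝ (jetEnergy (m := m)) (jet' (read Φ x) y))
        (chart x).target :=
      (jetEnergy_smooth.continuousOn_fderiv_of_isOpen hO (by simp)).comp
        (hF.jet'_smooth hF.smooth).continuousOn fun y hy => ⟨hF.jet_mem hy, trivial⟩
    exact ((h1.clm_apply (hF.jet'_smooth hb).continuousOn).mul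
      (hF.volDensity_smooth.continuousOn.inv₀ fun y hy => (hF.volDensity_pos hy).ne')).sub
      ((hF.divUp_smooth (hF.localFlux_smooth hb)).continuousOn)
  · have hy := (chart x).map_source h
    rw [inner_willmore_eq hΦ hB h, fderiv_jetEnergy (hΦ.imm x) (read_smooth hB.smooth x)
      (hB.normal x) hy]
    have := (hΦ.imm x).volDensity_pos hy
    field_simp
    ring

lemma localFlux_eq_zero {x : M} {y : Coord}
    (hy : y ∈ (chart x).target ∩ (chart x).symm ⁻¹' (tsupport B)ᶜ) (j : Fin 4) :
    localFlux (read Φ x) (read B x) j y = 0 := by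
  have hU := relOpen_inter (x := x) (isClosed_tsupport B).isOpen_compl
  have hF := (hΦ.imm x).mono hU Set.inter_subset_left
  have hb : ∀ z ∈ (chart x).target ∩ (chart x).symm ⁻¹' (tsupport B)ᶜ, read B x z = 0 :=
    fun z hz => image_eq_zero_of_notMem_tsupport (f := B) hz.2
  rw [hF.localFlux_congr (c := 0) hb hy, hF.localFlux_zero hy]

lemma divFlux_eq_zero {p : M} (hp : p ∉ tsupport B) : divFlux Φ B p = 0 := by
  have hU := relOpen_inter (x := p) (isClosed_tsupport B).isOpen_compl
  have hF := (hΦ.imm p).mono hU Set.inter_subset_left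
  have hy := pt_mem_inter (O := (tsupport B)ᶜ) hp
  rw [divFlux, hF.divUp_congr (S := fun _ _ => 0) (fun j z hz => localFlux_eq_zero hΦ hz j) hy]
  simp [divUp, nablaUp, pd_const hU hy]

lemma flux_eq_zero {p : M} (hp : p ∉ tsupport B) : flux Φ B p = 0 := by
  simp only [flux, localFlux_eq_zero hΦ (pt_mem_inter (O := (tsupport B)ᶜ) hp), zero_mul,
    Finset.sum_const_zero]

lemma hasCompactSupport_divFlux (hs : HasCompactSupport B) : HasCompactSupport (divFlux Φ B) :=
  hs.mono' fun _ hp => by_contra fun h => hp (divFlux_eq_zero hΦ h)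

include hB in
lemma divFlux_add {B' : M → Amb m} (hB' : ContMDiff (𝓡∂ 4) 𝓘(ℝ, Amb m) ∞ B') (p : M) :
    divFlux Φ (B + B') p = divFlux Φ B p + divFlux Φ B' p := by
  have hF := hΦ.imm p
  have hp : pt p ∈ (chart p).target := mem_extChartAt_target p
  have hb := read_smooth hB p
  have hb' := read_smooth hB' p
  exact (hF.divUp_congr (fun j z hz => hF.localFlux_add hb hb' hz j) hp).trans
    (hF.divUp_add (hF.localFlux_smooth hb) (hF.localFlux_smooth hb') hp)

include hB in
lemma flux_add {B' : M → Amb m} (hB' : ContMDiff (𝓡∂ 4) 𝓘(ℝ, Amb m) ∞ B') (p : M) :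
    flux Φ (B + B') p = flux Φ B p + flux Φ B' p := by
  have hp : pt p ∈ (chart p).target := mem_extChartAt_target p
  have h : ∀ j, localFlux (read Φ p) (read (B + B') p) j (pt p) = _ := fun j =>
    (hΦ.imm p).localFlux_add (read_smooth hB p) (read_smooth hB' p) hp j
  simp only [flux, h, add_mul, Finset.sum_add_distrib]

lemma divFlux_sum {ι : Type*} (s : Finset ι) {B : ι → M → Amb m}
    (hB : ∀ k, ContMDiff (𝓡∂ 4) 𝓘(ℝ, Amb m) ∞ (B k)) (p : M) :
    divFlux Φ (∑ k ∈ s, B k) p = ∑ k ∈ s, divFlux Φ (B k) p := by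
  classical
  induction s using Finset.induction_on with
  | empty => exact divFlux_eq_zero hΦ (by simp)
  | insert k s hk ih =>
    rw [Finset.sum_insert hk, Finset.sum_insert hk, divFlux_add hΦ (hB k), ih]
    have := contMDiff_finsetSum (t := s) fun k _ => hB k
    convert this using 1
    ext p : 1
    simp

lemma flux_sum {ι : Type*} (s : Finset ι) {B : ι → M → Amb m}
    (hB : ∀ k, ContMDiff (𝓡∂ 4) 𝓘(ℝ, Amb m) ∞ (B k)) (p : M) :
    flux Φ (∑ k ∈ s, B k) p = ∑ k ∈ s, flux Φ (B k) p := by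
  classical
  induction s using Finset.induction_on with
  | empty => exact flux_eq_zero hΦ (by simp)
  | insert k s hk ih =>
    rw [Finset.sum_insert hk, Finset.sum_insert hk, flux_add hΦ (hB k), ih]
    have := contMDiff_finsetSum (t := s) fun k _ => hB k
    convert this using 1
    ext p : 1
    simp

section Integral

variable [SecondCountableTopology M]

omit hΦ in
/-- A finite smooth partition of unity near a compact set, subordinate to charts. -/
lemma exists_partition [T2Space M] {S : Set M} (hS : IsCompact S) :
    ∃ (t : Finset M) (ρ : t → M → ℝ),
    (∀ k, ContMDiff (𝓡∂ 4) 𝓘(ℝ) ∞ (ρ k)) ∧ (∀ k, tsupport (ρ k) ⊆ (chart k.1).source) ∧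
    ∀ p ∈ S, ∑ k, ρ k p = 1 := by
  have : LocallyCompactSpace (EuclideanHalfSpace 4) := (𝓡∂ 4).locallyCompactSpace
  have : LocallyCompactSpace M := ChartedSpace.locallyCompactSpace (EuclideanHalfSpace 4) M
  have : SigmaCompactSpace M := inferInstance
  obtain ⟨t, _, ht⟩ := hS.elim_nhds_subcover (fun x => (chart x).source)
    fun x _ => (isOpen_source x).mem_nhds (mem_source x)
  obtain ⟨f, hf⟩ := SmoothPartitionOfUnity.exists_isSubordinate (𝓡∂ 4) hS.isClosed
    (fun k : t => (chart k.1).source) (fun k => isOpen_source k.1) fun p hp => by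
      obtain ⟨x, hx, hpx⟩ := Set.mem_iUnion₂.1 (ht hp)
      exact Set.mem_iUnion.2 ⟨⟨x, hx⟩, hpx⟩
  exact ⟨t, fun k => f k, fun k => (f k).contMDiff, hf, fun p hp => by
    rw [← finsum_eq_sum_of_fintype]; exact f.sum_eq_one hp⟩

variable [MeasurableSpace M] [BorelSpace M]

include hB in
lemma integrable_divFlux (hs : HasCompactSupport B) : Integrable (divFlux Φ B) (vol Φ) := by
  have := isFiniteMeasureOnCompacts_vol hΦ
  exact (continuous_divFlux hΦ hB).integrable_of_hasCompactSupport
    (hasCompactSupport_divFlux hΦ hs)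

lemma restrict_bdry : (bdryVol Φ).restrict (bdry M) = bdryVol Φ :=
  Measure.restrict_eq_self_of_ae_mem (mem_ae_iff.2 (bdryVol_compl_bdry hΦ))

include hB in
lemma integrable_flux (hs : HasCompactSupport B) : Integrable (flux Φ B) (bdryVol Φ) := by
  have := isFiniteMeasureOnCompacts_bdryVol hΦ
  have hm : MeasurableSet (tsupport B) := (isClosed_tsupport B).measurableSet
  have h1 : IntegrableOn (flux Φ B) (tsupport B ∩ bdry M) (bdryVol Φ) :=
    ((continuousOn_flux hΦ hB).mono Set.inter_subset_right).integrableOn_compact'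
      (IsCompact.inter_right hs (isClosed_bdry hΦ))
      (hm.inter (isClosed_bdry hΦ).measurableSet)
  rw [IntegrableOn, ← Measure.restrict_restrict hm, restrict_bdry hΦ] at h1
  exact (integrableOn_iff_integrable_of_support_subset fun p hp =>
    by_contra fun h => hp (flux_eq_zero hΦ h)).1 h1

include hB in
/-- The divergence theorem for a variation supported in a chart. -/
lemma integral_divFlux_of_chart (hs : HasCompactSupport B) (x : M)
    (hx : tsupport B ⊆ (chart x).source) :
    ∫ p, divFlux Φ B p ∂(vol Φ) = ∫ p, flux Φ B p ∂(bdryVol Φ) := by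
  have hF := hΦ.imm x
  have hm := (isOpen_source x).measurableSet
  have hbm := (isClosed_bdry hΦ).measurableSet
  have e1 : (chart x).symm ⁻¹' (chart x).source ∩ (chart x).target = (chart x).target :=
    Set.inter_eq_right.2 fun y hy => (chart x).map_target hy
  have hbd : ∀ z ∈ bdryTarget x, bdryParam x z ∈ bdry M := fun z hz =>
    (pt_zero_eq_zero_iff hΦ ((chart x).map_target hz)).2
      (by rw [(chart x).right_inv hz, bdryPoint_zero])
  have e2 : bdryParam x ⁻¹' ((chart x).source ∩ bdry M) ∩ bdryTarget x = bdryTarget x :=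
    Set.inter_eq_right.2 fun z hz => ⟨(chart x).map_target hz, hbd z hz⟩
  have h1 : ∫ p, divFlux Φ B p ∂(vol Φ) = ∫ y in (chart x).target,
      volDensity (read Φ x) y * divUp (read Φ x) (localFlux (read Φ x) (read B x)) y := by
    rw [← setIntegral_eq_integral_of_forall_compl_eq_zero (s := (chart x).source)
      fun p hp => divFlux_eq_zero hΦ fun h => hp (hx h),
      setIntegral_vol hΦ x hm subset_rfl (continuous_divFlux hΦ hB).continuousOn, e1]
    refine setIntegral_congr_fun (relOpen_target x).measurableSet fun y hy => ?_
    rw [divFlux_eq hΦ hB ((chart x).map_target hy), (chart x).right_inv hy]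
  have h2 : ∫ p, flux Φ B p ∂(bdryVol Φ) = ∫ z in bdryTarget x,
      bdryDensity (read Φ x) (bdryPoint z) * ∑ j, localFlux (read Φ x) (read B x) j (bdryPoint z)
        * conormal (read Φ x) j (bdryPoint z) := by
    rw [← setIntegral_eq_integral_of_forall_compl_eq_zero (s := (chart x).source)
      fun p hp => flux_eq_zero hΦ fun h => hp (hx h), ← restrict_bdry hΦ,
      Measure.restrict_restrict hm, setIntegral_bdryVol hΦ x (hm.inter hbm) Set.inter_subset_left
      ((continuousOn_flux hΦ hB).mono Set.inter_subset_right), e2]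
    refine setIntegral_congr_fun (measurableSet_bdryTarget x) fun z hz => ?_
    rw [flux_eq hΦ hB ((chart x).map_target hz) (hbd z hz), (chart x).right_inv hz]
  rw [h1, h2]
  refine hF.integral_div_localFlux (read_smooth hB x)
    (C := chart x '' tsupport B) (IsCompact.image_of_continuousOn hs
      ((continuousOn_extChartAt x).mono hx)) ?_ fun z hz hzC => ?_
  · rintro _ ⟨p, hp, rfl⟩
    exact (chart x).map_source (hx hp)
  · have h : (chart x).symm z ∉ tsupport B := fun h => hzC ⟨_, h, (chart x).right_inv hz⟩
    exact image_eq_zero_of_notMem_tsupport (f := B) h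

variable [T2Space M]

include hB in
/-- The divergence theorem for the flux field of a compactly supported variation. -/
theorem integral_divFlux (hs : HasCompactSupport B) :
    ∫ p, divFlux Φ B p ∂(vol Φ) = ∫ p, flux Φ B p ∂(bdryVol Φ) := by
  obtain ⟨t, ρ, hρ, hρs, hρ1⟩ := exists_partition hs
  let C : t → M → Amb m := fun k p => ρ k p • B p
  have hC : ∀ k, ContMDiff (𝓡∂ 4) 𝓘(ℝ, Amb m) ∞ (C k) := fun k => (hρ k).smul hB
  have hCs : ∀ k, HasCompactSupport (C k) := fun k => hs.smul_left (f := ρ k)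
  have hCB : B = ∑ k, C k := by
    ext p : 1
    simp only [Finset.sum_apply, C, ← Finset.sum_smul]
    by_cases hp : p ∈ tsupport B
    · rw [hρ1 p hp, one_smul]
    · rw [image_eq_zero_of_notMem_tsupport hp, smul_zero]
  have h1 : divFlux Φ B = fun p => ∑ k, divFlux Φ (C k) p := by
    conv_lhs => rw [hCB]
    exact funext fun p => divFlux_sum hΦ _ hC p
  have h2 : flux Φ B = fun p => ∑ k, flux Φ (C k) p := by
    conv_lhs => rw [hCB]
    exact funext fun p => flux_sum hΦ _ hC p
  rw [h1, h2, integral_finsetSum _ fun k _ => integrable_divFlux hΦ (hC k) (hCs k),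
    integral_finsetSum _ fun k _ => integrable_flux hΦ (hC k) (hCs k)]
  exact Finset.sum_congr rfl fun k _ => integral_divFlux_of_chart hΦ (hC k) (hCs k) k.1
    ((tsupport_smul_subset_left (ρ k) B).trans (hρs k))

end Integral
end

/-! ### Differentiation under the integral sign -/

section

variable {m : ℕ}

/-- Differentiation of `∫ w f(q + t v)` over a compact set, for a smooth function `f`. -/
lemma hasDerivAt_setIntegral_line {E : Type*} [NormedAddCommGroup E] [NormedSpace ℝ E] {O : Set E}
    (hO : IsOpen O) {f : E → ℝ} (hf : ContDiffOn ℝ ∞ f O) {C : Set Coord} (hC : IsCompact C)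
    {q v : Coord → E} (hq : ContinuousOn q C) (hv : ContinuousOn v C) (hqO : Set.MapsTo q C O)
    {w : Coord → ℝ} (hw : ContinuousOn w C) :
    HasDerivAt (fun t : ℝ => ∫ y in C, w y * f (q y + t • v y))
      (∫ y in C, w y * fderiv ℝ f (q y) (v y)) 0 := by
  have hf' : ContinuousOn (fderiv ℝ f) O := hf.continuousOn_fderiv_of_isOpen hO (by simp)
  have hm : MeasurableSet C := hC.measurableSet
  -- the lines stay in the domain of smoothness for small times
  have hP : IsCompact ((fun y => (q y, v y)) '' C) := hC.image_of_continuousOn (hq.prodMk hv)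
  have hev : ∀ᶠ t : ℝ in 𝓝 0, ∀ p ∈ (fun y => (q y, v y)) '' C, p.1 + t • p.2 ∈ O := by
    refine hP.eventually_forall_of_forall_eventually ?_
    rintro _ ⟨y, hy, rfl⟩
    have hc : Continuous fun z : ℝ × (E × E) => z.2.1 + z.1 • z.2.2 := by fun_prop
    refine hc.continuousAt.preimage_mem_nhds (hO.mem_nhds ?_)
    simp only [zero_smul, add_zero]
    exact hqO hy
  obtain ⟨δ, hδ, hball⟩ := Metric.nhds_basis_closedBall.mem_iff.1 hev
  have hmem : ∀ t ∈ Metric.closedBall (0 : ℝ) δ, ∀ y ∈ C, q y + t • v y ∈ O :=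
    fun t ht y hy => hball ht _ ⟨y, hy, rfl⟩
  have hline : ∀ t : ℝ, ContinuousOn (fun y => q y + t • v y) C := fun t => hq.add (hv.const_smul t)
  -- a bound for the derivative, by compactness
  obtain ⟨A, hA⟩ : ∃ A : ℝ, ∀ z ∈ Metric.closedBall (0 : ℝ) δ ×ˢ C,
      ‖w z.2 * fderiv ℝ f (q z.2 + z.1 • v z.2) (v z.2)‖ ≤ A := by
    refine ((isCompact_closedBall (0 : ℝ) δ).prod hC).exists_bound_of_continuousOn ?_
    have h2 : ContinuousOn (Prod.snd : ℝ × Coord → Coord) (Metric.closedBall (0 : ℝ) δ ×ˢ C) :=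
      continuousOn_snd
    have hs : Set.MapsTo (Prod.snd : ℝ × Coord → Coord) (Metric.closedBall (0 : ℝ) δ ×ˢ C) C :=
      fun z hz => hz.2
    have hv2 := hv.comp h2 hs
    refine (hw.comp h2 hs).mul ((hf'.comp ((hq.comp h2 hs).add (continuousOn_fst.smul hv2))
      fun z hz => hmem z.1 hz.1 z.2 hz.2).clm_apply hv2)
  have hcont : ∀ t ∈ Metric.closedBall (0 : ℝ) δ,
      ContinuousOn (fun y => w y * f (q y + t • v y)) C := fun t ht =>
    hw.mul (hf.continuousOn.comp (hline t) fun y hy => hmem t ht y hy)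
  have h0 : (0 : ℝ) ∈ Metric.closedBall (0 : ℝ) δ := Metric.mem_closedBall_self hδ.le
  have key := hasDerivAt_integral_of_dominated_loc_of_deriv_le
    (μ := volume.restrict C) (F := fun (t : ℝ) y => w y * f (q y + t • v y))
    (F' := fun (t : ℝ) y => w y * fderiv ℝ f (q y + t • v y) (v y))
    (x₀ := (0 : ℝ)) (s := Metric.closedBall 0 δ) (bound := fun _ => A)
    (Metric.closedBall_mem_nhds 0 hδ)
    (by
      filter_upwards [Metric.closedBall_mem_nhds (0 : ℝ) hδ] with t ht
      exact (hcont t ht).aestronglyMeasurable hm)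
    ((hcont 0 h0).integrableOn_compact' hC hm)
    ((hw.mul ((hf'.comp (hline 0) fun y hy => hmem 0 h0 y hy).clm_apply
      hv)).aestronglyMeasurable hm)
    ((ae_restrict_iff' hm).2 (ae_of_all _ fun y hy t ht => hA (t, y) ⟨ht, hy⟩))
    (integrableOn_const (hC.measure_lt_top.ne))
    ((ae_restrict_iff' hm).2 (ae_of_all _ fun y hy t ht => by
      have h1 : DifferentiableAt ℝ f (q y + t • v y) :=
        (hf.contDiffAt (hO.mem_nhds (hmem t ht y hy))).differentiableAt (by simp)
      have h2 : HasDerivAt (fun s : ℝ => q y + s • v y) (v y) t := by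
        simpa using ((hasDerivAt_id t).smul_const (v y)).const_add (q y)
      exact (h1.hasFDerivAt.comp_hasDerivAt t h2).const_mul (w y)))
  have h := key.2
  simp only [zero_smul, add_zero] at h
  exact h

/-- The derivative of the energy of a compact part of a chart, in terms of jets. -/
lemma hasDerivAt_integral_jetEnergy {F b : Coord → Amb m} {U : Set Coord} (hF : Imm F U)
    (hb : ContDiffOn ℝ ∞ b U) {C : Set Coord} (hC : IsCompact C) (hCU : C ⊆ U) {w : Coord → ℝ}
    (hw : ContinuousOn w C) :
    HasDerivAt (fun t : ℝ => ∫ y in C, w y * jetEnergy (jet' F y + t • jet' b y))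
      (∫ y in C, w y * fderiv ℝ jetEnergy (jet' F y) (jet' b y)) 0 :=
  hasDerivAt_setIntegral_line (isOpen_immJets.prod isOpen_univ) jetEnergy_smooth hC
    ((hF.jet'_smooth hF.smooth).continuousOn.mono hCU)
    ((hF.jet'_smooth hb).continuousOn.mono hCU) (fun _ hy => ⟨hF.jet_mem (hCU hy), trivial⟩) hw

end

/-! ### The first variation of the energy -/

section

variable {m : ℕ} {M : Type*} [TopologicalSpace M] [ChartedSpace (EuclideanHalfSpace 4) M]
  [IsManifold (𝓡∂ 4) ∞ M] {Φ B : M → Amb m} (hΦ : IsImm Φ)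

/-- The energy density is local. -/
lemma energyDensity_congr {Ψ : M → Amb m} (hΦ : IsImm Φ) (hΨ : IsImm Ψ) {O : Set M} (hO : IsOpen O)
    (h : ∀ p ∈ O, Φ p = Ψ p) {p : M} (hp : p ∈ O) : energyDensity Φ p = energyDensity Ψ p := by
  have hU := relOpen_inter (x := p) hO
  have hy := pt_mem_inter hp
  have hF := (hΦ.imm p).mono hU Set.inter_subset_left
  have hG := (hΨ.imm p).mono hU Set.inter_subset_left
  have h1 : ∀ z ∈ (chart p).target ∩ (chart p).symm ⁻¹' O, ∀ k,
      pd k (read Φ p) z = pd k (read Ψ p) z := fun z hz k =>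
    hU.pd_congr (fun w hw => h _ hw.2) hz k
  have h2 : ∀ z ∈ (chart p).target ∩ (chart p).symm ⁻¹' O, jet (read Φ p) z = jet (read Ψ p) z :=
    fun z hz => Prod.ext (funext fun k => h1 z hz k) (funext fun i => funext fun j =>
      hU.pd_congr (fun w hw => h1 w hw j) hz i)
  rw [energyDensity, energyDensity, hF.localDensity_eq hy, hG.localDensity_eq hy]
  congr 1
  exact Prod.ext (h2 _ hy) (funext fun i => hU.pd_congr h2 hy i)

include hΦ

/-- Small compactly supported variations of an immersion are immersions. -/
lemma eventually_isImm (hB : ContMDiff (𝓡∂ 4) 𝓘(ℝ, Amb m) ∞ B) (hs : HasCompactSupport B) :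
    ∀ᶠ t : ℝ in 𝓝 0, IsImm (Φ + t • B) := by
  have hsm : ∀ t : ℝ, ContMDiff (𝓡∂ 4) 𝓘(ℝ, Amb m) ∞ (Φ + t • B) := fun t =>
    hΦ.smooth.add ((contMDiff_const (I := 𝓡∂ 4) (I' := 𝓘(ℝ)) (c := t)).smul hB)
  have h1 : ∀ᶠ t : ℝ in 𝓝 0, ∀ q ∈ tsupport B, ImmAt (Φ + t • B) q := by
    refine IsCompact.eventually_forall_of_forall_eventually hs fun p _ => ?_
    have hF := hΦ.imm p
    have hj : ∀ {X : M → Amb m}, ContMDiff (𝓡∂ 4) 𝓘(ℝ, Amb m) ∞ X →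
        ContinuousAt (fun q => jet (read X p) (chart p q)) p := fun hX =>
      (((hF.jet_smooth (read_smooth hX p)).continuousOn.comp (continuousOn_extChartAt p)
        fun q hq => (chart p).map_source hq) p (mem_source p)).continuousAt
        ((isOpen_source p).mem_nhds (mem_source p))
    have hc : ContinuousAt (fun z : ℝ × M => jet (read Φ p) (chart p z.2)
        + z.1 • jet (read B p) (chart p z.2)) (0, p) :=
      ((hj hΦ.smooth).comp_of_eq continuousAt_snd rfl).add
        (continuousAt_fst.smul ((hj hB).comp_of_eq continuousAt_snd rfl))
    have h0 : jet (read Φ p) (chart p p) + (0 : ℝ) • jet (read B p) (chart p p)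
        ∈ immJets m := by
      simp only [zero_smul, add_zero]
      exact hΦ.immAt p
    filter_upwards [hc.preimage_mem_nhds (isOpen_immJets.mem_nhds h0),
      continuousAt_snd.preimage_mem_nhds ((isOpen_source p).mem_nhds (mem_source p))]
      with z hz hzp
    have hzp' : z.2 ∈ (chart p).source := hzp
    rw [immAt_iff (hsm z.1) hzp']
    have e := hF.jet_add_smul hF.smooth (read_smooth hB p) z.1 ((chart p).map_source hzp')
    exact (show jet (read (Φ + z.1 • B) p) (chart p z.2) = _ from e) ▸ hz
  filter_upwards [h1] with t ht
  refine ⟨hsm t, fun q => ?_⟩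
  by_cases hq : q ∈ tsupport B
  · exact ht q hq
  -- near points off the support the map does not change
  · have hU := relOpen_inter (x := q) (isClosed_tsupport B).isOpen_compl
    have hy := pt_mem_inter (O := (tsupport B)ᶜ) hq
    have h2 : ∀ k, pd k (read (Φ + t • B) q) (pt q) = pd k (read Φ q) (pt q) := fun k =>
      hU.pd_congr (fun z hz => by
        have : B ((chart q).symm z) = 0 := image_eq_zero_of_notMem_tsupport (f := B) hz.2
        simp only [read, Function.comp_apply, Pi.add_apply, Pi.smul_apply]
        rw [this, smul_zero, add_zero]) hy k
    have h3 : (jet (read (Φ + t • B) q) (pt q)).1 = (jet (read Φ q) (pt q)).1 := funext h2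
    have h4 := hΦ.immAt q
    simp only [ImmAt, immJets, Set.mem_ofPred_eq] at h4 ⊢
    rwa [h3]

variable [T2Space M] [SecondCountableTopology M] [MeasurableSpace M] [BorelSpace M]

omit [T2Space M] in
lemma integrableOn_energyDensity {K : Set M} (hK : IsCompact K) (hKm : MeasurableSet K) :
    IntegrableOn (energyDensity Φ) K (vol Φ) := by
  have := isFiniteMeasureOnCompacts_vol hΦ
  exact (continuous_energyDensity hΦ).continuousOn.integrableOn_compact' hK hKm

omit [T2Space M] in
/-- The energy of a compact part of a chart, in terms of jets. -/
lemma setIntegral_energyDensity_add_smul (hB : ContMDiff (𝓡∂ 4) 𝓘(ℝ, Amb m) ∞ B) {t : ℝ}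
    (ht : IsImm (Φ + t • B)) {x : M} {C : Set M} (hC : MeasurableSet C)
    (hCx : C ⊆ (chart x).source) {ρ : M → ℝ} (hρ : Continuous ρ) :
    ∫ p in C, ρ p * energyDensity (Φ + t • B) p ∂(vol (Φ + t • B))
      = ∫ y in (chart x).symm ⁻¹' C ∩ (chart x).target, ρ ((chart x).symm y)
        * jetEnergy (jet' (read Φ x) y + t • jet' (read B x) y) := by
  rw [setIntegral_vol ht x hC hCx (f := fun p => ρ p * energyDensity (Φ + t • B) p)
    (hρ.mul (continuous_energyDensity ht)).continuousOn]
  refine setIntegral_congr_fun (measurableSet_inter_preimage (relOpen_target x).measurableSet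
    (continuousOn_extChartAt_symm x) hC) fun y hy => ?_
  have hF := hΦ.imm x
  have hb := read_smooth hB x
  have h1 := (ht.imm x).jet_mem hy.2
  have h2 : jet (read (Φ + t • B) x) y = _ := hF.jet_add_smul hF.smooth hb t hy.2
  rw [h2] at h1
  have h3 := hF.density_mul_vol_add_smul hb hy.2 h1
  rw [← h3, energyDensity_eq ht ((chart x).map_target hy.2), (chart x).right_inv hy.2]
  change _ * (_ * localDensity (read Φ x + t • read B x) y) = _
  change volDensity (read Φ x + t • read B x) y * _ = _
  ring

/-- The first variation of the energy of the support of a normal variation. -/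
lemma hasDerivAt_integral_tsupport (hB : IsNormalField Φ B) (hs : HasCompactSupport B) :
    HasDerivAt
      (fun t : ℝ => ∫ p in tsupport B, energyDensity (Φ + t • B) p ∂(vol (Φ + t • B)))
      ((∫ p, ⟪B p, willmore Φ p⟫_ℝ ∂(vol Φ)) + ∫ p, flux Φ B p ∂(bdryVol Φ)) 0 := by
  obtain ⟨t, ρ, hρ, hρs, hρ1⟩ := exists_partition hs
  have hS : MeasurableSet (tsupport B) := (isClosed_tsupport B).measurableSet
  have hfin := isFiniteMeasureOnCompacts_vol hΦ
  -- the parts of the support on which the functions of the partition live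
  let C : t → Set M := fun k => tsupport B ∩ tsupport (ρ k)
  have hCc : ∀ k, IsCompact (C k) := fun k => IsCompact.inter_right hs (isClosed_tsupport _)
  have hCm : ∀ k, MeasurableSet (C k) := fun k => hS.inter (isClosed_tsupport _).measurableSet
  have hCx : ∀ k, C k ⊆ (chart k.1).source := fun k => Set.inter_subset_right.trans (hρs k)
  -- `Ψ` ranges over the varied immersions, whose volume measures differ
  have hsplit : ∀ {Ψ : M → Amb m}, IsImm Ψ → ∀ {f : M → ℝ}, Continuous f →
      ∫ p in tsupport B, f p ∂(vol Ψ) = ∑ k, ∫ p in C k, ρ k p * f p ∂(vol Ψ) := by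
    intro Ψ hΨ f hf
    have := isFiniteMeasureOnCompacts_vol hΨ
    have h1 : ∫ p in tsupport B, f p ∂(vol Ψ)
        = ∫ p in tsupport B, ∑ k, ρ k p * f p ∂(vol Ψ) :=
      setIntegral_congr_fun hS fun p hp => by
        simp only [← Finset.sum_mul]
        rw [hρ1 p hp, one_mul]
    rw [h1, integral_finsetSum (f := fun k p => ρ k p * f p) _ fun k _ =>
      (((hρ k).continuous.mul hf).continuousOn.integrableOn_compact' hs hS)]
    refine Finset.sum_congr rfl fun k _ => ?_
    refine setIntegral_eq_of_subset_of_forall_sdiff_eq_zero hS Set.inter_subset_left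
      fun p hp => ?_
    have : p ∉ tsupport (ρ k) := fun h => hp.2 ⟨hp.1, h⟩
    rw [image_eq_zero_of_notMem_tsupport this, zero_mul]
  let D : t → Set Coord := fun k => (chart k.1).symm ⁻¹' (C k) ∩ (chart k.1).target
  have hD : ∀ k, D k = chart k.1 '' C k := fun k => by
    ext y
    constructor
    · exact fun hy => ⟨_, hy.1, (chart k.1).right_inv hy.2⟩
    · rintro ⟨p, hp, rfl⟩
      refine ⟨?_, (chart k.1).map_source (hCx k hp)⟩
      rw [Set.mem_preimage, (chart k.1).left_inv (hCx k hp)]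
      exact hp
  have hDc : ∀ k, IsCompact (D k) := fun k => by
    rw [hD k]
    exact (hCc k).image_of_continuousOn ((continuousOn_extChartAt k.1).mono (hCx k))
  have hder : ∀ k, HasDerivAt (fun s : ℝ => ∫ y in D k, ρ k ((chart k.1).symm y)
      * jetEnergy (jet' (read Φ k.1) y + s • jet' (read B k.1) y))
      (∫ p in C k, ρ k p * (⟪B p, willmore Φ p⟫_ℝ + divFlux Φ B p) ∂(vol Φ)) 0 := fun k => by
    have h := hasDerivAt_integral_jetEnergy (hΦ.imm k.1) (read_smooth hB.smooth k.1) (hDc k)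
      Set.inter_subset_right (w := fun y => ρ k ((chart k.1).symm y))
      ((hρ k).continuous.comp_continuousOn
        ((continuousOn_extChartAt_symm k.1).mono Set.inter_subset_right))
    refine h.congr_deriv ?_
    rw [setIntegral_vol hΦ k.1 (hCm k) (hCx k)
      (f := fun p => ρ k p * (⟪B p, willmore Φ p⟫_ℝ + divFlux Φ B p)) ((hρ k).continuous.mul
      ((continuous_inner_willmore hΦ hB).add (continuous_divFlux hΦ hB.smooth))).continuousOn]
    refine setIntegral_congr_fun (hDc k).measurableSet fun y hy => ?_
    have hy' := (chart k.1).map_target hy.2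
    rw [inner_willmore_eq hΦ hB hy', divFlux_eq hΦ hB.smooth hy', (chart k.1).right_inv hy.2,
      fderiv_jetEnergy (hΦ.imm k.1) (read_smooth hB.smooth k.1) (hB.normal k.1) hy.2]
    ring
  have hsum := HasDerivAt.fun_sum (u := Finset.univ) fun k _ => hder k
  have h1 : (fun s : ℝ => ∫ p in tsupport B, energyDensity (Φ + s • B) p ∂(vol (Φ + s • B)))
      =ᶠ[𝓝 0] fun s => ∑ k, ∫ y in D k, ρ k ((chart k.1).symm y)
      * jetEnergy (jet' (read Φ k.1) y + s • jet' (read B k.1) y) := by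
    filter_upwards [eventually_isImm hΦ hB.smooth hs] with s hsI
    rw [hsplit hsI (continuous_energyDensity hsI)]
    exact Finset.sum_congr rfl fun k _ =>
      setIntegral_energyDensity_add_smul hΦ hB.smooth hsI (hCm k) (hCx k) (hρ k).continuous
  refine (hsum.congr_of_eventuallyEq h1).congr_deriv ?_
  have hW := continuous_inner_willmore hΦ hB
  have hW0 : ∀ p, p ∉ tsupport B → ⟪B p, willmore Φ p⟫_ℝ = 0 := fun p hp => by
    rw [image_eq_zero_of_notMem_tsupport hp, inner_zero_left]
  have hWi : Integrable (fun p => ⟪B p, willmore Φ p⟫_ℝ) (vol Φ) :=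
    hW.integrable_of_hasCompactSupport (hs.mono' fun p hp => by_contra fun h => hp (hW0 p h))
  rw [← hsplit hΦ (f := fun p => ⟪B p, willmore Φ p⟫_ℝ + divFlux Φ B p)
      (hW.add (continuous_divFlux hΦ hB.smooth)),
    setIntegral_eq_integral_of_forall_compl_eq_zero fun p hp => by
      rw [hW0 p hp, divFlux_eq_zero hΦ hp, add_zero],
    integral_add hWi (integrable_divFlux hΦ hB.smooth hs), integral_divFlux hΦ hB.smooth hs]

end

section

variable {m : ℕ} {M : Type*} [TopologicalSpace M] [ChartedSpace (EuclideanHalfSpace 4) M]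
  [IsManifold (𝓡∂ 4) ∞ M] {Φ B : M → Amb m} (hΦ : IsImm Φ) [SecondCountableTopology M]
  [MeasurableSpace M] [BorelSpace M]
include hΦ

/-- The energy of a variation off the support of the variation. -/
lemma energy_diff_tsupport {t : ℝ} (ht : IsImm (Φ + t • B)) {K : Set M} (hK : MeasurableSet K) :
    (IntegrableOn (energyDensity Φ) (K \ tsupport B) (vol Φ) →
      IntegrableOn (energyDensity (Φ + t • B)) (K \ tsupport B) (vol (Φ + t • B))) ∧
    ∫ p in K \ tsupport B, energyDensity (Φ + t • B) p ∂(vol (Φ + t • B))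
      = ∫ p in K \ tsupport B, energyDensity Φ p ∂(vol Φ) := by
  have hO := (isClosed_tsupport B).isOpen_compl
  have heq : ∀ p ∈ (tsupport B)ᶜ, Φ p = (Φ + t • B) p := fun p hp => by
    rw [Pi.add_apply, Pi.smul_apply, image_eq_zero_of_notMem_tsupport hp, smul_zero, add_zero]
  have hm : MeasurableSet (K \ tsupport B) := hK.diff (isClosed_tsupport B).measurableSet
  have h1 : (vol (Φ + t • B)).restrict (K \ tsupport B) = (vol Φ).restrict (K \ tsupport B) := by
    have e : K ∩ (tsupport B)ᶜ = K \ tsupport B := rfl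
    rw [← e, ← Measure.restrict_restrict hK, ← Measure.restrict_restrict hK,
      restrict_vol_congr hΦ ht hO heq]
  have h2 : ∀ p ∈ K \ tsupport B, energyDensity Φ p = energyDensity (Φ + t • B) p :=
    fun p hp => energyDensity_congr hΦ ht hO heq hp.2
  refine ⟨fun h => ?_, ?_⟩
  · rw [IntegrableOn, h1]
    exact (integrableOn_congr_fun h2 hm).1 h
  · rw [h1]
    exact (setIntegral_congr_fun hm h2).symm

end

end FourWillmore

end

theorem mainTheorem2 {m : ℕ} {M : Type*} [TopologicalSpace M] [T2Space M]
    [SecondCountableTopology M] [ChartedSpace (EuclideanHalfSpace 4) M]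
    [IsManifold (𝓡∂ 4) ∞ M] [MeasurableSpace M] [BorelSpace M]
    (Φ B : M → EuclideanSpace ℝ (Fin m))
    (hΦ : ContMDiff (𝓡∂ 4) 𝓘(ℝ, EuclideanSpace ℝ (Fin m)) ∞ Φ)
    (himm : ∀ p : M,
      Function.Injective (mfderiv (𝓡∂ 4) 𝓘(ℝ, EuclideanSpace ℝ (Fin m)) Φ p))
    (hB : ContMDiff (𝓡∂ 4) 𝓘(ℝ, EuclideanSpace ℝ (Fin m)) ∞ B)
    (hnormal : ∀ (p : M) (v : TangentSpace (𝓡∂ 4) p),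
      ⟪B p, (mfderiv (𝓡∂ 4) 𝓘(ℝ, EuclideanSpace ℝ (Fin m)) Φ p v : EuclideanSpace ℝ (Fin m))⟫_ℝ
        = 0)
    (hsupp : HasCompactSupport B) :
    Integrable (fun p => ⟪B p, FourWillmore.willmore Φ p⟫_ℝ) (FourWillmore.vol Φ) ∧
    Integrable (FourWillmore.flux Φ B) (FourWillmore.bdryVol Φ) ∧
    (∀ K : Set M, IsCompact K →
      IntegrableOn (FourWillmore.energyDensity Φ) K (FourWillmore.vol Φ)) ∧
    ∀ K : Set M, MeasurableSet K → tsupport B ⊆ K →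
      IntegrableOn (FourWillmore.energyDensity Φ) K (FourWillmore.vol Φ) →
      (∀ᶠ t : ℝ in 𝓝 0, IntegrableOn (FourWillmore.energyDensity (Φ + t • B)) K
        (FourWillmore.vol (Φ + t • B))) ∧
      HasDerivAt (fun t : ℝ => FourWillmore.energy (Φ + t • B) K)
        ((∫ p, ⟪B p, FourWillmore.willmore Φ p⟫_ℝ ∂(FourWillmore.vol Φ)) +
          ∫ p, FourWillmore.flux Φ B p ∂(FourWillmore.bdryVol Φ)) 0 := by
  have hI : FourWillmore.IsImm Φ := FourWillmore.isImm_of_mfderiv hΦ himm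
  have hN : FourWillmore.IsNormalField Φ B := hI.isNormalField hB hnormal
  have hfin := FourWillmore.isFiniteMeasureOnCompacts_vol hI
  refine ⟨(FourWillmore.continuous_inner_willmore hI hN).integrable_of_hasCompactSupport
    (hsupp.mono' fun p hp => by_contra fun h => hp ?_),
    FourWillmore.integrable_flux hI hB hsupp,
    fun K hK => FourWillmore.integrableOn_energyDensity hI hK hK.measurableSet,
    fun K hK hBK hKi => ?_⟩
  · simp only [image_eq_zero_of_notMem_tsupport h, inner_zero_left]
  have hS : MeasurableSet (tsupport B) := (isClosed_tsupport B).measurableSet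
  have hdisj : Disjoint (tsupport B) (K \ tsupport B) := Set.disjoint_sdiff_right
  have hun : tsupport B ∪ K \ tsupport B = K := Set.union_sdiff_cancel hBK
  have hev := FourWillmore.eventually_isImm hI hB hsupp
  have hint : ∀ t : ℝ, FourWillmore.IsImm (Φ + t • B) →
      IntegrableOn (FourWillmore.energyDensity (Φ + t • B)) (tsupport B)
        (FourWillmore.vol (Φ + t • B)) ∧
      IntegrableOn (FourWillmore.energyDensity (Φ + t • B)) (K \ tsupport B)
        (FourWillmore.vol (Φ + t • B)) := fun t ht =>
    ⟨FourWillmore.integrableOn_energyDensity ht hsupp hS,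
      (FourWillmore.energy_diff_tsupport hI ht hK).1 (hKi.mono_set Set.sdiff_subset)⟩
  refine ⟨?_, ?_⟩
  · filter_upwards [hev] with t ht
    rw [← hun]
    exact (hint t ht).1.union (hint t ht).2
  · have h := (FourWillmore.hasDerivAt_integral_tsupport hI hN hsupp).add_const
      (∫ p in K \ tsupport B, FourWillmore.energyDensity Φ p ∂(FourWillmore.vol Φ))
    refine h.congr_of_eventuallyEq ?_
    filter_upwards [hev] with t ht
    -- off the support of the variation the energy does not change
    rw [← (FourWillmore.energy_diff_tsupport hI ht hK).2,
      ← setIntegral_union hdisj (hK.diff hS) (hint t ht).1 (hint t ht).2, hun]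
    rfl
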